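/- **Conventions.** A (smooth) conservative system on a manifold $M$ is a smooth Riemannian metric $g$ together with a smooth function $U$ on $M$; its Hamiltonian on $T^*M$ is $H=K+U$ with $K=\frac12\sum g^{ij}p_ip_j$. It is written $H=ds^2+U$, where $ds^2$ is the metric $g$. An integral of degree $m$ in momenta is a smooth function $F:T^*M\to\mathbb R$ with $\{F,H\}=0$ that in local coordinates is a polynomial of degree at most $m$ in the momenta, and that is functionally independent of $H$ (that is, $dF$ and $dH$ are not everywhere linearly dependent). Two systems $K_1+U_1$, $K_2+U_2$ on $M$ are equivalent if there is a diffeomorphism $\phi$ of $M$, with induced fibrewise linear map $\Phi$ of $T^*M$ (on the fibre over $x$, the inverse of the transpose of $d\phi_x$), and there are nonzero constants $\kappa,\tilde\kappa$ such that $\Phi^*K_1=\kappa K_2$ and $\phi^*U_1=\tilde\kappa U_2$. On $S^2=\{u_1^2+u_2^2+u_3^2=1\}$ the Goryachev systems are $$H=\frac{du_1^2+du_2^2+2du_3^2}{2u_1^2+2u_2^2+u_3^2}-2B_1u_1u_2-B_2(u_1^2-u_2^2)-u_1,\qquad B_1,B_2\in\mathbb R,$$ and the Kovalevskaya system is the one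 with $B_1=B_2=0$. **Theorem.** Let $A=1+au^2+u^4$ and $$H_p=\frac{A^{1/2}-u^2+p}{A^{1/2}}\left(d\varphi^2+A^{-1/2}du^2\right)-\frac{u\left((a+2u^2)-2A^{1/2}\right)}{2\left(A^{1/2}-u^2+p\right)}\cos\varphi ,$$ where either $a>2$ and $p\in(-\infty,-\frac a2)\cup(-1,\infty)$, or $-2<a<2$ and $p\in(-\infty,-1)\cup(-\frac a2,\infty)$. Let $y(u)=\int_0^u A(t)^{-1/4}\,dt$, and regard $(\varphi,u)$, with $\varphi\in\mathbb R/2\pi\mathbb Z$ and $u\in\mathbb R$, as coordinates on $S^2$ minus its two poles $(0,0,\pm1)$ by $$(\varphi,u)\mapsto\left(\frac{\cos\varphi}{\cosh y(u)},\frac{\sin\varphi}{\cosh y(u)},\tanh y(u)\right),$$ so that $(e^{y(u)},\varphi)$ are polar coordinates in the stereographic projection. These are indeed smooth coordinates on the complement of the two poles. Then: 1. There is a smooth conservative system on all of $S^2$ which in the coordinates $(\varphi,u)$ is $H_p$ or $-H_p$. 2. This system possesses an integral of degree four in momenta, whose differential is linearly independent of $dH$ on a dense subset of $T^*S^2$;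 it possesses no integral of degree one or two in momenta. 3. The systems for different pairs $(a,p)$ are not equivalent. 4. None of these systems is equivalent to the Kovalevskaya system or to a Goryachev system. -/

import Mathlib

open scoped Manifold ContDiff Topology

noncomputable section

section CotangentBundle

variable {n : ℕ} {M : Type} [TopologicalSpace M] [ChartedSpace (EuclideanSpace ℝ (Fin n)) M]

/-- The points of the cotangent bundle `T*M` of an `n`-dimensional manifold `M`: pairs `⟨x, α⟩` of a
point `x` of `M` and a covector `α` at `x`. -/
abbrev CotangentBundle (n : ℕ) (M : Type) [TopologicalSpace M]
    [ChartedSpace (EuclideanSpace ℝ (Fin n)) M] : Type :=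
  Σ x : M, (TangentSpace (𝓡 n) x →L[ℝ] ℝ)

/-- The canonical coordinates of `T*M` attached to a chart `e` of `M`: the point with position
coordinates `z.1 = (q₁, …, qₙ)` and momenta `z.2 = (p₁, …, pₙ)` is the covector `∑ pᵢ dqᵢ` at the
point of `M` with coordinates `q`. -/
def cotangentPoint (e : OpenPartialHomeomorph M (EuclideanSpace ℝ (Fin n)))
    (z : EuclideanSpace ℝ (Fin n) × EuclideanSpace ℝ (Fin n)) : CotangentBundle n M :=
  ⟨e.symm z.1, (innerSL ℝ z.2 : EuclideanSpace ℝ (Fin n) →L[ℝ] ℝ).comp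
    (mfderiv (𝓡 n) (𝓡 n) e (e.symm z.1))⟩

/-- A function on `T*M` written in the canonical coordinates of the chart `e`. -/
def inCanonicalCoordinates (F : CotangentBundle n M → ℝ)
    (e : OpenPartialHomeomorph M (EuclideanSpace ℝ (Fin n)))
    (z : EuclideanSpace ℝ (Fin n) × EuclideanSpace ℝ (Fin n)) : ℝ :=
  F (cotangentPoint e z)

/-- The domain of the canonical coordinates of the chart `e`. -/
def canonicalDomain (e : OpenPartialHomeomorph M (EuclideanSpace ℝ (Fin n))) :
    Set (EuclideanSpace ℝ (Fin n) × EuclideanSpace ℝ (Fin n)) :=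
  e.target ×ˢ Set.univ

/-- `F : T*M → ℝ` is of class `C^∞`. -/
def IsSmoothOnCotangent (F : CotangentBundle n M → ℝ) : Prop :=
  ∀ e ∈ IsManifold.maximalAtlas (𝓡 n) ∞ M,
    ContDiffOn ℝ ∞ (inCanonicalCoordinates F e) (canonicalDomain e)

/-- The Poisson bracket `{f, h} = ∑ᵢ (∂f/∂qᵢ ∂h/∂pᵢ - ∂f/∂pᵢ ∂h/∂qᵢ)` in canonical coordinates. -/
def poissonBracket (f h : EuclideanSpace ℝ (Fin n) × EuclideanSpace ℝ (Fin n) → ℝ)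
    (z : EuclideanSpace ℝ (Fin n) × EuclideanSpace ℝ (Fin n)) : ℝ :=
  ∑ i : Fin n,
    (fderiv ℝ f z (EuclideanSpace.single i 1, 0) * fderiv ℝ h z (0, EuclideanSpace.single i 1) -
      fderiv ℝ f z (0, EuclideanSpace.single i 1) * fderiv ℝ h z (EuclideanSpace.single i 1, 0))

/-- `F` is conserved by the Hamiltonian system with Hamiltonian `H`, that is `{F, H} = 0` on `T*M`. -/
def IsConserved (F H : CotangentBundle n M → ℝ) : Prop :=
  ∀ e ∈ IsManifold.maximalAtlas (𝓡 n) ∞ M, ∀ z ∈ canonicalDomain e,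
    poissonBracket (inCanonicalCoordinates F e) (inCanonicalCoordinates H e) z = 0

/-- In local coordinates, `F` is a polynomial of degree at most `m` in the momenta, with
coefficients that depend on the position. -/
def IsPolynomialInMomenta (m : ℕ) (F : CotangentBundle n M → ℝ) : Prop :=
  ∀ e ∈ IsManifold.maximalAtlas (𝓡 n) ∞ M, ∀ q ∈ e.target,
    ∃ P : MvPolynomial (Fin n) ℝ, P.totalDegree ≤ m ∧
      ∀ p : EuclideanSpace ℝ (Fin n), inCanonicalCoordinates F e (q, p) = MvPolynomial.eval p P

/-- The points, in the canonical coordinates of `e`, at which the differentials of `F` and `H` are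
linearly independent. -/
def independencePoints (F H : CotangentBundle n M → ℝ)
    (e : OpenPartialHomeomorph M (EuclideanSpace ℝ (Fin n))) :
    Set (EuclideanSpace ℝ (Fin n) × EuclideanSpace ℝ (Fin n)) :=
  {z | z ∈ canonicalDomain e ∧ LinearIndependent ℝ
    ![fderiv ℝ (inCanonicalCoordinates F e) z, fderiv ℝ (inCanonicalCoordinates H e) z]}

/-- `F` is not functionally dependent on `H`: `dF` and `dH` are linearly independent somewhere. -/
def IsIndependent (F H : CotangentBundle n M → ℝ) : Prop :=
  ∃ e ∈ IsManifold.maximalAtlas (𝓡 n) ∞ M, (independencePoints F H e).Nonempty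

/-- `dF` and `dH` are linearly independent on a dense subset of `T*M`. -/
def IsGenericallyIndependent (F H : CotangentBundle n M → ℝ) : Prop :=
  ∀ e ∈ IsManifold.maximalAtlas (𝓡 n) ∞ M,
    canonicalDomain e ⊆ closure (independencePoints F H e)

/-- `F` is an integral of degree `m` in momenta of the Hamiltonian system with Hamiltonian `H`. -/
structure IsIntegralOfDegree (m : ℕ) (F H : CotangentBundle n M → ℝ) : Prop where
  smooth : IsSmoothOnCotangent F
  conserved : IsConserved F H
  polynomial : IsPolynomialInMomenta m F
  independent : IsIndependent F H

/-- The map of `T*M` induced by a diffeomorphism `φ` of `M`: it covers `φ`, and on the fibre over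
`x` it is the linear isomorphism `T*ₓM → T*_{φ x}M` inverse to the transpose of `dφ`. -/
def cotangentLift [IsManifold (𝓡 n) ∞ M] (φ : M ≃ₘ^∞⟮𝓡 n, 𝓡 n⟯ M) (ξ : CotangentBundle n M) :
    CotangentBundle n M :=
  ⟨φ ξ.1, ContinuousLinearMap.comp
    (show TangentSpace (𝓡 n) (φ.symm (φ ξ.1)) →L[ℝ] ℝ from ξ.2)
    (mfderiv (𝓡 n) (𝓡 n) φ.symm (φ ξ.1))⟩

variable (n M) in
/-- A smooth conservative system on `M`: a smooth Riemannian metric and a smooth potential. -/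
structure ConservativeSystem [IsManifold (𝓡 n) ∞ M] where
  metric : Bundle.ContMDiffRiemannianMetric (𝓡 n) ∞ (EuclideanSpace ℝ (Fin n))
    (fun x : M => TangentSpace (𝓡 n) x)
  potential : M → ℝ
  potential_smooth : ContMDiff (𝓡 n) 𝓘(ℝ, ℝ) ∞ potential

namespace ConservativeSystem

variable [IsManifold (𝓡 n) ∞ M]

/-- The kinetic energy `K = ½ ∑ gⁱʲ pᵢ pⱼ` as a function on `T*M`. The inverse of the map `v ↦ g(v, ·)`
from tangent vectors to covectors exists because `g` is positive definite. -/
def kinetic (S : ConservativeSystem n M) (ξ : CotangentBundle n M) : ℝ :=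
  1 / 2 * ξ.2 ((S.metric.inner ξ.1).inverse ξ.2)

/-- The Hamiltonian `H = K + U` on `T*M`. -/
def hamiltonian (S : ConservativeSystem n M) (ξ : CotangentBundle n M) : ℝ :=
  S.kinetic ξ + S.potential ξ.1

/-- Equivalence of conservative systems: a diffeomorphism `φ` of `M`, with its induced map `Φ` of
`T*M`, satisfies `Φ^* K₁ = κ K₂` and `φ^* U₁ = κ' U₂` for some nonzero constants `κ`, `κ'`. -/
def Equivalent (S₁ S₂ : ConservativeSystem n M) : Prop :=
  ∃ (φ : M ≃ₘ^∞⟮𝓡 n, 𝓡 n⟯ M) (κ κ' : ℝ), κ ≠ 0 ∧ κ' ≠ 0 ∧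
    (∀ ξ : CotangentBundle n M, S₁.kinetic (cotangentLift φ ξ) = κ * S₂.kinetic ξ) ∧
    (∀ x : M, S₁.potential (φ x) = κ' * S₂.potential x)

end ConservativeSystem

end CotangentBundle

section Sphere

abbrev E3 : Type := EuclideanSpace ℝ (Fin 3)

/-- The unit sphere in `ℝ³`, with Mathlib's smooth structure. -/
abbrev S2 : Type := Metric.sphere (0 : E3) 1

/-- The differential of the inclusion of the sphere in `ℝ³`. -/
def inclusionDeriv (x : S2) : TangentSpace (𝓡 2) x →L[ℝ] E3 :=
  mvfderiv (𝓡 2) (Subtype.val : S2 → E3) x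

theorem inclusionDeriv_injective (x : S2) : Function.Injective (inclusionDeriv x) :=
  haveI : Fact (Module.finrank ℝ E3 = 2 + 1) := ⟨finrank_euclideanSpace_fin⟩
  injective_mvfderiv_subtypeVal_sphere x

theorem inclusionDeriv_ne_zero (x : S2) {v : TangentSpace (𝓡 2) x} (hv : v ≠ 0) :
    inclusionDeriv x v ≠ 0 := fun h =>
  hv (inclusionDeriv_injective x (h.trans (map_zero (inclusionDeriv x)).symm))

theorem isVonNBounded_of_pos {V : Type} [NormedAddCommGroup V] [NormedSpace ℝ V]
    [FiniteDimensional ℝ V] (B : V →L[ℝ] V →L[ℝ] ℝ) (hB : ∀ v, v ≠ 0 → 0 < B v v) :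
    Bornology.IsVonNBounded ℝ {v : V | B v v < 1} := by
  rw [NormedSpace.isVonNBounded_iff]
  have hc : Continuous fun v : V => B v v := by fun_prop
  rcases (Metric.sphere (0 : V) 1).eq_empty_or_nonempty with h | h
  · have : ∀ v : V, v = 0 := by
      intro v
      by_contra hv
      have : ‖v‖⁻¹ • v ∈ Metric.sphere (0 : V) 1 := by
        simp [norm_smul, inv_mul_cancel₀ (norm_ne_zero_iff.2 hv)]
      simp [h] at this
    exact (Bornology.isBounded_singleton (x := (0 : V))).subset fun v _ => this v
  · obtain ⟨w, hw, hmin⟩ := (isCompact_sphere (0 : V) 1).exists_isMinOn h hc.continuousOn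
    have hw0 : w ≠ 0 := by
      rintro rfl
      simp at hw
    have hpos := hB w hw0
    refine (Metric.isBounded_closedBall (x := (0 : V)) (r := 1 + (B w w)⁻¹)).subset fun v hv => ?_
    rw [mem_closedBall_zero_iff]
    by_cases hv0 : v = 0
    · subst hv0
      simp only [norm_zero]
      positivity
    have hn : 0 < ‖v‖ := norm_pos_iff.2 hv0
    have hmem : ‖v‖⁻¹ • v ∈ Metric.sphere (0 : V) 1 := by
      simp [norm_smul, inv_mul_cancel₀ hn.ne']
    have h1 : B w w ≤ B (‖v‖⁻¹ • v) (‖v‖⁻¹ • v) := hmin hmem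
    have h2 : B (‖v‖⁻¹ • v) (‖v‖⁻¹ • v) = (‖v‖ ^ 2)⁻¹ * B v v := by
      simp only [map_smul, smul_apply, smul_eq_mul]
      field_simp
    have hv' : B v v < 1 := hv
    have h3 : B w w * ‖v‖ ^ 2 < 1 := by
      rw [h2] at h1
      have := mul_le_mul_of_nonneg_right h1 (sq_nonneg ‖v‖)
      have h4 : (‖v‖ ^ 2)⁻¹ * B v v * ‖v‖ ^ 2 = B v v := by field_simp
      linarith
    have h5 : ‖v‖ ^ 2 < (B w w)⁻¹ := by
      rw [lt_inv_comm₀ (by positivity) hpos, lt_inv_comm₀ hpos (by positivity)]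
      rw [← one_div, lt_div_iff₀ hpos]
      linarith
    have : 0 < (B w w)⁻¹ := inv_pos.2 hpos
    nlinarith [sq_nonneg (‖v‖ - 1)]

theorem tangent_isVonNBounded (x : S2)
    (B : TangentSpace (𝓡 2) x →L[ℝ] TangentSpace (𝓡 2) x →L[ℝ] ℝ)
    (hB : ∀ v, v ≠ 0 → 0 < B v v) :
    Bornology.IsVonNBounded ℝ {v : TangentSpace (𝓡 2) x | B v v < 1} :=
  isVonNBounded_of_pos (V := EuclideanSpace ℝ (Fin 2)) B hB

/-- The bilinear form induced on the tangent plane of the sphere at `x` by a form on `ℝ³`. -/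
def tangentForm (x : S2) (B : E3 →L[ℝ] E3 →L[ℝ] ℝ) :
    TangentSpace (𝓡 2) x →L[ℝ] TangentSpace (𝓡 2) x →L[ℝ] ℝ :=
  ((inclusionDeriv x).precomp ℝ).comp (B.comp (inclusionDeriv x))

theorem tangentForm_apply (x : S2) (B : E3 →L[ℝ] E3 →L[ℝ] ℝ) (v w : TangentSpace (𝓡 2) x) :
    tangentForm x B v w = B (inclusionDeriv x v) (inclusionDeriv x w) := rfl

theorem contMDiffAt_flip {V W : Type} [NormedAddCommGroup V] [NormedSpace ℝ V]
    [NormedAddCommGroup W] [NormedSpace ℝ W] {f : S2 → V →L[ℝ] W →L[ℝ] ℝ} {x : S2}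
    (hf : ContMDiffAt (𝓡 2) 𝓘(ℝ, V →L[ℝ] W →L[ℝ] ℝ) ∞ f x) :
    ContMDiffAt (𝓡 2) 𝓘(ℝ, W →L[ℝ] V →L[ℝ] ℝ) ∞ (fun y => (f y).flip) x := by
  have h : ContDiff ℝ ∞ (fun B : V →L[ℝ] W →L[ℝ] ℝ => B.flip) :=
    IsBoundedLinearMap.contDiff (𝕜 := ℝ) ⟨⟨fun _ _ => rfl, fun _ _ => rfl⟩, 1, one_pos,
      fun B => by rw [one_mul, ContinuousLinearMap.opNorm_flip]⟩
  exact ContMDiffAt.comp (g := fun B : V →L[ℝ] W →L[ℝ] ℝ => B.flip) x h.contMDiff.contMDiffAt hf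

theorem contMDiff_tangentForm (Q : S2 → E3 →L[ℝ] E3 →L[ℝ] ℝ)
    (hQ : ContMDiff (𝓡 2) 𝓘(ℝ, E3 →L[ℝ] E3 →L[ℝ] ℝ) ∞ Q) :
    ContMDiff (𝓡 2)
      ((𝓡 2).prod 𝓘(ℝ, EuclideanSpace ℝ (Fin 2) →L[ℝ] EuclideanSpace ℝ (Fin 2) →L[ℝ] ℝ)) ∞
      (fun x : S2 => Bundle.TotalSpace.mk'
        (EuclideanSpace ℝ (Fin 2) →L[ℝ] EuclideanSpace ℝ (Fin 2) →L[ℝ] ℝ)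
        (E := fun x : S2 => TangentSpace (𝓡 2) x →L[ℝ] TangentSpace (𝓡 2) x →L[ℝ] ℝ)
        x (tangentForm x (Q x))) := by
  have : Fact (Module.finrank ℝ E3 = 2 + 1) := ⟨finrank_euclideanSpace_fin⟩
  intro x₀
  rw [Bundle.contMDiffAt_section]
  have hι : ContMDiffAt (𝓡 2) 𝓘(ℝ, E3) ∞ (Subtype.val : S2 → E3) x₀ :=
    contMDiff_coe_sphere.contMDiffAt
  have hD := hι.mfderiv_const (m := ∞) (by simp)
  set D := inTangentCoordinates (𝓡 2) 𝓘(ℝ, E3) id (Subtype.val : S2 → E3)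
    (mfderiv (𝓡 2) 𝓘(ℝ, E3) (Subtype.val : S2 → E3)) x₀ with hDdef
  refine ContMDiffAt.congr_of_eventuallyEq (f := fun x => ((((Q x).comp (D x)).flip).comp (D x)).flip)
    (contMDiffAt_flip ((contMDiffAt_flip (hQ.contMDiffAt.clm_comp hD)).clm_comp hD)) ?_
  have hbase : (trivializationAt (EuclideanSpace ℝ (Fin 2))
      (TangentSpace (𝓡 2) (M := S2)) x₀).baseSet ∈ 𝓝 x₀ :=
    (trivializationAt (EuclideanSpace ℝ (Fin 2)) (TangentSpace (𝓡 2)) x₀).open_baseSet.mem_nhds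
      (FiberBundle.mem_baseSet_trivializationAt' x₀)
  filter_upwards [hbase] with x hx
  have key : ∀ u, D x u = inclusionDeriv x
      ((trivializationAt (EuclideanSpace ℝ (Fin 2)) (TangentSpace (𝓡 2)) x₀).symm x u) := by
    intro u
    simp only [hDdef, inTangentCoordinates, ContinuousLinearMap.inCoordinates]
    rw [TangentBundle.continuousLinearMapAt_model_space, ← Bundle.Trivialization.symmL_apply (R := ℝ) _ hx]
    rfl
  refine ContinuousLinearMap.ext fun v => ContinuousLinearMap.ext fun w => ?_
  rw [hom_trivializationAt_apply, inCoordinates_apply_eq₂ hx hx (Set.mem_univ _)]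
  simp only [ContinuousLinearMap.flip_apply, ContinuousLinearMap.comp_apply, key, tangentForm_apply]
  simp

/-- The Riemannian metric that a smoothly varying positive definite quadratic form on `ℝ³` induces
on the sphere. -/
def sphereMetric (Q : S2 → E3 →L[ℝ] E3 →L[ℝ] ℝ) (hsymm : ∀ x v w, Q x v w = Q x w v)
    (hpos : ∀ x v, v ≠ 0 → 0 < Q x v v)
    (hQ : ContMDiff (𝓡 2) 𝓘(ℝ, E3 →L[ℝ] E3 →L[ℝ] ℝ) ∞ Q) :
    Bundle.ContMDiffRiemannianMetric (𝓡 2) ∞ (EuclideanSpace ℝ (Fin 2))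
      (fun x : S2 => TangentSpace (𝓡 2) x) where
  inner x := tangentForm x (Q x)
  symm x _ _ := hsymm x _ _
  pos x _ hv := hpos x _ (inclusionDeriv_ne_zero x hv)
  isVonNBounded x := tangent_isVonNBounded x _ fun _ hv => hpos x _ (inclusionDeriv_ne_zero x hv)
  contMDiff := contMDiff_tangentForm Q hQ

/-- The bilinear form `v₁ w₁ + v₂ w₂ + 2 v₃ w₃` on `ℝ³`. -/
def goryachevForm : E3 →L[ℝ] E3 →L[ℝ] ℝ :=
  ((EuclideanSpace.proj 0 : E3 →L[ℝ] ℝ).smulRight (EuclideanSpace.proj 0 : E3 →L[ℝ] ℝ)) +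
  ((EuclideanSpace.proj 1 : E3 →L[ℝ] ℝ).smulRight (EuclideanSpace.proj 1 : E3 →L[ℝ] ℝ)) +
  (2 : ℝ) • ((EuclideanSpace.proj 2 : E3 →L[ℝ] ℝ).smulRight (EuclideanSpace.proj 2 : E3 →L[ℝ] ℝ))

theorem goryachevForm_apply (v w : E3) :
    goryachevForm v w = v 0 * w 0 + v 1 * w 1 + 2 * (v 2 * w 2) := by
  simp [goryachevForm]

theorem sphere_sq_sum (x : S2) :
    (x : E3) 0 ^ 2 + (x : E3) 1 ^ 2 + (x : E3) 2 ^ 2 = 1 := by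
  have h : ‖(x : E3)‖ ^ 2 = 1 := by simp
  rw [EuclideanSpace.norm_sq_eq, Fin.sum_univ_three] at h
  simpa using h

/-- The factor `1 / (2 u₁² + 2 u₂² + u₃²)`. -/
def goryachevFactor (x : S2) : ℝ :=
  (2 * (x : E3) 0 ^ 2 + 2 * (x : E3) 1 ^ 2 + (x : E3) 2 ^ 2)⁻¹

theorem goryachevFactor_denom_pos (x : S2) :
    0 < 2 * (x : E3) 0 ^ 2 + 2 * (x : E3) 1 ^ 2 + (x : E3) 2 ^ 2 := by
  nlinarith [sphere_sq_sum x, sq_nonneg ((x : E3) 0), sq_nonneg ((x : E3) 1)]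

theorem contMDiff_sphere_coord (i : Fin 3) :
    ContMDiff (𝓡 2) 𝓘(ℝ, ℝ) ∞ (fun x : S2 => (x : E3) i) := by
  have : Fact (Module.finrank ℝ E3 = 2 + 1) := ⟨finrank_euclideanSpace_fin⟩
  have h : ContMDiff (𝓡 2) 𝓘(ℝ, E3) ∞ (fun x : S2 => (x : E3)) := contMDiff_coe_sphere
  exact (EuclideanSpace.proj i : E3 →L[ℝ] ℝ).contDiff.contMDiff.comp h

theorem contMDiff_goryachevFactor : ContMDiff (𝓡 2) 𝓘(ℝ, ℝ) ∞ goryachevFactor := by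
  have h0 := contMDiff_sphere_coord 0
  have h1 := contMDiff_sphere_coord 1
  have h2 := contMDiff_sphere_coord 2
  have hpoly : ContDiff ℝ ∞ (fun t : ℝ × ℝ × ℝ => 2 * t.1 ^ 2 + 2 * t.2.1 ^ 2 + t.2.2 ^ 2) := by
    fun_prop
  have hd : ContMDiff (𝓡 2) 𝓘(ℝ, ℝ) ∞
      (fun x : S2 => 2 * (x : E3) 0 ^ 2 + 2 * (x : E3) 1 ^ 2 + (x : E3) 2 ^ 2) :=
    hpoly.contMDiff.comp (h0.prodMk_space (h1.prodMk_space h2))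
  intro x
  exact (contDiffAt_inv ℝ (goryachevFactor_denom_pos x).ne').contMDiffAt.comp x hd.contMDiffAt

theorem goryachevForm_pos {v : E3} (hv : v ≠ 0) : 0 < goryachevForm v v := by
  rw [goryachevForm_apply]
  by_contra h
  apply hv
  have h0 : v 0 = 0 := by nlinarith [sq_nonneg (v 0), sq_nonneg (v 1), sq_nonneg (v 2)]
  have h1 : v 1 = 0 := by nlinarith [sq_nonneg (v 0), sq_nonneg (v 1), sq_nonneg (v 2)]
  have h2 : v 2 = 0 := by nlinarith [sq_nonneg (v 0), sq_nonneg (v 1), sq_nonneg (v 2)]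
  ext i
  fin_cases i <;> assumption

/-- The system of Goryachev on `u₁² + u₂² + u₃² = 1`, with metric
`(du₁² + du₂² + 2 du₃²) / (2 u₁² + 2 u₂² + u₃²)` and potential
`- 2 B₁ u₁ u₂ - B₂ (u₁² - u₂²) - u₁`. -/
def goryachev (B₁ B₂ : ℝ) : ConservativeSystem 2 S2 where
  metric := sphereMetric (fun x => goryachevFactor x • goryachevForm)
    (fun x v w => by simp only [smul_apply, goryachevForm_apply]; ring_nf)
    (fun x v hv => by
      simp only [smul_apply, smul_eq_mul]
      exact mul_pos (inv_pos.2 (goryachevFactor_denom_pos x)) (goryachevForm_pos hv))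
    (contMDiff_goryachevFactor.smul contMDiff_const)
  potential x := - 2 * B₁ * (x : E3) 0 * (x : E3) 1 - B₂ * ((x : E3) 0 ^ 2 - (x : E3) 1 ^ 2)
    - (x : E3) 0
  potential_smooth := by
    have hpoly : ContDiff ℝ ∞ (fun t : ℝ × ℝ =>
        - 2 * B₁ * t.1 * t.2 - B₂ * (t.1 ^ 2 - t.2 ^ 2) - t.1) := by
      fun_prop
    exact hpoly.contMDiff.comp ((contMDiff_sphere_coord 0).prodMk_space (contMDiff_sphere_coord 1))

/-- The system of Kovalevskaya, with potential `- u₁`. -/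
def kovalevskaya : ConservativeSystem 2 S2 := goryachev 0 0

end Sphere

section Family

/-- `A(u, a, 1) = 1 + a u² + u⁴`. -/
def quarticA (a u : ℝ) : ℝ := 1 + a * u ^ 2 + u ^ 4

/-- The increasing function `y(u)` with `dy/du = A^(-1/4)` and `y(0) = 0`, that is the inverse of
the solution `u(y)` of `u'⁴ = 1 + a u² + u⁴`, `u' > 0`, `u(0) = 0`. -/
def conformalCoord (a u : ℝ) : ℝ := ∫ t in (0 : ℝ)..u, (quarticA a t) ^ (-(1 / 4) : ℝ)

/-- The point of the sphere whose stereographic projection from the pole `(0, 0, 1)` onto the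
equatorial plane has polar coordinates `(e^y, φ)`. -/
def spherePoint (φ y : ℝ) : S2 :=
  ⟨!₂[Real.cos φ / Real.cosh y, Real.sin φ / Real.cosh y, Real.sinh y / Real.cosh y], by
    have h : ‖!₂[Real.cos φ / Real.cosh y, Real.sin φ / Real.cosh y, Real.sinh y / Real.cosh y]‖ ^ 2
        = 1 := by
      rw [EuclideanSpace.norm_sq_eq, Fin.sum_univ_three]
      have hc := (Real.cosh_pos y).ne'
      simp only [Real.norm_eq_abs, sq_abs]
      simp
      field_simp
      nlinarith [Real.cosh_sq y, Real.sin_sq_add_cos_sq φ]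
    rw [mem_sphere_zero_iff_norm]
    exact (pow_eq_one_iff_of_nonneg (norm_nonneg _) two_ne_zero).1 h⟩

/-- The coordinates `(φ, u)` on the sphere: the point with longitude `φ` and with `y = y(u)`. -/
def cylinderMap (a : ℝ) (z : ℝ × ℝ) : S2 := spherePoint z.1 (conformalCoord a z.2)

/-- `ψ` gives smooth coordinates `(φ, u)`, with `φ` an angle modulo `2π` and `u` in `ℝ`, on the
complement of two points of the sphere. -/
structure IsCylindricalCoordinates (ψ : ℝ × ℝ → S2) : Prop where
  smooth : ContMDiff 𝓘(ℝ, ℝ × ℝ) (𝓡 2) ∞ ψ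
  immersive : ∀ z, Function.Injective (mfderiv 𝓘(ℝ, ℝ × ℝ) (𝓡 2) ψ z)
  eq_iff : ∀ z z', ψ z = ψ z' ↔ (∃ k : ℤ, z.1 = z'.1 + k * (2 * Real.pi)) ∧ z.2 = z'.2
  range_eq : ∃ P Q : S2, P ≠ Q ∧ Set.range ψ = {P, Q}ᶜ

/-- The quadratic form of `H_p` in the coordinates `(φ, u)`, polarized:
`(A^(1/2) - u² + p) / A^(1/2) * (dφ² + A^(-1/2) du²)`. -/
def formHp (a p : ℝ) (z X Y : ℝ × ℝ) : ℝ :=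
  (√(quarticA a z.2) - z.2 ^ 2 + p) / √(quarticA a z.2) *
    (X.1 * Y.1 + (√(quarticA a z.2))⁻¹ * (X.2 * Y.2))

/-- The potential of `H_p` in the coordinates `(φ, u)`. -/
def potentialHp (a p : ℝ) (z : ℝ × ℝ) : ℝ :=
  -(z.2 * ((a + 2 * z.2 ^ 2) - 2 * √(quarticA a z.2)) /
    (2 * (√(quarticA a z.2) - z.2 ^ 2 + p))) * Real.cos z.1

/-- The conservative system `S` on the sphere is the one defined by `H_p` or by `-H_p`: in the
coordinates `(φ, u)` on the complement of the poles, its metric and its potential are those of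
`H_p`, or are both the negatives of those of `H_p`. -/
def IsSystemHp (a p : ℝ) (S : ConservativeSystem 2 S2) : Prop :=
  ∃ ε : ℝ, (ε = 1 ∨ ε = -1) ∧ ∀ z : ℝ × ℝ,
    (∀ X Y : ℝ × ℝ, S.metric.inner (cylinderMap a z)
      (mfderiv 𝓘(ℝ, ℝ × ℝ) (𝓡 2) (cylinderMap a) z X)
      (mfderiv 𝓘(ℝ, ℝ × ℝ) (𝓡 2) (cylinderMap a) z Y) = ε * formHp a p z X Y) ∧
    S.potential (cylinderMap a z) = ε * potentialHp a p z

/-- The admissible values of the parameters. -/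
def Admissible (a p : ℝ) : Prop :=
  (2 < a ∧ (p < -a / 2 ∨ -1 < p)) ∨ (-2 < a ∧ a < 2 ∧ (p < -1 ∨ -a / 2 < p))

end Family

end

open scoped Manifold ContDiff Topology

noncomputable section

set_option linter.unusedSectionVars false
set_option linter.unusedSimpArgs false

/-! ### Changes of canonical coordinates on the cotangent bundle are symplectic. -/

section CanonicalTransition

open ContinuousLinearMap

variable {n : ℕ} {M : Type} [TopologicalSpace M] [ChartedSpace (EuclideanSpace ℝ (Fin n)) M]

/-! Away from the poles everything is explicit. In the coordinates (φ, y), y = y(u), with momenta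
(P, Q), write U = u(y), w = A^(1/4), c = a + 2U² - 2w², m = w² - U² + p. The metric is ε f (dφ² +
dy²) with f = m/w², the potential is ε W(y) cos φ with W = -Uc/(2m), and U, w, m, c satisfy the
closed system U' = w, w' = U(c + 2w²)/(2w²), m' = Uc/w, c' = -2Uc/w. The two missing points are
harmless for identities such as {F, H} = 0, which extend by continuity; smoothness at the poles is a
separate matter.

Existence. With s = u/√(1 + u²) in [-1, 1] the quartic becomes 1 + (a - 2)s²(1 - s²) up to the
factor (1 - s²)², and y - artanh s is smooth across s = ±1. Hence s is a smooth function of the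
height u₃ = tanh y on the closed sphere (`exists_sphereCoord`). The system is f₁(s) times the round
metric with potential g₁(s) u₁, for f₁, g₁ smooth on [-1, 1]. The gap √A - u² runs between 1 and
a/2, so admissibility says that m has a constant sign ε, poles included.

The quartic integral is F = P⁴ - 4εP²H + 4U P² cos φ - 4w PQ sin φ + c sin² φ. By the system above,
{F, H} = 0 is an algebraic identity; globally F is assembled from two angular momenta and smooth
functions of s. The Jacobian of (F, H) in the momenta is, for P ≠ 0, a cubic in Q up to a nonzero
factor, so it is nonzero on a dense set.

Low degree. The Killing equations of an even conformal factor are integrated in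
`killing_tensor_dichotomy`: either f satisfies the first-order equation of a rotationally symmetric
metric of constant curvature, or every quadratic integral of the geodesic flow is a combination of
P² and the kinetic energy. The first case is excluded by a rational parametrization of w⁴ = 1 + aU²
+ U⁴. The potential then rules out P², and splitting an integral into its even and odd parts in the
momenta leaves only b H + d.

Inequivalence. The same dichotomy shows that an equivalence with a rotationally symmetric metric
carries P² to a multiple of P², so it maps parallels to parallels. For a Goryachev system some
parallel would go to the equator, where the potential of H_p vanishes, but -u₁ forces the Goryachev
potential to be nonzero somewhere on each parallel. Between H_p and H_p', the map acts on y
affinely; it preserves the equator because of the potentials, and the decay of f like 1/cosh² y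
makes it y ↦ ±y. The product f W is proportional to h = Uc/w², which does not involve p, and h''/h
has the value -6 - 5a/2 at y = 0. This recovers a, and then f recovers p. -/

theorem poissonBracket_eq_sub {f h : EuclideanSpace ℝ (Fin n) × EuclideanSpace ℝ (Fin n) → ℝ}
    {z : EuclideanSpace ℝ (Fin n) × EuclideanSpace ℝ (Fin n)} {a b : EuclideanSpace ℝ (Fin n)}
    (ha : ∀ w, fderiv ℝ f z (0, w) = inner ℝ a w) (hb : ∀ w, fderiv ℝ h z (0, w) = inner ℝ b w) :
    poissonBracket f h z = fderiv ℝ f z (b, 0) - fderiv ℝ h z (a, 0) := by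
  have key : ∀ (A : EuclideanSpace ℝ (Fin n) × EuclideanSpace ℝ (Fin n) →L[ℝ] ℝ)
      (v : EuclideanSpace ℝ (Fin n)),
      A (v, 0) = ∑ i, A (EuclideanSpace.single i 1, 0) * inner ℝ v (EuclideanSpace.single i 1) := by
    intro A v
    have h1 : (A.comp (ContinuousLinearMap.inl ℝ _ _)) v = A (v, 0) := by simp
    rw [← h1]
    conv_lhs => rw [← (EuclideanSpace.basisFun (Fin n) ℝ).sum_repr v]
    rw [map_sum]
    refine Finset.sum_congr rfl fun i _ => ?_
    simp [mul_comm, EuclideanSpace.inner_single_right]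
  rw [poissonBracket, key (fderiv ℝ f z) b, key (fderiv ℝ h z) a, ← Finset.sum_sub_distrib]
  refine Finset.sum_congr rfl fun i _ => ?_
  rw [ha, hb]
  ring

/-- The change of canonical coordinates of the cotangent bundle between the charts `e` and `e'`. -/
def canonicalTransition (e e' : OpenPartialHomeomorph M (EuclideanSpace ℝ (Fin n)))
    (z : EuclideanSpace ℝ (Fin n) × EuclideanSpace ℝ (Fin n)) :
    EuclideanSpace ℝ (Fin n) × EuclideanSpace ℝ (Fin n) :=
  (e' (e.symm z.1), adjoint (fderiv ℝ (e ∘ e'.symm) (e' (e.symm z.1))) z.2)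

variable {e e' : OpenPartialHomeomorph M (EuclideanSpace ℝ (Fin n))}

/-- The points of the canonical domain of `e` that lie over the source of `e'`. -/
def canonicalOverlap (e e' : OpenPartialHomeomorph M (EuclideanSpace ℝ (Fin n))) :
    Set (EuclideanSpace ℝ (Fin n) × EuclideanSpace ℝ (Fin n)) :=
  (e.symm.trans e').source ×ˢ Set.univ

theorem mem_canonicalOverlap {z : EuclideanSpace ℝ (Fin n) × EuclideanSpace ℝ (Fin n)} :
    z ∈ canonicalOverlap e e' ↔ z.1 ∈ e.target ∧ e.symm z.1 ∈ e'.source := by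
  simp [canonicalOverlap, OpenPartialHomeomorph.trans_source]

theorem isOpen_canonicalDomain : IsOpen (canonicalDomain e) := e.open_target.prod isOpen_univ

theorem isOpen_canonicalOverlap : IsOpen (canonicalOverlap e e') :=
  (e.symm.trans e').open_source.prod isOpen_univ

theorem canonicalTransition_mem {z : EuclideanSpace ℝ (Fin n) × EuclideanSpace ℝ (Fin n)}
    (hz : z ∈ canonicalOverlap e e') : canonicalTransition e e' z ∈ canonicalOverlap e' e := by
  rw [mem_canonicalOverlap] at hz ⊢
  refine ⟨e'.map_source hz.2, ?_⟩
  simp only [canonicalTransition]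
  rw [e'.left_inv hz.2]
  exact e.map_target hz.1

variable [IsManifold (𝓡 n) ∞ M]

theorem contDiffOn_transition (he : e ∈ IsManifold.maximalAtlas (𝓡 n) ∞ M)
    (he' : e' ∈ IsManifold.maximalAtlas (𝓡 n) ∞ M) :
    ContDiffOn ℝ ∞ (e' ∘ e.symm) (e.symm.trans e').source := by
  rw [← contMDiffOn_iff_contDiffOn]
  refine (contMDiffOn_of_mem_maximalAtlas he').comp
    ((contMDiffOn_symm_of_mem_maximalAtlas he).mono fun q hq => ?_) fun q hq => ?_
  · simp only [OpenPartialHomeomorph.trans_source] at hq; exact hq.1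
  · simp only [OpenPartialHomeomorph.trans_source] at hq; exact hq.2

theorem contDiffAt_transition (he : e ∈ IsManifold.maximalAtlas (𝓡 n) ∞ M)
    (he' : e' ∈ IsManifold.maximalAtlas (𝓡 n) ∞ M) {q : EuclideanSpace ℝ (Fin n)}
    (hq : q ∈ e.target) (hq' : e.symm q ∈ e'.source) : ContDiffAt ℝ ∞ (e' ∘ e.symm) q :=
  (contDiffOn_transition he he').contDiffAt
    ((e.symm.trans e').open_source.mem_nhds (by simp [OpenPartialHomeomorph.trans_source, hq, hq']))

theorem fderiv_transition_comp (he : e ∈ IsManifold.maximalAtlas (𝓡 n) ∞ M)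
    (he' : e' ∈ IsManifold.maximalAtlas (𝓡 n) ∞ M) {q : EuclideanSpace ℝ (Fin n)}
    (hq : q ∈ e.target) (hq' : e.symm q ∈ e'.source) :
    (fderiv ℝ (e' ∘ e.symm) q).comp (fderiv ℝ (e ∘ e'.symm) (e' (e.symm q))) =
      ContinuousLinearMap.id ℝ _ := by
  have h1 : DifferentiableAt ℝ (e' ∘ e.symm) q :=
    (contDiffAt_transition he he' hq hq').differentiableAt (by simp)
  have hx : e'.symm (e' (e.symm q)) = e.symm q := e'.left_inv hq'
  have h2 : DifferentiableAt ℝ (e ∘ e'.symm) (e' (e.symm q)) :=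
    (contDiffAt_transition he' he (e'.map_source hq')
      (by rw [hx]; exact e.map_target hq)).differentiableAt (by simp)
  have h3 : (e ∘ e'.symm) (e' (e.symm q)) = q := by
    simp [hx, e.right_inv hq]
  have h4 : ((e' ∘ e.symm) ∘ (e ∘ e'.symm)) =ᶠ[𝓝 (e' (e.symm q))] id := by
    have : (e'.symm.trans e).source ∈ 𝓝 (e' (e.symm q)) :=
      (e'.symm.trans e).open_source.mem_nhds (by
        simp [OpenPartialHomeomorph.trans_source, hx, e'.map_source hq', e.map_target hq])
    filter_upwards [this] with x hx
    simp only [OpenPartialHomeomorph.trans_source] at hx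
    have hxt : x ∈ e'.target := hx.1
    have hxs : e'.symm x ∈ e.source := hx.2
    simp [e.left_inv hxs, e'.right_inv hxt]
  have h5 := h4.fderiv_eq (𝕜 := ℝ)
  rw [fderiv_comp _ (by rw [h3]; exact h1) h2, h3, fderiv_id] at h5
  exact h5

theorem cotangentPoint_canonicalTransition (he : e ∈ IsManifold.maximalAtlas (𝓡 n) ∞ M)
    (he' : e' ∈ IsManifold.maximalAtlas (𝓡 n) ∞ M)
    {z : EuclideanSpace ℝ (Fin n) × EuclideanSpace ℝ (Fin n)}
    (hz : z ∈ canonicalOverlap e e') :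
    cotangentPoint e' (canonicalTransition e e' z) = cotangentPoint e z := by
  rw [mem_canonicalOverlap] at hz
  obtain ⟨hq, hq'⟩ := hz
  have hx : e'.symm (e' (e.symm z.1)) = e.symm z.1 := e'.left_inv hq'
  set p' := (canonicalTransition e e' z).2 with hp'
  -- The base points of the two covectors are equal only propositionally. Treating the covector as a
  -- function of its base point lets one rewrite act on the point and on the fibre together.
  set g : M → CotangentBundle n M := fun x => ⟨x, (innerSL ℝ p').comp
    (mfderiv (𝓡 n) (𝓡 n) e' x)⟩ with hg
  have h1 : cotangentPoint e' (canonicalTransition e e' z) = g (e'.symm (e' (e.symm z.1))) := rfl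
  rw [h1, hx, hg, cotangentPoint]
  refine Sigma.ext rfl (heq_of_eq ?_)
  have hσ : MDifferentiableAt (𝓡 n) (𝓡 n) (e ∘ e'.symm) (e' (e.symm z.1)) :=
    ((contDiffAt_transition he' he (e'.map_source hq')
      (by rw [hx]; exact e.map_target hq)).differentiableAt (by simp)).mdifferentiableAt
  have he'd : MDifferentiableAt (𝓡 n) (𝓡 n) e' (e.symm z.1) :=
    (contMDiffAt_of_mem_maximalAtlas he' hq').mdifferentiableAt (by simp)
  have h6 : ((e ∘ e'.symm) ∘ e') =ᶠ[𝓝 (e.symm z.1)] e := by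
    filter_upwards [e'.open_source.mem_nhds hq'] with x hx
    simp [e'.left_inv hx]
  have h7 := h6.mfderiv_eq (I := 𝓡 n) (I' := 𝓡 n)
  rw [mfderiv_comp _ hσ he'd, mfderiv_eq_fderiv] at h7
  have h8 : mfderiv (𝓡 n) (𝓡 n) e (e.symm z.1) = (fderiv ℝ (e ∘ e'.symm) (e' (e.symm z.1))).comp
      (mfderiv (𝓡 n) (𝓡 n) e' (e.symm z.1)) := h7.symm
  rw [h8]
  refine ContinuousLinearMap.ext (M₁ := EuclideanSpace ℝ (Fin n)) (M₂ := ℝ) fun v => ?_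
  simp only [hp', canonicalTransition]
  have key : ∀ (A : EuclideanSpace ℝ (Fin n) →L[ℝ] EuclideanSpace ℝ (Fin n))
      (x y : EuclideanSpace ℝ (Fin n)), innerSL ℝ x (A y) = innerSL ℝ (adjoint A x) y :=
    fun A x y => (adjoint_inner_left A y x).symm
  exact (key (fderiv ℝ (e ∘ e'.symm) (e' (e.symm z.1))) z.2
    (mfderiv (𝓡 n) (𝓡 n) e' (e.symm z.1) v)).symm

theorem inCanonicalCoordinates_canonicalTransition (F : CotangentBundle n M → ℝ)
    (he : e ∈ IsManifold.maximalAtlas (𝓡 n) ∞ M)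
    (he' : e' ∈ IsManifold.maximalAtlas (𝓡 n) ∞ M)
    {z : EuclideanSpace ℝ (Fin n) × EuclideanSpace ℝ (Fin n)}
    (hz : z ∈ canonicalOverlap e e') :
    inCanonicalCoordinates F e z = inCanonicalCoordinates F e' (canonicalTransition e e' z) := by
  rw [inCanonicalCoordinates, inCanonicalCoordinates, cotangentPoint_canonicalTransition he he' hz]

theorem contDiffOn_canonicalTransition (he : e ∈ IsManifold.maximalAtlas (𝓡 n) ∞ M)
    (he' : e' ∈ IsManifold.maximalAtlas (𝓡 n) ∞ M) :
    ContDiffOn ℝ ∞ (canonicalTransition e e') (canonicalOverlap e e') := by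
  intro z hz
  rw [mem_canonicalOverlap] at hz
  have hx : e'.symm (e' (e.symm z.1)) = e.symm z.1 := e'.left_inv hz.2
  have h1 : ContDiffAt ℝ ∞ (fun z : EuclideanSpace ℝ (Fin n) × EuclideanSpace ℝ (Fin n) =>
      e' (e.symm z.1)) z :=
    (contDiffAt_transition he he' hz.1 hz.2).comp z contDiffAt_fst
  have h2 : ContDiffAt ℝ ∞ (fderiv ℝ (e ∘ e'.symm)) (e' (e.symm z.1)) :=
    (contDiffAt_transition he' he (e'.map_source hz.2)
      (by rw [hx]; exact e.map_target hz.1)).fderiv_right (by simp)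
  have h3 : ContDiffAt ℝ ∞ (fun z : EuclideanSpace ℝ (Fin n) × EuclideanSpace ℝ (Fin n) =>
      fderiv ℝ (e ∘ e'.symm) (e' (e.symm z.1))) z := h2.comp z h1
  have h4 : ContDiff ℝ ∞ (fun A : EuclideanSpace ℝ (Fin n) →L[ℝ] EuclideanSpace ℝ (Fin n) =>
      adjoint A) :=
    (adjoint (𝕜 := ℝ) (E := EuclideanSpace ℝ (Fin n))
      (F := EuclideanSpace ℝ (Fin n))).toContinuousLinearEquiv.contDiff
  exact (h1.prodMk ((h4.contDiffAt.comp z h3).clm_apply contDiffAt_snd)).contDiffWithinAt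

theorem canonicalTransition_canonicalTransition (he : e ∈ IsManifold.maximalAtlas (𝓡 n) ∞ M)
    (he' : e' ∈ IsManifold.maximalAtlas (𝓡 n) ∞ M)
    {z : EuclideanSpace ℝ (Fin n) × EuclideanSpace ℝ (Fin n)}
    (hz : z ∈ canonicalOverlap e e') :
    canonicalTransition e' e (canonicalTransition e e' z) = z := by
  rw [mem_canonicalOverlap] at hz
  have hx : e'.symm (e' (e.symm z.1)) = e.symm z.1 := e'.left_inv hz.2
  have hxx : e (e'.symm (e' (e.symm z.1))) = z.1 := by rw [hx, e.right_inv hz.1]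
  refine Prod.ext hxx ?_
  refine ext_inner_right ℝ fun v => ?_
  simp only [canonicalTransition, adjoint_inner_left, hxx]
  congr 1
  have := fderiv_transition_comp he' he (e'.map_source hz.2)
    (by rw [hx]; exact e.map_target hz.1)
  rw [hxx] at this
  exact DFunLike.congr_fun this v

/-- Cotangent lifts are symplectic. The derivative of the lift has a block with the second
derivative of the base transition; its two contributions to the bracket cancel because that second
derivative is symmetric. -/
theorem poissonBracket_canonicalTransition {f h : EuclideanSpace ℝ (Fin n) ×
      EuclideanSpace ℝ (Fin n) → ℝ} (he : e ∈ IsManifold.maximalAtlas (𝓡 n) ∞ M)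
    (he' : e' ∈ IsManifold.maximalAtlas (𝓡 n) ∞ M)
    {z : EuclideanSpace ℝ (Fin n) × EuclideanSpace ℝ (Fin n)}
    (hz : z ∈ canonicalOverlap e e')
    (hf : DifferentiableAt ℝ f (canonicalTransition e e' z))
    (hh : DifferentiableAt ℝ h (canonicalTransition e e' z)) :
    poissonBracket (f ∘ canonicalTransition e e') (h ∘ canonicalTransition e e') z =
      poissonBracket f h (canonicalTransition e e' z) := by
  have hT : DifferentiableAt ℝ (canonicalTransition e e') z :=
    ((contDiffOn_canonicalTransition he he').contDiffAt
      (isOpen_canonicalOverlap.mem_nhds hz)).differentiableAt (by simp)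
  rw [mem_canonicalOverlap] at hz
  obtain ⟨hq, hq'⟩ := hz
  have hx : e'.symm (e' (e.symm z.1)) = e.symm z.1 := e'.left_inv hq'
  set σ := e ∘ e'.symm with hσ
  set τ := e' ∘ e.symm with hτ
  have hσc : ContDiffAt ℝ ∞ σ (τ z.1) := contDiffAt_transition he' he (e'.map_source hq')
      (by simp only [hτ, Function.comp_apply]; rw [hx]; exact e.map_target hq)
  have hτd : HasFDerivAt τ (fderiv ℝ τ z.1) z.1 :=
    ((contDiffAt_transition he he' hq hq').differentiableAt (by simp)).hasFDerivAt
  have hσ2 : HasFDerivAt (fderiv ℝ σ) (fderiv ℝ (fderiv ℝ σ) (τ z.1)) (τ z.1) :=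
    ((hσc.fderiv_right (m := ∞) (by simp)).differentiableAt (by simp)).hasFDerivAt
  have hsymm : IsSymmSndFDerivAt ℝ σ (τ z.1) := hσc.isSymmSndFDerivAt (by
    rw [minSmoothness_of_isRCLikeNormedField]; exact WithTop.coe_le_coe.2 le_top)
  have hinv := fderiv_transition_comp he he' hq hq'
  set D := fderiv ℝ (canonicalTransition e e') z with hD
  have hτz : HasFDerivAt (fun z : EuclideanSpace ℝ (Fin n) × EuclideanSpace ℝ (Fin n) => τ z.1)
      ((fderiv ℝ τ z.1).comp (ContinuousLinearMap.fst ℝ _ _)) z :=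
    HasFDerivAt.comp z hτd hasFDerivAt_fst
  have hD1 : ∀ v, (D v).1 = fderiv ℝ τ z.1 v.1 := by
    intro v
    have h1 : HasFDerivAt (fun z => (canonicalTransition e e' z).1)
      ((ContinuousLinearMap.fst ℝ _ _).comp D) z := hasFDerivAt_fst.comp z hT.hasFDerivAt
    exact DFunLike.congr_fun (h1.unique hτz) v
  -- The new momentum is (dσ)ᵀ p. Paired with a fixed u its derivative has one term from moving the
  -- base point, with σ'', and one from moving p.
  have hD2 : ∀ v u, inner ℝ (D v).2 u = inner ℝ z.2
      (fderiv ℝ (fderiv ℝ σ) (τ z.1) (fderiv ℝ τ z.1 v.1) u) +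
        inner ℝ v.2 (fderiv ℝ σ (τ z.1) u) := by
    intro v u
    have h1 : HasFDerivAt (fun z => (canonicalTransition e e' z).2)
      ((ContinuousLinearMap.snd ℝ _ _).comp D) z := hasFDerivAt_snd.comp z hT.hasFDerivAt
    have h2 := h1.inner ℝ (hasFDerivAt_const u z)
    have h3 : HasFDerivAt (fun z : EuclideanSpace ℝ (Fin n) × EuclideanSpace ℝ (Fin n) =>
        fderiv ℝ σ (τ z.1) u) _ z := ((hσ2.comp z hτz).clm_apply (hasFDerivAt_const u z))
    have h4 := (hasFDerivAt_snd (𝕜 := ℝ) (p := z)).inner ℝ h3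
    have h5 : (fun z => inner ℝ (canonicalTransition e e' z).2 u) =
        fun z : EuclideanSpace ℝ (Fin n) × EuclideanSpace ℝ (Fin n) =>
          inner ℝ z.2 (fderiv ℝ σ (τ z.1) u) := by
      funext z
      simp only [canonicalTransition, adjoint_inner_left]
      rfl
    rw [h5] at h2
    have h6 := DFunLike.congr_fun (h2.unique h4) v
    simpa using h6
  set w := canonicalTransition e e' z with hw
  have hdf : fderiv ℝ (f ∘ canonicalTransition e e') z = (fderiv ℝ f w).comp D :=
    fderiv_comp z hf hT
  have hdh : fderiv ℝ (h ∘ canonicalTransition e e') z = (fderiv ℝ h w).comp D :=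
    fderiv_comp z hh hT
  obtain ⟨a, ha⟩ : ∃ a, ∀ u, fderiv ℝ f w (0, u) = inner ℝ a u := by
    refine ⟨(InnerProductSpace.toDual ℝ _).symm ((fderiv ℝ f w).comp
      (ContinuousLinearMap.inr ℝ _ _)), fun u => ?_⟩
    simp
  obtain ⟨b, hb⟩ : ∃ a, ∀ u, fderiv ℝ h w (0, u) = inner ℝ a u := by
    refine ⟨(InnerProductSpace.toDual ℝ _).symm ((fderiv ℝ h w).comp
      (ContinuousLinearMap.inr ℝ _ _)), fun u => ?_⟩
    simp
  have split : ∀ (A : EuclideanSpace ℝ (Fin n) × EuclideanSpace ℝ (Fin n) →L[ℝ] ℝ) v,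
      A v = A (v.1, 0) + A (0, v.2) := by
    intro A v
    rw [← map_add]
    simp
  have vert : ∀ u, (D (0, u)).1 = 0 := fun u => by rw [hD1]; simp
  have A1 : ∀ u, fderiv ℝ (f ∘ canonicalTransition e e') z (0, u) =
      inner ℝ (fderiv ℝ σ (τ z.1) a) u := by
    intro u
    rw [hdf, ContinuousLinearMap.comp_apply, split, vert, Prod.mk_zero_zero,
      map_zero, zero_add, ha, ← real_inner_comm, hD2]
    simp [real_inner_comm]
  have B1 : ∀ u, fderiv ℝ (h ∘ canonicalTransition e e') z (0, u) =
      inner ℝ (fderiv ℝ σ (τ z.1) b) u := by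
    intro u
    rw [hdh, ContinuousLinearMap.comp_apply, split, vert, Prod.mk_zero_zero,
      map_zero, zero_add, hb, ← real_inner_comm, hD2]
    simp [real_inner_comm]
  have hinv' : ∀ u, fderiv ℝ τ z.1 (fderiv ℝ σ (τ z.1) u) = u := fun u =>
    DFunLike.congr_fun hinv u
  rw [poissonBracket_eq_sub A1 B1, poissonBracket_eq_sub ha hb, hdf, hdh,
    ContinuousLinearMap.comp_apply, ContinuousLinearMap.comp_apply, split (fderiv ℝ f w),
    split (fderiv ℝ h w), ha, hb, ← real_inner_comm, hD2, ← real_inner_comm b, hD2, hD1, hD1]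
  simp only [hinv', inner_zero_left, add_zero]
  -- What remains besides the bracket is p · σ''(b, a) - p · σ''(a, b).
  rw [hsymm.eq b a]
  ring

theorem poissonBracket_inCanonicalCoordinates {F H : CotangentBundle n M → ℝ}
    (hF : IsSmoothOnCotangent F) (hH : IsSmoothOnCotangent H)
    (he : e ∈ IsManifold.maximalAtlas (𝓡 n) ∞ M) (he' : e' ∈ IsManifold.maximalAtlas (𝓡 n) ∞ M)
    {z : EuclideanSpace ℝ (Fin n) × EuclideanSpace ℝ (Fin n)} (hz : z ∈ canonicalOverlap e e') :
    poissonBracket (inCanonicalCoordinates F e) (inCanonicalCoordinates H e) z =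
      poissonBracket (inCanonicalCoordinates F e') (inCanonicalCoordinates H e')
        (canonicalTransition e e' z) := by
  have hmem : canonicalTransition e e' z ∈ canonicalDomain e' :=
    ⟨(mem_canonicalOverlap.1 (canonicalTransition_mem hz)).1, trivial⟩
  have hd : ∀ {G : CotangentBundle n M → ℝ}, IsSmoothOnCotangent G →
      DifferentiableAt ℝ (inCanonicalCoordinates G e') (canonicalTransition e e' z) := fun hG =>
    ((hG e' he').contDiffAt (isOpen_canonicalDomain.mem_nhds hmem)).differentiableAt (by simp)
  have hev : ∀ G : CotangentBundle n M → ℝ, inCanonicalCoordinates G e =ᶠ[𝓝 z]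
      inCanonicalCoordinates G e' ∘ canonicalTransition e e' := fun G => by
    filter_upwards [isOpen_canonicalOverlap.mem_nhds hz] with w hw
    exact inCanonicalCoordinates_canonicalTransition G he he' hw
  rw [← poissonBracket_canonicalTransition he he' hz (hd hF) (hd hH)]
  simp only [poissonBracket, (hev F).fderiv_eq, (hev H).fderiv_eq]

/-- The linear independence of differentials does not depend on the canonical coordinates. -/
theorem linearIndependent_fderiv_transition {F H : CotangentBundle n M → ℝ}
    (hF : IsSmoothOnCotangent F) (hH : IsSmoothOnCotangent H)
    (he : e ∈ IsManifold.maximalAtlas (𝓡 n) ∞ M) (he' : e' ∈ IsManifold.maximalAtlas (𝓡 n) ∞ M)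
    {z : EuclideanSpace ℝ (Fin n) × EuclideanSpace ℝ (Fin n)} (hz : z ∈ canonicalOverlap e e')
    (h : LinearIndependent ℝ ![fderiv ℝ (inCanonicalCoordinates F e) z,
      fderiv ℝ (inCanonicalCoordinates H e) z]) :
    LinearIndependent ℝ ![fderiv ℝ (inCanonicalCoordinates F e') (canonicalTransition e e' z),
      fderiv ℝ (inCanonicalCoordinates H e') (canonicalTransition e e' z)] := by
  have hmem : canonicalTransition e e' z ∈ canonicalDomain e' :=
    ⟨(mem_canonicalOverlap.1 (canonicalTransition_mem hz)).1, trivial⟩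
  have hT : DifferentiableAt ℝ (canonicalTransition e e') z :=
    ((contDiffOn_canonicalTransition he he').contDiffAt
      (isOpen_canonicalOverlap.mem_nhds hz)).differentiableAt (by simp)
  have hd : ∀ {G : CotangentBundle n M → ℝ}, IsSmoothOnCotangent G →
      fderiv ℝ (inCanonicalCoordinates G e) z =
        (fderiv ℝ (inCanonicalCoordinates G e') (canonicalTransition e e' z)).comp
          (fderiv ℝ (canonicalTransition e e') z) := fun {G} hG => by
    have h1 : DifferentiableAt ℝ (inCanonicalCoordinates G e') (canonicalTransition e e' z) :=
      ((hG e' he').contDiffAt (isOpen_canonicalDomain.mem_nhds hmem)).differentiableAt (by simp)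
    have hev : inCanonicalCoordinates G e =ᶠ[𝓝 z]
        inCanonicalCoordinates G e' ∘ canonicalTransition e e' := by
      filter_upwards [isOpen_canonicalOverlap.mem_nhds hz] with w hw
      exact inCanonicalCoordinates_canonicalTransition G he he' hw
    rw [hev.fderiv_eq, fderiv_comp z h1 hT]
  rw [LinearIndependent.pair_iff] at h ⊢
  intro s t hst
  refine h s t ?_
  rw [hd hF, hd hH]
  refine ContinuousLinearMap.ext fun v => ?_
  exact DFunLike.congr_fun hst (fderiv ℝ (canonicalTransition e e') z v)

end CanonicalTransition

/-! ### The kinetic energy in charts, and functions polynomial in the momenta. -/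

section Kinetic

variable {n : ℕ} {M : Type} [TopologicalSpace M] [ChartedSpace (EuclideanSpace ℝ (Fin n)) M]

/-- Needed because `ContinuousLinearMap.inverse` has the default value 0 outside the invertible
maps. Positivity gives injectivity, and a space and its dual have equal dimension. -/
theorem exists_equiv_of_pos {V : Type} [NormedAddCommGroup V] [NormedSpace ℝ V]
    [FiniteDimensional ℝ V] (g : V →L[ℝ] V →L[ℝ] ℝ) (hg : ∀ v, v ≠ 0 → 0 < g v v) :
    ∃ G : V ≃L[ℝ] (V →L[ℝ] ℝ), (G : V →L[ℝ] V →L[ℝ] ℝ) = g := by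
  have hinj : Function.Injective g.toLinearMap := by
    rw [injective_iff_map_eq_zero]
    intro v hv
    by_contra h
    have h1 := hg v h
    have h2 : g v = 0 := hv
    simp [h2] at h1
  have hfin : Module.finrank ℝ V = Module.finrank ℝ (V →L[ℝ] ℝ) := by
    rw [← (LinearMap.toContinuousLinearMap (𝕜 := ℝ) (E := V) (F' := ℝ)).finrank_eq,
      Module.finrank_linearMap, Module.finrank_self, mul_one]
  exact ⟨(LinearEquiv.ofInjectiveOfFinrankEq g.toLinearMap hinj hfin).toContinuousLinearEquiv,
    by ext; rfl⟩

theorem mdifferentiable_of_mem_maximalAtlas {e : OpenPartialHomeomorph M (EuclideanSpace ℝ (Fin n))}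
    (he : e ∈ IsManifold.maximalAtlas (𝓡 n) ∞ M) : e.MDifferentiable (𝓡 n) (𝓡 n) :=
  ⟨(contMDiffOn_of_mem_maximalAtlas he).mdifferentiableOn (by simp),
    (contMDiffOn_symm_of_mem_maximalAtlas he).mdifferentiableOn (by simp)⟩

variable {e : OpenPartialHomeomorph M (EuclideanSpace ℝ (Fin n))}

theorem mfderiv_symm_mfderiv (he : e ∈ IsManifold.maximalAtlas (𝓡 n) ∞ M)
    {q : EuclideanSpace ℝ (Fin n)} (hq : q ∈ e.target) (v : TangentSpace (𝓡 n) (e.symm q)) :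
    mfderiv (𝓡 n) (𝓡 n) e.symm q (mfderiv (𝓡 n) (𝓡 n) e (e.symm q) v) = v := by
  have h := (mdifferentiable_of_mem_maximalAtlas he).symm_comp_deriv (e.map_target hq)
  rw [e.right_inv hq] at h
  exact DFunLike.congr_fun h v

theorem mfderiv_mfderiv_symm (he : e ∈ IsManifold.maximalAtlas (𝓡 n) ∞ M)
    {q : EuclideanSpace ℝ (Fin n)} (hq : q ∈ e.target) (v : EuclideanSpace ℝ (Fin n)) :
    mfderiv (𝓡 n) (𝓡 n) e (e.symm q) (mfderiv (𝓡 n) (𝓡 n) e.symm q v) = v :=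
  DFunLike.congr_fun ((mdifferentiable_of_mem_maximalAtlas he).comp_symm_deriv hq) v

theorem contDiffAt_inverse_inner {V : Type} [NormedAddCommGroup V] [InnerProductSpace ℝ V]
    [CompleteSpace V] {A : V × V → V →L[ℝ] V →L[ℝ] ℝ} {z : V × V}
    (hG : ∃ G : V ≃L[ℝ] (V →L[ℝ] ℝ), (G : V →L[ℝ] V →L[ℝ] ℝ) = A z) (hA : ContDiffAt ℝ ∞ A z) :
    ContDiffAt ℝ ∞ (fun z : V × V => 1 / 2 * inner ℝ z.2 ((A z).inverse (innerSL ℝ z.2))) z := by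
  obtain ⟨G, hG⟩ := hG
  have h3 : ContDiffAt ℝ ∞ (ContinuousLinearMap.inverse : (V →L[ℝ] V →L[ℝ] ℝ) → _) (A z) := by
    rw [← hG]
    exact contDiffAt_map_inverse G
  have h4 : ContDiffAt ℝ ∞ (fun z : V × V => (innerSL ℝ z.2 : V →L[ℝ] ℝ)) z :=
    (innerSL ℝ : V →L[ℝ] _).contDiff.contDiffAt.comp z contDiffAt_snd
  have h5 : ContDiffAt ℝ ∞ (fun z => (A z).inverse) z := h3.comp z hA
  exact contDiffAt_const.mul (contDiffAt_snd.inner ℝ (h5.clm_apply h4))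

variable [IsManifold (𝓡 n) ∞ M]

/-- Coordinate fields are smooth sections of the tangent bundle for any chart of the maximal atlas.
Evaluating the metric section on them gives smooth components of the metric in that chart. -/
theorem contMDiffAt_symm_field (he : e ∈ IsManifold.maximalAtlas (𝓡 n) ∞ M)
    {q : EuclideanSpace ℝ (Fin n)} (hq : q ∈ e.target) (v : EuclideanSpace ℝ (Fin n)) :
    ContMDiffAt (𝓡 n) ((𝓡 n).prod 𝓘(ℝ, EuclideanSpace ℝ (Fin n))) ∞
      (fun q => (⟨e.symm q, mfderiv (𝓡 n) (𝓡 n) e.symm q v⟩ : TangentBundle (𝓡 n) M)) q := by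
  have h1 : ContMDiffOn (𝓡 n).tangent (𝓡 n).tangent ∞
      (tangentMapWithin (𝓡 n) (𝓡 n) e.symm e.target) _ :=
    (contMDiffOn_symm_of_mem_maximalAtlas he).contMDiffOn_tangentMapWithin
      (m := ∞) (by simp) e.open_target.uniqueMDiffOn
  have h2 : ContMDiffAt (𝓡 n) (𝓡 n).tangent ∞ (fun q : EuclideanSpace ℝ (Fin n) =>
      (⟨q, v⟩ : TangentBundle (𝓡 n) (EuclideanSpace ℝ (Fin n)))) q :=
    contMDiffAt_vectorSpace_iff_contDiffAt.2 contDiffAt_const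
  have hmem : Bundle.TotalSpace.proj ⁻¹' e.target ∈
      𝓝 (⟨q, v⟩ : TangentBundle (𝓡 n) (EuclideanSpace ℝ (Fin n))) :=
    (FiberBundle.continuous_proj (EuclideanSpace ℝ (Fin n))
      (TangentSpace (𝓡 n) (M := EuclideanSpace ℝ (Fin n)))).continuousAt.preimage_mem_nhds
        (e.open_target.mem_nhds hq)
  have h3 := (h1.contMDiffAt hmem).comp q h2
  refine h3.congr_of_eventuallyEq ?_
  filter_upwards [e.open_target.mem_nhds hq] with x hx
  simp only [tangentMapWithin, Function.comp_apply]
  rw [mfderivWithin_of_isOpen e.open_target hx]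

namespace ConservativeSystem

variable (S : ConservativeSystem n M)

/-- The kinetic energy can be read off from any vector `w` that is metrically dual to `α`, so the
metric never has to be inverted explicitly. -/
theorem kinetic_eq {x : M} {α : TangentSpace (𝓡 n) x →L[ℝ] ℝ} {w : TangentSpace (𝓡 n) x}
    (hw : ∀ v, S.metric.inner x w v = α v) : S.kinetic ⟨x, α⟩ = 1 / 2 * α w := by
  obtain ⟨G, hG⟩ := exists_equiv_of_pos (V := EuclideanSpace ℝ (Fin n)) (S.metric.inner x)
    (S.metric.pos x)
  have h1 : G w = α := by
    refine ContinuousLinearMap.ext fun v => ?_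
    exact (DFunLike.congr_fun (DFunLike.congr_fun hG w) v).trans (hw v)
  have h2 : (S.metric.inner x).inverse α = w := by
    have h3 : (S.metric.inner x).inverse α = G.symm α := by
      rw [← ContinuousLinearEquiv.coe_coe G.symm, ← ContinuousLinearMap.inverse_equiv]
      rw [hG]
      rfl
    rw [h3, ← h1]
    exact G.symm_apply_apply w
  rw [kinetic]
  simp only [h2]

/-- The metric tensor in the coordinates of the chart `e`. -/
def coordMetric (e : OpenPartialHomeomorph M (EuclideanSpace ℝ (Fin n)))
    (q : EuclideanSpace ℝ (Fin n)) :
    EuclideanSpace ℝ (Fin n) →L[ℝ] EuclideanSpace ℝ (Fin n) →L[ℝ] ℝ :=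
  ((mfderiv (𝓡 n) (𝓡 n) e.symm q).precomp ℝ).comp
    ((S.metric.inner (e.symm q)).comp (mfderiv (𝓡 n) (𝓡 n) e.symm q))

theorem coordMetric_apply (q v w : EuclideanSpace ℝ (Fin n)) :
    S.coordMetric e q v w = S.metric.inner (e.symm q) (mfderiv (𝓡 n) (𝓡 n) e.symm q v)
      (mfderiv (𝓡 n) (𝓡 n) e.symm q w) := rfl

theorem contDiffOn_coordMetric (he : e ∈ IsManifold.maximalAtlas (𝓡 n) ∞ M) :
    ContDiffOn ℝ ∞ (S.coordMetric e) e.target := by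
  rw [contDiffOn_clm_apply]
  intro v
  rw [contDiffOn_clm_apply]
  intro w q hq
  refine ContDiffAt.contDiffWithinAt ?_
  simp only [coordMetric_apply]
  have h1 : ContMDiffAt (𝓡 n) ((𝓡 n).prod 𝓘(ℝ, EuclideanSpace ℝ (Fin n) →L[ℝ]
      EuclideanSpace ℝ (Fin n) →L[ℝ] ℝ)) ∞ (fun q => Bundle.TotalSpace.mk'
      (EuclideanSpace ℝ (Fin n) →L[ℝ] EuclideanSpace ℝ (Fin n) →L[ℝ] ℝ)
      (E := fun x : M => TangentSpace (𝓡 n) x →L[ℝ] TangentSpace (𝓡 n) x →L[ℝ] ℝ)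
      (e.symm q) (S.metric.inner (e.symm q))) q :=
    S.metric.contMDiff.contMDiffAt.comp q (contMDiffAt_symm_of_mem_maximalAtlas he hq)
  have h2 := ContMDiffAt.clm_bundle_apply₂ (F₃ := ℝ) (E₃ := Bundle.Trivial M ℝ) h1
    (contMDiffAt_symm_field he hq v) (contMDiffAt_symm_field he hq w)
  have h3 := (Bundle.contMDiffAt_totalSpace.1 h2).2
  exact h3.contDiffAt

theorem exists_coordMetric_equiv (he : e ∈ IsManifold.maximalAtlas (𝓡 n) ∞ M)
    {q : EuclideanSpace ℝ (Fin n)} (hq : q ∈ e.target) :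
    ∃ G : EuclideanSpace ℝ (Fin n) ≃L[ℝ] (EuclideanSpace ℝ (Fin n) →L[ℝ] ℝ),
      (G : EuclideanSpace ℝ (Fin n) →L[ℝ] EuclideanSpace ℝ (Fin n) →L[ℝ] ℝ) =
        S.coordMetric e q := by
  refine exists_equiv_of_pos _ fun v hv => ?_
  rw [coordMetric_apply]
  refine S.metric.pos _ _ fun h => hv ?_
  rw [← mfderiv_mfderiv_symm he hq v, h]
  exact map_zero _

theorem inCanonicalCoordinates_kinetic (he : e ∈ IsManifold.maximalAtlas (𝓡 n) ∞ M)
    {z : EuclideanSpace ℝ (Fin n) × EuclideanSpace ℝ (Fin n)} (hz : z.1 ∈ e.target) :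
    inCanonicalCoordinates S.kinetic e z =
      1 / 2 * inner ℝ z.2 ((S.coordMetric e z.1).inverse (innerSL ℝ z.2)) := by
  obtain ⟨G, hG⟩ := S.exists_coordMetric_equiv he hz
  have h0 : (S.coordMetric e z.1).inverse (innerSL ℝ z.2) = G.symm (innerSL ℝ z.2) := by
    rw [← hG, ContinuousLinearMap.inverse_equiv]
    rfl
  have h1 : ∀ v, S.coordMetric e z.1 (G.symm (innerSL ℝ z.2)) v = inner ℝ z.2 v := by
    intro v
    rw [← hG]
    simp
  rw [inCanonicalCoordinates, cotangentPoint, h0,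
    S.kinetic_eq (w := mfderiv (𝓡 n) (𝓡 n) e.symm z.1 (G.symm (innerSL ℝ z.2)))]
  · congr 1
    have := mfderiv_mfderiv_symm he hz (G.symm (innerSL ℝ z.2))
    exact congrArg (innerSL ℝ z.2) this
  · intro v
    have h2 := h1 (mfderiv (𝓡 n) (𝓡 n) e (e.symm z.1) v)
    exact (congrArg (S.metric.inner (e.symm z.1) (mfderiv (𝓡 n) (𝓡 n) e.symm z.1
      (G.symm (innerSL ℝ z.2)))) (mfderiv_symm_mfderiv he hz v)).symm.trans h2

theorem isSmoothOnCotangent_kinetic : IsSmoothOnCotangent S.kinetic := by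
  intro e he z hz
  have hz1 : z.1 ∈ e.target := hz.1
  refine ContDiffAt.contDiffWithinAt ?_
  have hev : inCanonicalCoordinates S.kinetic e =ᶠ[𝓝 z] fun z =>
      1 / 2 * inner ℝ z.2 ((S.coordMetric e z.1).inverse (innerSL ℝ z.2)) := by
    filter_upwards [isOpen_canonicalDomain.mem_nhds hz] with w hw
    exact S.inCanonicalCoordinates_kinetic he hw.1
  refine ContDiffAt.congr_of_eventuallyEq ?_ hev
  exact contDiffAt_inverse_inner (S.exists_coordMetric_equiv he hz1) (ContDiffAt.comp z
    ((S.contDiffOn_coordMetric he).contDiffAt (e.open_target.mem_nhds hz1)) contDiffAt_fst)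

end ConservativeSystem

theorem inCanonicalCoordinates_base (f : M → ℝ) {z : EuclideanSpace ℝ (Fin n) ×
    EuclideanSpace ℝ (Fin n)} :
    inCanonicalCoordinates (fun ξ : CotangentBundle n M => f ξ.1) e z = f (e.symm z.1) := rfl

theorem isSmoothOnCotangent_base {f : M → ℝ} (hf : ContMDiff (𝓡 n) 𝓘(ℝ, ℝ) ∞ f) :
    IsSmoothOnCotangent (fun ξ : CotangentBundle n M => f ξ.1) := by
  intro e he
  have h1 : ContMDiffOn (𝓡 n) 𝓘(ℝ, ℝ) ∞ (f ∘ e.symm) e.target :=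
    hf.comp_contMDiffOn (contMDiffOn_symm_of_mem_maximalAtlas he)
  exact h1.contDiffOn.comp contDiffOn_fst fun z hz => hz.1

theorem IsSmoothOnCotangent.add {F G : CotangentBundle n M → ℝ} (hF : IsSmoothOnCotangent F)
    (hG : IsSmoothOnCotangent G) : IsSmoothOnCotangent (fun ξ => F ξ + G ξ) :=
  fun e he => (hF e he).add (hG e he)

theorem IsSmoothOnCotangent.mul {F G : CotangentBundle n M → ℝ} (hF : IsSmoothOnCotangent F)
    (hG : IsSmoothOnCotangent G) : IsSmoothOnCotangent (fun ξ => F ξ * G ξ) :=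
  fun e he => (hF e he).mul (hG e he)

theorem ConservativeSystem.isSmoothOnCotangent_hamiltonian (S : ConservativeSystem n M) :
    IsSmoothOnCotangent S.hamiltonian :=
  S.isSmoothOnCotangent_kinetic.add (isSmoothOnCotangent_base S.potential_smooth)

theorem IsPolynomialInMomenta.add {m : ℕ} {F G : CotangentBundle n M → ℝ}
    (hF : IsPolynomialInMomenta m F) (hG : IsPolynomialInMomenta m G) :
    IsPolynomialInMomenta m (fun ξ => F ξ + G ξ) := by
  intro e he q hq
  obtain ⟨P, hP, hPe⟩ := hF e he q hq
  obtain ⟨Q, hQ, hQe⟩ := hG e he q hq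
  refine ⟨P + Q, (MvPolynomial.totalDegree_add P Q).trans (max_le hP hQ), fun p => ?_⟩
  rw [map_add, ← hPe, ← hQe]
  rfl

theorem IsPolynomialInMomenta.mul {m k : ℕ} {F G : CotangentBundle n M → ℝ}
    (hF : IsPolynomialInMomenta m F) (hG : IsPolynomialInMomenta k G) :
    IsPolynomialInMomenta (m + k) (fun ξ => F ξ * G ξ) := by
  intro e he q hq
  obtain ⟨P, hP, hPe⟩ := hF e he q hq
  obtain ⟨Q, hQ, hQe⟩ := hG e he q hq
  refine ⟨P * Q, (MvPolynomial.totalDegree_mul P Q).trans (add_le_add hP hQ), fun p => ?_⟩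
  rw [map_mul, ← hPe, ← hQe]
  rfl

theorem IsPolynomialInMomenta.mono {m k : ℕ} (hmk : m ≤ k) {F : CotangentBundle n M → ℝ}
    (hF : IsPolynomialInMomenta m F) : IsPolynomialInMomenta k F := fun e he q hq =>
  let ⟨P, hP, hPe⟩ := hF e he q hq
  ⟨P, hP.trans hmk, hPe⟩

theorem isPolynomialInMomenta_base (f : M → ℝ) :
    IsPolynomialInMomenta 0 (fun ξ : CotangentBundle n M => f ξ.1) := fun e _ q _ =>
  ⟨MvPolynomial.C (f (e.symm q)), by simp, fun p => by
    rw [MvPolynomial.eval_C, inCanonicalCoordinates_base]⟩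

theorem isPolynomialInMomenta_momentum (X : ∀ x : M, TangentSpace (𝓡 n) x) :
    IsPolynomialInMomenta 1 (fun ξ : CotangentBundle n M => ξ.2 (X ξ.1)) := by
  intro e he q hq
  set c : EuclideanSpace ℝ (Fin n) := mfderiv (𝓡 n) (𝓡 n) e (e.symm q) (X (e.symm q)) with hc
  refine ⟨∑ i, MvPolynomial.C (c i) * MvPolynomial.X i, ?_, fun p => ?_⟩
  · refine MvPolynomial.totalDegree_finsetSum_le fun i _ => ?_
    refine (MvPolynomial.totalDegree_mul _ _).trans ?_
    simp
  · have : inCanonicalCoordinates (fun ξ : CotangentBundle n M => ξ.2 (X ξ.1)) e (q, p) =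
      inner ℝ p c := rfl
    rw [this, PiLp.inner_apply]
    simp

theorem ConservativeSystem.isPolynomialInMomenta_kinetic (S : ConservativeSystem n M) :
    IsPolynomialInMomenta 2 S.kinetic := by
  intro e he q hq
  set B : EuclideanSpace ℝ (Fin n) →L[ℝ] EuclideanSpace ℝ (Fin n) :=
    (S.coordMetric e q).inverse.comp (innerSL ℝ) with hB
  refine ⟨∑ i, ∑ j, MvPolynomial.C (1 / 2 * B (EuclideanSpace.single j 1) i) *
    (MvPolynomial.X i * MvPolynomial.X j), ?_, fun p => ?_⟩
  · refine MvPolynomial.totalDegree_finsetSum_le fun i _ =>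
      MvPolynomial.totalDegree_finsetSum_le fun j _ => ?_
    refine (MvPolynomial.totalDegree_mul _ _).trans ?_
    rw [MvPolynomial.totalDegree_C, zero_add]
    refine (MvPolynomial.totalDegree_mul _ _).trans ?_
    simp
  · rw [S.inCanonicalCoordinates_kinetic he (z := (q, p)) hq]
    have h1 : (S.coordMetric e q).inverse (innerSL ℝ p) = B p := rfl
    have h2 : B p = ∑ j, p j • B (EuclideanSpace.single j 1) := by
      conv_lhs => rw [← (EuclideanSpace.basisFun (Fin n) ℝ).sum_repr p]
      simp [map_sum]
    simp only [h1]
    rw [PiLp.inner_apply, Finset.mul_sum, map_sum]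
    refine Finset.sum_congr rfl fun i _ => ?_
    have h3 : B p i = ∑ j, p j * B (EuclideanSpace.single j 1) i := by
      rw [h2]
      simp
    simp only [map_sum, RCLike.inner_apply, conj_trivial]
    rw [h3, Finset.sum_mul, Finset.mul_sum]
    refine Finset.sum_congr rfl fun j _ => ?_
    simp
    ring

theorem ConservativeSystem.isPolynomialInMomenta_hamiltonian (S : ConservativeSystem n M) :
    IsPolynomialInMomenta 2 S.hamiltonian :=
  S.isPolynomialInMomenta_kinetic.add
    ((isPolynomialInMomenta_base S.potential).mono (Nat.zero_le _))

theorem trans_mem_maximalAtlas (φ : M ≃ₘ^∞⟮𝓡 n, 𝓡 n⟯ M)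
    (he : e ∈ IsManifold.maximalAtlas (𝓡 n) ∞ M) :
    φ.toHomeomorph.toOpenPartialHomeomorph.trans e ∈ IsManifold.maximalAtlas (𝓡 n) ∞ M := by
  refine OpenPartialHomeomorph.mem_maximalAtlas_of_contMDiffOn _ ?_ ?_
  · refine (contMDiffOn_of_mem_maximalAtlas he).comp φ.contMDiff.contMDiffOn fun x hx => ?_
    simpa [OpenPartialHomeomorph.trans_source] using hx
  · refine φ.symm.contMDiff.comp_contMDiffOn
      ((contMDiffOn_symm_of_mem_maximalAtlas he).mono fun x hx => ?_)
    simpa [OpenPartialHomeomorph.trans_target] using hx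

/-- If the chart on the source is the pullback by `φ` of the chart on the target, the lift of `φ` is
the identity in canonical coordinates. Statements about lifts thereby become statements about a
change of chart. -/
theorem cotangentLift_cotangentPoint (φ : M ≃ₘ^∞⟮𝓡 n, 𝓡 n⟯ M)
    (he : e ∈ IsManifold.maximalAtlas (𝓡 n) ∞ M)
    {z : EuclideanSpace ℝ (Fin n) × EuclideanSpace ℝ (Fin n)} (hz : z.1 ∈ e.target) :
    cotangentLift φ (cotangentPoint (φ.toHomeomorph.toOpenPartialHomeomorph.trans e) z) =
      cotangentPoint e z := by
  set x := e.symm z.1 with hx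
  have hx' : φ (φ.symm x) = x := φ.apply_symm_apply x
  have hed : MDifferentiableAt (𝓡 n) (𝓡 n) e (φ (φ.symm x)) := by
    rw [hx']
    exact (contMDiffAt_of_mem_maximalAtlas he (e.map_target hz)).mdifferentiableAt (by simp)
  have h1 : mfderiv (𝓡 n) (𝓡 n) (φ.toHomeomorph.toOpenPartialHomeomorph.trans e) (φ.symm x) =
      (mfderiv (𝓡 n) (𝓡 n) e (φ (φ.symm x))).comp (mfderiv (𝓡 n) (𝓡 n) φ (φ.symm x)) :=
    mfderiv_comp (φ.symm x) hed (φ.mdifferentiable (by simp) _)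
  have h2 : (mfderiv (𝓡 n) (𝓡 n) φ (φ.symm x)).comp (mfderiv (𝓡 n) (𝓡 n) φ.symm x) =
      ContinuousLinearMap.id ℝ (TangentSpace (𝓡 n) x) := by
    have h3 := mfderiv_comp (I'' := 𝓡 n) x (φ.mdifferentiable (by simp) (φ.symm x))
      (φ.symm.mdifferentiable (by simp) x)
    have h4 : (φ ∘ φ.symm : M → M) = id := by
      funext y
      exact φ.apply_symm_apply y
    rw [h4, mfderiv_id] at h3
    exact h3.symm
  have h5 : cotangentLift φ (cotangentPoint (φ.toHomeomorph.toOpenPartialHomeomorph.trans e) z) =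
      ⟨φ (φ.symm x), ((innerSL ℝ z.2 : EuclideanSpace ℝ (Fin n) →L[ℝ] ℝ).comp
        (mfderiv (𝓡 n) (𝓡 n) (φ.toHomeomorph.toOpenPartialHomeomorph.trans e) (φ.symm x))).comp
          (mfderiv (𝓡 n) (𝓡 n) φ.symm (φ (φ.symm x)))⟩ := rfl
  rw [h5, h1]
  set g : M → CotangentBundle n M := fun y => ⟨y, ((innerSL ℝ z.2 :
    EuclideanSpace ℝ (Fin n) →L[ℝ] ℝ).comp ((mfderiv (𝓡 n) (𝓡 n) e y).comp
      (mfderiv (𝓡 n) (𝓡 n) φ (φ.symm x) : EuclideanSpace ℝ (Fin n) →L[ℝ] _))).comp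
          (mfderiv (𝓡 n) (𝓡 n) φ.symm y : EuclideanSpace ℝ (Fin n) →L[ℝ] _)⟩ with hg
  change g (φ (φ.symm x)) = _
  rw [hx', hg]
  refine Sigma.ext rfl (heq_of_eq ?_)
  refine ContinuousLinearMap.ext (M₁ := EuclideanSpace ℝ (Fin n)) (M₂ := ℝ) fun v => ?_
  have h6 := DFunLike.congr_fun h2 v
  exact congrArg (fun w : EuclideanSpace ℝ (Fin n) => innerSL ℝ z.2
    (mfderiv (𝓡 n) (𝓡 n) e x w)) h6

end Kinetic

/-! ### The coordinates (φ, y) on the sphere minus its poles. -/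

section PolarMap

abbrev E2 : Type := EuclideanSpace ℝ (Fin 2)

instance : Fact (Module.finrank ℝ E3 = 2 + 1) := ⟨finrank_euclideanSpace_fin⟩

/-- The coordinates `(φ, y)` on the sphere minus the poles. -/
def polarMap (z : E2) : S2 := spherePoint (z 0) (z 1)

theorem polarMap_coe (z : E2) : (polarMap z : E3) =
    !₂[Real.cos (z 0) / Real.cosh (z 1), Real.sin (z 0) / Real.cosh (z 1),
      Real.sinh (z 1) / Real.cosh (z 1)] := rfl

theorem contDiff_polarMap_coe : ContDiff ℝ ∞ (fun z : E2 => (polarMap z : E3)) := by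
  have h0 : ∀ i : Fin 2, ContDiff ℝ ∞ (fun z : E2 => z i) := fun i =>
    (EuclideanSpace.proj i : E2 →L[ℝ] ℝ).contDiff
  have hc : ContDiff ℝ ∞ (fun z : E2 => Real.cosh (z 1)) := Real.contDiff_cosh.comp (h0 1)
  have hne : ∀ z : E2, Real.cosh (z 1) ≠ 0 := fun z => (Real.cosh_pos _).ne'
  rw [contDiff_euclidean]
  intro i
  fin_cases i
  · exact (Real.contDiff_cos.comp (h0 0)).div hc hne
  · exact (Real.contDiff_sin.comp (h0 0)).div hc hne
  · exact (Real.contDiff_sinh.comp (h0 1)).div hc hne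

theorem contMDiff_polarMap : ContMDiff (𝓡 2) (𝓡 2) ∞ polarMap :=
  ContMDiff.codRestrict_sphere (contDiff_polarMap_coe.contMDiff) fun z => (polarMap z).2

/-- The image of `∂/∂φ` in `ℝ³`. -/
def polarTangentφ (z : E2) : E3 :=
  !₂[-Real.sin (z 0) / Real.cosh (z 1), Real.cos (z 0) / Real.cosh (z 1), 0]

/-- The image of `∂/∂y` in `ℝ³`. -/
def polarTangentY (z : E2) : E3 :=
  !₂[-Real.cos (z 0) * Real.sinh (z 1) / Real.cosh (z 1) ^ 2,
    -Real.sin (z 0) * Real.sinh (z 1) / Real.cosh (z 1) ^ 2, 1 / Real.cosh (z 1) ^ 2]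

theorem inclusionDeriv_comp_mfderiv {n : ℕ} {M : Type} [TopologicalSpace M]
    [ChartedSpace (EuclideanSpace ℝ (Fin n)) M] {f : M → S2} {x : M}
    (hf : MDifferentiableAt (𝓡 n) (𝓡 2) f x) (v : TangentSpace (𝓡 n) x) :
    inclusionDeriv (f x) (mfderiv (𝓡 n) (𝓡 2) f x v) =
      mfderiv (𝓡 n) 𝓘(ℝ, E3) (fun y => (f y : E3)) x v := by
  have h1 : MDifferentiableAt (𝓡 2) 𝓘(ℝ, E3) (Subtype.val : S2 → E3) (f x) :=
    (contMDiff_coe_sphere (n := 2) (m := ∞)).contMDiffAt.mdifferentiableAt (by simp)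
  have h2 := mfderiv_comp x h1 hf
  exact (DFunLike.congr_fun h2 v).symm

/-- The differential of `polarMap`. -/
def polarDeriv (z : E2) : E2 →L[ℝ] TangentSpace (𝓡 2) (polarMap z) :=
  mfderiv (𝓡 2) (𝓡 2) polarMap z

theorem inclusionDeriv_polarDeriv (z v : E2) :
    inclusionDeriv (polarMap z) (polarDeriv z v) =
      v 0 • polarTangentφ z + v 1 • polarTangentY z := by
  have h0 := inclusionDeriv_comp_mfderiv (contMDiff_polarMap.mdifferentiable (by simp) z) v
  have h1 : mfderiv (𝓡 2) 𝓘(ℝ, E3) (fun y => (polarMap y : E3)) z v =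
      fderiv ℝ (fun y => (polarMap y : E3)) z v :=
    DFunLike.congr_fun mfderiv_eq_fderiv v
  refine (h0.trans h1).trans ?_
  have hl : HasDerivAt (fun t : ℝ => z + t • v) v 0 := by
    simpa using ((hasDerivAt_id (0 : ℝ)).smul_const v).const_add z
  have hd : ∀ i : Fin 2, HasDerivAt (fun t : ℝ => (z + t • v) i) (v i) 0 := fun i =>
    (EuclideanSpace.proj i : E2 →L[ℝ] ℝ).hasFDerivAt.comp_hasDerivAt 0 hl
  have hc := (hd 1).cosh
  have hne : Real.cosh (z 1) ≠ 0 := (Real.cosh_pos _).ne'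
  have hne' : Real.cosh ((z + (0 : ℝ) • v) 1) ≠ 0 := (Real.cosh_pos _).ne'
  have hF : HasFDerivAt (fun y => (polarMap y : E3)) (fderiv ℝ (fun y => (polarMap y : E3)) z)
      (z + (0 : ℝ) • v) := by
    simpa using (contDiff_polarMap_coe.differentiable (by simp) z).hasFDerivAt
  have hF' : HasDerivAt (fun t : ℝ => (polarMap (z + t • v) : E3))
      (fderiv ℝ (fun y => (polarMap y : E3)) z v) 0 :=
    HasFDerivAt.comp_hasDerivAt (l := fun y => (polarMap y : E3)) (f := fun t : ℝ => z + t • v)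
      0 hF hl
  have key : ∀ i, HasDerivAt (fun t : ℝ => (polarMap (z + t • v) : E3) i)
      (fderiv ℝ (fun y => (polarMap y : E3)) z v i) 0 := fun i =>
    HasFDerivAt.comp_hasDerivAt (f := fun t : ℝ => (polarMap (z + t • v) : E3)) 0
      (EuclideanSpace.proj i : E3 →L[ℝ] ℝ).hasFDerivAt hF'
  ext i
  fin_cases i
  · refine ((key 0).unique ((hd 0).cos.div hc hne')).trans ?_
    simp [polarTangentφ, polarTangentY]
    field_simp
    ring
  · refine ((key 1).unique ((hd 0).sin.div hc hne')).trans ?_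
    simp [polarTangentφ, polarTangentY]
    field_simp
    ring
  · refine ((key 2).unique ((hd 1).sinh.div hc hne')).trans ?_
    simp [polarTangentφ, polarTangentY]
    field_simp
    rw [Real.cosh_sq]
    ring

theorem inner_polarTangent (z v w : E2) :
    inner ℝ (v 0 • polarTangentφ z + v 1 • polarTangentY z)
      (w 0 • polarTangentφ z + w 1 • polarTangentY z) =
      (v 0 * w 0 + v 1 * w 1) / Real.cosh (z 1) ^ 2 := by
  have hne : Real.cosh (z 1) ≠ 0 := (Real.cosh_pos _).ne'
  simp only [PiLp.inner_apply, Fin.sum_univ_three, polarTangentφ, polarTangentY]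
  simp
  field_simp
  have h1 := Real.sin_sq_add_cos_sq (z 0)
  have h2 := Real.cosh_sq (z 1)
  have h3 : Real.cos (z 0) ^ 2 = 1 - Real.sin (z 0) ^ 2 := by linarith
  ring_nf
  simp only [h3, h2, show Real.cosh (z 1) ^ 4 = (Real.cosh (z 1) ^ 2) ^ 2 by ring]
  ring

theorem injective_polarDeriv (z : E2) : Function.Injective (polarDeriv z) := by
  rw [injective_iff_map_eq_zero]
  intro v hv
  have h3 := inner_polarTangent z v v
  rw [← inclusionDeriv_polarDeriv, hv, map_zero, inner_zero_left] at h3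
  have hne : 0 < Real.cosh (z 1) := Real.cosh_pos _
  have h4 : v 0 * v 0 + v 1 * v 1 = 0 := by
    rcases div_eq_zero_iff.1 h3.symm with h | h
    · exact h
    · exact absurd h (by positivity)
  have h5 : v 0 = 0 := by nlinarith [mul_self_nonneg (v 0), mul_self_nonneg (v 1)]
  have h6 : v 1 = 0 := by nlinarith [mul_self_nonneg (v 0), mul_self_nonneg (v 1)]
  ext i
  fin_cases i
  · exact h5
  · exact h6

/-- By the inverse function theorem applied to a chart composed with `polarMap`, local inverses of
`polarMap` are charts of the maximal atlas. So (φ, y) may be used like any other local coordinates.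
-/
theorem exists_chart_polarMap (z₀ : E2) : ∃ e ∈ IsManifold.maximalAtlas (𝓡 2) ∞ S2,
    z₀ ∈ e.target ∧ ∀ z ∈ e.target, e.symm z = polarMap z := by
  set c := chartAt E2 (polarMap z₀) with hc
  have hcm : c ∈ IsManifold.maximalAtlas (𝓡 2) ∞ S2 := IsManifold.chart_mem_maximalAtlas _
  set U : Set E2 := polarMap ⁻¹' c.source with hU
  have hUo : IsOpen U := c.open_source.preimage contMDiff_polarMap.continuous
  have hgs : ∀ z ∈ U, ContDiffAt ℝ ∞ (c ∘ polarMap) z := fun z hz =>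
    ((contMDiffAt_of_mem_maximalAtlas hcm hz).comp z contMDiff_polarMap.contMDiffAt).contDiffAt
  have hgd : ∀ z ∈ U, ∃ G : E2 ≃L[ℝ] E2, HasFDerivAt (c ∘ polarMap) (G : E2 →L[ℝ] E2) z := by
    intro z hz
    have h1 : (c ∘ polarMap) = c ∘ polarMap := rfl
    have h2 := mfderiv_comp (I'' := 𝓡 2) z
      ((contMDiffAt_of_mem_maximalAtlas hcm hz).mdifferentiableAt (by simp))
      (contMDiff_polarMap.mdifferentiable (by simp) z)
    have hinj : Function.Injective (fderiv ℝ (c ∘ polarMap) z) := by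
      rw [mfderiv_eq_fderiv] at h2
      intro v w hvw
      have h3 := DFunLike.congr_fun h2 v
      have h4 := DFunLike.congr_fun h2 w
      exact injective_polarDeriv z ((mdifferentiable_of_mem_maximalAtlas hcm).mfderiv_injective
        hz (h3.symm.trans (hvw.trans h4)))
    refine ⟨(LinearEquiv.ofInjectiveEndo (fderiv ℝ (c ∘ polarMap) z).toLinearMap
      hinj).toContinuousLinearEquiv, ?_⟩
    exact ((hgs z hz).differentiableAt (by simp)).hasFDerivAt
  have hz₀ : z₀ ∈ U := mem_chart_source E2 (polarMap z₀)
  obtain ⟨G, hG⟩ := hgd z₀ hz₀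
  set h := (hgs z₀ hz₀).toOpenPartialHomeomorph (c ∘ polarMap) hG (by simp) with hh
  have hcoe : ∀ z, h z = c (polarMap z) := fun z => rfl
  have hmem : z₀ ∈ h.source := (hgs z₀ hz₀).mem_toOpenPartialHomeomorph_source hG (by simp)
  -- The wanted chart is `c` followed by the inverse of `c ∘ polarMap`. The restriction to `U` keeps
  -- `polarMap` inside the source of `c`, where `c.symm ∘ c` cancels.
  set k := h.restrOpen U hUo with hk
  have hks : k.source = h.source ∩ U := rfl
  have hkc : ∀ z, k z = c (polarMap z) := fun z => rfl
  set e := c.trans k.symm with he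
  have het : ∀ z ∈ e.target, z ∈ h.source ∩ U := fun z hz => by
    have : z ∈ k.source := by
      rw [he, OpenPartialHomeomorph.trans_target] at hz
      exact hz.1
    exact this
  have hes : ∀ z ∈ e.target, e.symm z = polarMap z := fun z hz => by
    have h1 : e.symm z = c.symm (k z) := by simp [he]
    rw [h1, hkc, c.left_inv (het z hz).2]
  refine ⟨e, ?_, ?_, hes⟩
  · refine OpenPartialHomeomorph.mem_maximalAtlas_of_contMDiffOn _ ?_ ?_
    · have h1 : ContMDiffOn (𝓡 2) (𝓡 2) ∞ k.symm k.target := by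
        intro x hx
        have hx' : k.symm x ∈ h.source ∩ U := k.map_target hx
        obtain ⟨G', hG'⟩ := hgd _ hx'.2
        exact (k.contDiffAt_symm hx hG' (hgs _ hx'.2)).contMDiffAt.contMDiffWithinAt
      refine h1.comp ((contMDiffOn_of_mem_maximalAtlas hcm).mono fun x hx => ?_) fun x hx => ?_
      · rw [he, OpenPartialHomeomorph.trans_source] at hx; exact hx.1
      · rw [he, OpenPartialHomeomorph.trans_source] at hx; exact hx.2
    · exact contMDiff_polarMap.contMDiffOn.congr hes
  · rw [he, OpenPartialHomeomorph.trans_target]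
    refine ⟨⟨hmem, hz₀⟩, ?_⟩
    change k z₀ ∈ c.target
    rw [hkc]
    exact c.map_source hz₀

theorem polarMap_eq_iff (z w : E2) : polarMap z = polarMap w ↔
    (∃ k : ℤ, z 0 = w 0 + k * (2 * Real.pi)) ∧ z 1 = w 1 := by
  constructor
  · intro h
    have hE := congrArg (fun x : S2 => (x : E3)) h
    have h0 := congrArg (fun x : E3 => x 0) hE
    have h1 := congrArg (fun x : E3 => x 1) hE
    have h2 := congrArg (fun x : E3 => x 2) hE
    simp [polarMap_coe] at h0 h1 h2
    have hy : z 1 = w 1 := by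
      rw [← Real.tanh_eq_sinh_div_cosh, ← Real.tanh_eq_sinh_div_cosh] at h2
      exact Real.tanh_injective h2
    rw [hy] at h0 h1
    have hne : Real.cosh (w 1) ≠ 0 := (Real.cosh_pos _).ne'
    have hcs : Real.cos (z 0) = Real.cos (w 0) := by field_simp at h0; exact h0
    have hsn : Real.sin (z 0) = Real.sin (w 0) := by field_simp at h1; exact h1
    refine ⟨?_, hy⟩
    have h3 : ((z 0 : ℝ) : Real.Angle) = ((w 0 : ℝ) : Real.Angle) :=
      Real.Angle.cos_sin_inj hcs hsn
    obtain ⟨k, hk⟩ := Real.Angle.angle_eq_iff_two_pi_dvd_sub.1 h3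
    exact ⟨k, by linarith⟩
  · rintro ⟨⟨k, hk⟩, hy⟩
    apply Subtype.ext
    rw [polarMap_coe, polarMap_coe, hk, hy, Real.cos_add_int_mul_two_pi,
      Real.sin_add_int_mul_two_pi]

theorem polarMap_two (z : E2) : (polarMap z : E3) 2 = Real.tanh (z 1) := by
  rw [Real.tanh_eq_sinh_div_cosh]
  simp [polarMap_coe]

theorem mem_range_polarMap (x : S2) : x ∈ Set.range polarMap ↔ ((x : E3) 2) ^ 2 < 1 := by
  constructor
  · rintro ⟨z, rfl⟩
    rw [polarMap_two, sq_lt_one_iff_abs_lt_one]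
    exact Real.abs_tanh_lt_one _
  · intro h
    have hsum := sphere_sq_sum x
    set y := Real.artanh ((x : E3) 2) with hy
    have hmem : (x : E3) 2 ∈ Set.Ioo (-1 : ℝ) 1 := by
      rw [sq_lt_one_iff_abs_lt_one] at h
      exact abs_lt.1 h
    have hty : Real.tanh y = (x : E3) 2 := Real.tanh_artanh hmem
    have hpos : 0 < Real.cosh y := Real.cosh_pos y
    have hcos : Real.cosh y ^ 2 * (1 - (x : E3) 2 ^ 2) = 1 := by
      rw [← hty, Real.tanh_eq_sinh_div_cosh]
      field_simp
      linarith [Real.cosh_sq y]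
    set a := (x : E3) 0 * Real.cosh y with ha
    set b := (x : E3) 1 * Real.cosh y with hb
    have hab : a ^ 2 + b ^ 2 = 1 := by
      rw [ha, hb]
      linear_combination hcos + Real.cosh y ^ 2 * hsum
    set c : ℂ := ⟨a, b⟩ with hc
    have hn : ‖c‖ = 1 := by
      have : ‖c‖ ^ 2 = 1 := by
        rw [← Complex.normSq_eq_norm_sq, Complex.normSq_apply, hc]
        linarith
      exact (pow_eq_one_iff_of_nonneg (norm_nonneg _) two_ne_zero).1 this
    have hc0 : c ≠ 0 := by
      intro h0
      rw [h0] at hn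
      simp at hn
    have hcs : Real.cos c.arg = a := by rw [Complex.cos_arg hc0, hn, hc]; simp
    have hsn : Real.sin c.arg = b := by rw [Complex.sin_arg, hn, hc]; simp
    refine ⟨!₂[c.arg, y], Subtype.ext ?_⟩
    rw [polarMap_coe]
    ext i
    fin_cases i
    · simp [hcs, ha, hpos.ne']
    · simp [hsn, hb, hpos.ne']
    · simpa [← Real.tanh_eq_sinh_div_cosh] using hty

theorem pole_of_notMem_range {x : S2} (hx : x ∉ Set.range polarMap) :
    (x : E3) = !₂[0, 0, 1] ∨ (x : E3) = !₂[0, 0, -1] := by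
  rw [mem_range_polarMap, not_lt] at hx
  have hsum := sphere_sq_sum x
  have h0 : (x : E3) 0 = 0 := by nlinarith [sq_nonneg ((x : E3) 0), sq_nonneg ((x : E3) 1)]
  have h1 : (x : E3) 1 = 0 := by nlinarith [sq_nonneg ((x : E3) 0), sq_nonneg ((x : E3) 1)]
  have h2 : (x : E3) 2 ^ 2 = 1 := by rw [h0, h1] at hsum; linarith
  rcases mul_self_eq_one_iff.1 ((sq ((x : E3) 2)).symm.trans h2) with h | h
  · left
    ext i; fin_cases i <;> simp [h0, h1, h]
  · right
    ext i; fin_cases i <;> simp [h0, h1, h]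

end PolarMap

/-! ### Functions on T*S² in the coordinates (φ, y, P, Q), and extension over the poles. -/

section PolarCoordinates

/-- Testing on vectors of the model space, to which all tangent spaces unfold, avoids heterogeneous
equalities between fibres. -/
theorem cotangent_ext {n : ℕ} {M : Type} [TopologicalSpace M]
    [ChartedSpace (EuclideanSpace ℝ (Fin n)) M] {x y : M} (hxy : x = y)
    {α : TangentSpace (𝓡 n) x →L[ℝ] ℝ} {β : TangentSpace (𝓡 n) y →L[ℝ] ℝ}
    (h : ∀ v : EuclideanSpace ℝ (Fin n), α v = β v) :
    (⟨x, α⟩ : CotangentBundle n M) = ⟨y, β⟩ := by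
  subst hxy
  exact Sigma.ext rfl (heq_of_eq (ContinuousLinearMap.ext h))

theorem exists_polarDeriv_equiv (z : E2) :
    ∃ G : E2 ≃L[ℝ] TangentSpace (𝓡 2) (polarMap z), ∀ v, G v = polarDeriv z v := by
  have h : Function.Injective ((polarDeriv z : E2 →L[ℝ] E2)).toLinearMap := injective_polarDeriv z
  exact ⟨(LinearEquiv.ofInjectiveEndo (polarDeriv z : E2 →L[ℝ] E2).toLinearMap
    h).toContinuousLinearEquiv, fun v => rfl⟩

/-- The differential of `polarMap` as an isomorphism. -/
def polarEquiv (z : E2) : E2 ≃L[ℝ] TangentSpace (𝓡 2) (polarMap z) :=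
  Classical.choose (exists_polarDeriv_equiv z)

theorem polarEquiv_apply (z v : E2) : polarEquiv z v = polarDeriv z v :=
  Classical.choose_spec (exists_polarDeriv_equiv z) v

/-- The point of the cotangent bundle of the sphere with coordinates `(φ, y)` and momenta. -/
def polarPoint (w : E2 × E2) : CotangentBundle 2 S2 :=
  ⟨polarMap w.1, (innerSL ℝ w.2 : E2 →L[ℝ] ℝ).comp
    ((polarEquiv w.1).symm : TangentSpace (𝓡 2) (polarMap w.1) →L[ℝ] E2)⟩

theorem polarPoint_polarDeriv (w : E2 × E2) (v : E2) :
    (polarPoint w).2 (polarDeriv w.1 v) = inner ℝ w.2 v := by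
  rw [← polarEquiv_apply]
  change innerSL ℝ w.2 ((polarEquiv w.1).symm (polarEquiv w.1 v)) = _
  rw [ContinuousLinearEquiv.symm_apply_apply]
  rfl

/-- A function on the cotangent bundle of the sphere in the coordinates `(φ, y)` and momenta. -/
def inPolar (F : CotangentBundle 2 S2 → ℝ) (w : E2 × E2) : ℝ := F (polarPoint w)

theorem exists_polarPoint_eq {ξ : CotangentBundle 2 S2} (h : ξ.1 ∈ Set.range polarMap) :
    ∃ w, polarPoint w = ξ := by
  obtain ⟨x, α⟩ := ξ
  obtain ⟨z, hz⟩ := h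
  simp only at hz
  subst hz
  refine ⟨(z, (InnerProductSpace.toDual ℝ E2).symm
    (α.comp (polarEquiv z : E2 →L[ℝ] TangentSpace (𝓡 2) (polarMap z)))), cotangent_ext rfl fun v => ?_⟩
  have h1 : ∀ u : E2, inner ℝ ((InnerProductSpace.toDual ℝ E2).symm
    (α.comp (polarEquiv z : E2 →L[ℝ] TangentSpace (𝓡 2) (polarMap z)))) u = α (polarEquiv z u) := by
    intro u
    rw [InnerProductSpace.toDual_symm_apply]
    rfl
  refine (h1 ((polarEquiv z).symm v)).trans ?_
  exact congrArg α ((polarEquiv z).apply_symm_apply v)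

variable {e : OpenPartialHomeomorph S2 E2}

theorem cotangentPoint_eq_polarPoint (he : e ∈ IsManifold.maximalAtlas (𝓡 2) ∞ S2)
    (hep : ∀ z ∈ e.target, e.symm z = polarMap z) {w : E2 × E2} (hw : w ∈ canonicalDomain e) :
    cotangentPoint e w = polarPoint w := by
  have hw1 : w.1 ∈ e.target := hw.1
  refine cotangent_ext (hep _ hw1) fun v => ?_
  set u : E2 := mfderiv (𝓡 2) (𝓡 2) e (e.symm w.1) v with hu
  have h1 : mfderiv (𝓡 2) (𝓡 2) e.symm w.1 u = v := mfderiv_symm_mfderiv he hw1 v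
  have h2 : e.symm =ᶠ[𝓝 w.1] polarMap := by
    filter_upwards [e.open_target.mem_nhds hw1] with x hx using hep x hx
  have h3 := h2.mfderiv_eq (I := 𝓡 2) (I' := 𝓡 2)
  have h4 : (polarDeriv w.1 u : E2) = v :=
    (DFunLike.congr_fun h3 u : (mfderiv (𝓡 2) (𝓡 2) e.symm w.1 u : E2) = polarDeriv w.1 u).symm.trans h1
  have h5 := polarPoint_polarDeriv w u
  have h6 : (polarPoint w).2 v = inner ℝ w.2 u :=
    (congrArg (fun t : E2 => (polarPoint w).2 t) h4).symm.trans h5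
  exact h6.symm

theorem inCanonicalCoordinates_eq_inPolar (F : CotangentBundle 2 S2 → ℝ)
    (he : e ∈ IsManifold.maximalAtlas (𝓡 2) ∞ S2)
    (hep : ∀ z ∈ e.target, e.symm z = polarMap z) {w : E2 × E2} (hw : w ∈ canonicalDomain e) :
    inCanonicalCoordinates F e =ᶠ[𝓝 w] inPolar F := by
  filter_upwards [isOpen_canonicalDomain.mem_nhds hw] with x hx
  rw [inCanonicalCoordinates, inPolar, cotangentPoint_eq_polarPoint he hep hx]

theorem IsSmoothOnCotangent.contDiff_inPolar {F : CotangentBundle 2 S2 → ℝ}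
    (hF : IsSmoothOnCotangent F) : ContDiff ℝ ∞ (inPolar F) := by
  rw [contDiff_iff_contDiffAt]
  intro w
  obtain ⟨e, he, hz, hep⟩ := exists_chart_polarMap w.1
  have hw : w ∈ canonicalDomain e := ⟨hz, trivial⟩
  exact ((hF e he).contDiffAt (isOpen_canonicalDomain.mem_nhds hw)).congr_of_eventuallyEq
    (inCanonicalCoordinates_eq_inPolar F he hep hw).symm

theorem IsConserved.poissonBracket_inPolar {F H : CotangentBundle 2 S2 → ℝ}
    (h : IsConserved F H) (w : E2 × E2) : poissonBracket (inPolar F) (inPolar H) w = 0 := by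
  obtain ⟨e, he, hz, hep⟩ := exists_chart_polarMap w.1
  have hw : w ∈ canonicalDomain e := ⟨hz, trivial⟩
  rw [← h e he w hw]
  simp only [poissonBracket, (inCanonicalCoordinates_eq_inPolar F he hep hw).fderiv_eq,
    (inCanonicalCoordinates_eq_inPolar H he hep hw).fderiv_eq]

theorem IsPolynomialInMomenta.inPolar {m : ℕ} {F : CotangentBundle 2 S2 → ℝ}
    (hF : IsPolynomialInMomenta m F) (z : E2) : ∃ P : MvPolynomial (Fin 2) ℝ, P.totalDegree ≤ m ∧
      ∀ p : E2, inPolar F (z, p) = MvPolynomial.eval p P := by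
  obtain ⟨e, he, hz, hep⟩ := exists_chart_polarMap z
  obtain ⟨P, hP, hPe⟩ := hF e he z hz
  exact ⟨P, hP, fun p => by
    rw [← hPe, inCanonicalCoordinates, cotangentPoint_eq_polarPoint he hep ⟨hz, trivial⟩]; rfl⟩

/-- Only two points of the sphere are not in the range of `polarMap`, hence only finitely many
positions in a chart are bad; the momenta need not be moved. The arguments extending polar
statements to T*S² rest on this density. -/
theorem exists_near_polar (e : OpenPartialHomeomorph S2 E2) {w : E2 × E2}
    (hw : w ∈ canonicalDomain e) {s : Set (E2 × E2)} (hs : s ∈ 𝓝 w) :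
    ∃ w' ∈ s, w' ∈ canonicalDomain e ∧ e.symm w'.1 ∈ Set.range polarMap := by
  set B : Set E2 := {q | q ∈ e.target ∧ e.symm q ∉ Set.range polarMap} with hB
  have hfin : B.Finite := by
    have h1 : ({x : S2 | x ∉ Set.range polarMap}).Finite := by
      have h2 : (Subtype.val '' {x : S2 | x ∉ Set.range polarMap}).Finite := by
        refine (Set.toFinite ({!₂[0, 0, 1], !₂[0, 0, -1]} : Set E3)).subset ?_
        rintro _ ⟨x, hx, rfl⟩
        exact pole_of_notMem_range hx
      exact h2.of_finite_image Subtype.val_injective.injOn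
    refine Set.Finite.of_finite_image (f := e.symm) (h1.subset ?_) ?_
    · rintro _ ⟨q, hq, rfl⟩
      exact hq.2
    · exact e.symm.injOn.mono fun q hq => hq.1
  have hd : Dense Bᶜ := hfin.countable.dense_compl ℝ
  have hs' : {q | (q, w.2) ∈ s} ∩ e.target ∈ 𝓝 w.1 := by
    refine Filter.inter_mem ?_ (e.open_target.mem_nhds hw.1)
    exact (Continuous.prodMk_left w.2).continuousAt.preimage_mem_nhds hs
  obtain ⟨q, hq, hqB⟩ := mem_closure_iff_nhds.1 (hd w.1) _ hs'
  refine ⟨(q, w.2), hq.1, ⟨hq.2, trivial⟩, ?_⟩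
  by_contra hcon
  exact hqB ⟨hq.2, hcon⟩

theorem exists_overlap_chart {w : E2 × E2} (hw : w ∈ canonicalDomain e)
    (hr : e.symm w.1 ∈ Set.range polarMap) : ∃ e' ∈ IsManifold.maximalAtlas (𝓡 2) ∞ S2,
      (∀ z ∈ e'.target, e'.symm z = polarMap z) ∧ w ∈ canonicalOverlap e e' := by
  obtain ⟨z, hz⟩ := hr
  obtain ⟨e', he', hz', hep⟩ := exists_chart_polarMap z
  refine ⟨e', he', hep, mem_canonicalOverlap.2 ⟨hw.1, ?_⟩⟩
  rw [← hz, ← hep z hz']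
  exact e'.map_target hz'

theorem continuousOn_poissonBracket {f h : E2 × E2 → ℝ} {s : Set (E2 × E2)} (hs : IsOpen s)
    (hf : ContDiffOn ℝ ∞ f s) (hh : ContDiffOn ℝ ∞ h s) : ContinuousOn (poissonBracket f h) s := by
  have key : ∀ {g : E2 × E2 → ℝ}, ContDiffOn ℝ ∞ g s → ∀ v, ContinuousOn (fun z => fderiv ℝ g z v) s :=
    fun hg v => (hg.continuousOn_fderiv_of_isOpen hs (by simp)).clm_apply continuousOn_const
  exact continuousOn_finsetSum _ fun i _ => ((key hf _).mul (key hh _)).sub ((key hf _).mul (key hh _))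

/-- In any chart the bracket of smooth functions is continuous. If it were nonzero at a point it
would be nonzero at a nearby point over the polar domain, where invariance of the bracket identifies
it with the polar one. -/
theorem isConserved_of_inPolar {F H : CotangentBundle 2 S2 → ℝ} (hF : IsSmoothOnCotangent F)
    (hH : IsSmoothOnCotangent H) (h : ∀ w, poissonBracket (inPolar F) (inPolar H) w = 0) :
    IsConserved F H := by
  intro e he w hw
  by_contra hne
  have hc := (continuousOn_poissonBracket isOpen_canonicalDomain (hF e he) (hH e he)).continuousAt
    (isOpen_canonicalDomain.mem_nhds hw)
  obtain ⟨w', hw's, hw', hr⟩ := exists_near_polar e hw (hc.eventually_ne hne)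
  obtain ⟨e', he', hep, hov⟩ := exists_overlap_chart hw' hr
  apply hw's
  rw [poissonBracket_inCanonicalCoordinates hF hH he he' hov]
  have hmem : canonicalTransition e e' w' ∈ canonicalDomain e' :=
    ⟨(mem_canonicalOverlap.1 (canonicalTransition_mem hov)).1, trivial⟩
  rw [← h (canonicalTransition e e' w')]
  simp only [poissonBracket, (inCanonicalCoordinates_eq_inPolar F he' hep hmem).fderiv_eq,
    (inCanonicalCoordinates_eq_inPolar H he' hep hmem).fderiv_eq]

theorem isGenericallyIndependent_of_inPolar {F H : CotangentBundle 2 S2 → ℝ}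
    (hF : IsSmoothOnCotangent F) (hH : IsSmoothOnCotangent H)
    (h : ∀ w, ∀ s ∈ 𝓝 w, ∃ w' ∈ s, LinearIndependent ℝ
      ![fderiv ℝ (inPolar F) w', fderiv ℝ (inPolar H) w']) :
    IsGenericallyIndependent F H := by
  intro e he w hw
  rw [mem_closure_iff_nhds]
  intro s hs
  obtain ⟨t, hts, hto, hwt⟩ := mem_nhds_iff.1 hs
  obtain ⟨w', hw's, hw', hr⟩ := exists_near_polar e hw (hto.mem_nhds hwt)
  obtain ⟨e', he', hep, hov⟩ := exists_overlap_chart hw' hr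
  have hov' := canonicalTransition_mem hov
  have hcont : ContinuousAt (canonicalTransition e' e) (canonicalTransition e e' w') :=
    ((contDiffOn_canonicalTransition he' he).contDiffAt
      (isOpen_canonicalOverlap.mem_nhds hov')).continuousAt
  have hpre : canonicalTransition e' e ⁻¹' t ∩ canonicalOverlap e' e ∈
      𝓝 (canonicalTransition e e' w') := by
    refine Filter.inter_mem (hcont.preimage_mem_nhds ?_) (isOpen_canonicalOverlap.mem_nhds hov')
    rw [canonicalTransition_canonicalTransition he he' hov]
    exact hto.mem_nhds hw's
  obtain ⟨v, ⟨hvt, hvo⟩, hv⟩ := h _ _ hpre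
  have hvd : v ∈ canonicalDomain e' := ⟨(mem_canonicalOverlap.1 hvo).1, trivial⟩
  refine ⟨canonicalTransition e' e v, hts hvt,
    ⟨(mem_canonicalOverlap.1 (canonicalTransition_mem hvo)).1, trivial⟩, ?_⟩
  refine linearIndependent_fderiv_transition hF hH he' he hvo ?_
  rw [(inCanonicalCoordinates_eq_inPolar F he' hep hvd).fderiv_eq,
    (inCanonicalCoordinates_eq_inPolar H he' hep hvd).fderiv_eq]
  exact hv

theorem IsGenericallyIndependent.isIndependent {F H : CotangentBundle 2 S2 → ℝ}
    (h : IsGenericallyIndependent F H) : IsIndependent F H := by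
  obtain ⟨e, he, hz, -⟩ := exists_chart_polarMap 0
  have hw : ((0, 0) : E2 × E2) ∈ canonicalDomain e := ⟨hz, trivial⟩
  exact ⟨e, he, closure_nonempty_iff.1 ⟨_, h e he hw⟩⟩

/-- The affine relation extends over the poles by continuity, so dF = b dH everywhere. This is how
integrals of low degree are excluded. -/
theorem not_isIndependent_of_inPolar {F H : CotangentBundle 2 S2 → ℝ}
    (hF : IsSmoothOnCotangent F) (hH : IsSmoothOnCotangent H) {b c : ℝ}
    (h : ∀ w, inPolar F w = b * inPolar H w + c) : ¬ IsIndependent F H := by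
  rintro ⟨e, he, w, hw, hli⟩
  have heq : ∀ v ∈ canonicalDomain e, inCanonicalCoordinates F e v =
      b * inCanonicalCoordinates H e v + c := by
    intro v hv
    by_contra hne
    have hc : ContinuousAt (fun v => inCanonicalCoordinates F e v -
        (b * inCanonicalCoordinates H e v + c)) v :=
      (((hF e he).continuousOn.sub ((continuousOn_const.mul (hH e he).continuousOn).add
        continuousOn_const)).continuousAt (isOpen_canonicalDomain.mem_nhds hv))
    obtain ⟨v', hv's, hv', hr⟩ := exists_near_polar e hv (hc.eventually_ne (sub_ne_zero.2 hne))
    obtain ⟨u, hu⟩ := exists_polarPoint_eq (ξ := cotangentPoint e v') hr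
    apply hv's
    have := h u
    simp only [inPolar, hu] at this
    simp only [inCanonicalCoordinates, this, sub_self]
  have hev : inCanonicalCoordinates F e =ᶠ[𝓝 w] fun v => b * inCanonicalCoordinates H e v + c := by
    filter_upwards [isOpen_canonicalDomain.mem_nhds hw] with v hv using heq v hv
  have hd : DifferentiableAt ℝ (inCanonicalCoordinates H e) w :=
    ((hH e he).contDiffAt (isOpen_canonicalDomain.mem_nhds hw)).differentiableAt (by simp)
  have hfd : fderiv ℝ (inCanonicalCoordinates F e) w =
      b • fderiv ℝ (inCanonicalCoordinates H e) w := by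
    rw [hev.fderiv_eq, fderiv_add_const, fderiv_const_mul hd]
  rw [LinearIndependent.pair_iff] at hli
  have := (hli 1 (-b) (by rw [hfd]; simp)).1
  exact one_ne_zero this

end PolarCoordinates

/-! ### Angular momenta as smooth functions on T*S². -/

section Rotations

/-- The metric induced on the sphere by `f` times the Euclidean metric. -/
def conformalMetric (f : S2 → ℝ) (hf : ContMDiff (𝓡 2) 𝓘(ℝ, ℝ) ∞ f) (hpos : ∀ x, 0 < f x) :
    Bundle.ContMDiffRiemannianMetric (𝓡 2) ∞ (EuclideanSpace ℝ (Fin 2))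
      (fun x : S2 => TangentSpace (𝓡 2) x) :=
  sphereMetric (fun x => f x • (innerSL ℝ : E3 →L[ℝ] E3 →L[ℝ] ℝ))
    (fun x v w => by
      simp only [smul_apply, smul_eq_mul]
      exact congrArg (f x * ·) (real_inner_comm w v))
    (fun x v hv => by
      simp only [smul_apply, smul_eq_mul, innerSL_apply_apply]
      exact mul_pos (hpos x) (real_inner_self_pos.2 hv))
    (hf.smul contMDiff_const)

theorem conformalMetric_inner (f : S2 → ℝ) (hf : ContMDiff (𝓡 2) 𝓘(ℝ, ℝ) ∞ f)
    (hpos : ∀ x, 0 < f x) (x : S2) (v w : TangentSpace (𝓡 2) x) :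
    (conformalMetric f hf hpos).inner x v w =
      f x * inner ℝ (inclusionDeriv x v) (inclusionDeriv x w) := rfl

/-- The sphere with the round metric and no potential. -/
def roundSystem : ConservativeSystem 2 S2 where
  metric := conformalMetric (fun _ => 1) contMDiff_const fun _ => one_pos
  potential _ := 0
  potential_smooth := contMDiff_const

theorem roundSystem_inner (x : S2) (v w : TangentSpace (𝓡 2) x) :
    roundSystem.metric.inner x v w = inner ℝ (inclusionDeriv x v) (inclusionDeriv x w) :=
  one_mul _

/-- Only the image `Y` of the field in ℝ³ is known to be smooth. The components of the field in a
chart are recovered from the smooth covector v ↦ ⟨Y, dι v⟩ by raising its index with the round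
metric, which is the sole purpose of `roundSystem`. -/
theorem isSmoothOnCotangent_momentum {X : ∀ x : S2, TangentSpace (𝓡 2) x} {Y : S2 → E3}
    (hY : ContMDiff (𝓡 2) 𝓘(ℝ, E3) ∞ Y) (hX : ∀ x, inclusionDeriv x (X x) = Y x) :
    IsSmoothOnCotangent (fun ξ : CotangentBundle 2 S2 => ξ.2 (X ξ.1)) := by
  intro e he
  set c : E2 → E2 := fun q => mfderiv (𝓡 2) (𝓡 2) e (e.symm q) (X (e.symm q)) with hc
  set J : E2 → E2 →L[ℝ] E3 := fderiv ℝ (fun q => (e.symm q : E3)) with hJ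
  have hιc : ContDiffOn ℝ ∞ (fun q => (e.symm q : E3)) e.target :=
    ((contMDiff_coe_sphere (n := 2) (m := ∞)).comp_contMDiffOn
      (contMDiffOn_symm_of_mem_maximalAtlas he)).contDiffOn
  have hJc : ContDiffOn ℝ ∞ J e.target := hιc.fderiv_of_isOpen e.open_target (by simp)
  have hJv : ∀ q ∈ e.target, ∀ v : E2,
      inclusionDeriv (e.symm q) (mfderiv (𝓡 2) (𝓡 2) e.symm q v) = J q v := fun q hq v =>
    (inclusionDeriv_comp_mfderiv ((mdifferentiable_of_mem_maximalAtlas he).mdifferentiableAt_symm hq)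
      v).trans (DFunLike.congr_fun mfderiv_eq_fderiv v)
  have hYc : ContDiffOn ℝ ∞ (fun q => Y (e.symm q)) e.target :=
    (hY.comp_contMDiffOn (contMDiffOn_symm_of_mem_maximalAtlas he)).contDiffOn
  set α : E2 → E2 →L[ℝ] ℝ := fun q => (innerSL ℝ (Y (e.symm q)) : E3 →L[ℝ] ℝ).comp (J q) with hα
  have hαc : ContDiffOn ℝ ∞ α e.target :=
    ((innerSL ℝ : E3 →L[ℝ] E3 →L[ℝ] ℝ).contDiff.comp_contDiffOn hYc).clm_comp hJc
  have hcq : ∀ q ∈ e.target, (roundSystem.coordMetric e q).inverse (α q) = c q := by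
    intro q hq
    obtain ⟨G, hG⟩ := roundSystem.exists_coordMetric_equiv he hq
    have h1 : G (c q) = α q := by
      refine ContinuousLinearMap.ext fun v => ?_
      have h2 : G (c q) v = roundSystem.coordMetric e q (c q) v :=
        DFunLike.congr_fun (DFunLike.congr_fun hG (c q)) v
      have h3 : inclusionDeriv (e.symm q) (mfderiv (𝓡 2) (𝓡 2) e.symm q (c q)) = Y (e.symm q) :=
        (congrArg (inclusionDeriv (e.symm q)) (mfderiv_symm_mfderiv he hq _)).trans (hX _)
      rw [h2, ConservativeSystem.coordMetric_apply]
      refine (roundSystem_inner _ _ _).trans ?_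
      exact congrArg₂ (inner ℝ) h3 (hJv q hq v)
    rw [← hG, ContinuousLinearMap.inverse_equiv, ← h1]
    exact G.symm_apply_apply _
  have hcc : ContDiffOn ℝ ∞ c e.target := by
    refine ContDiffOn.congr ?_ fun q hq => (hcq q hq).symm
    intro q hq
    refine ContDiffWithinAt.clm_apply ?_ (hαc q hq)
    obtain ⟨G, hG⟩ := roundSystem.exists_coordMetric_equiv he hq
    have h3 : ContDiffAt ℝ ∞ (ContinuousLinearMap.inverse : (E2 →L[ℝ] E2 →L[ℝ] ℝ) → _)
        (roundSystem.coordMetric e q) := by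
      rw [← hG]
      exact contDiffAt_map_inverse G
    exact h3.comp_contDiffWithinAt q (roundSystem.contDiffOn_coordMetric he q hq)
  have h4 : ContDiffOn ℝ ∞ (fun z : E2 × E2 => inner ℝ z.2 (c z.1)) (canonicalDomain e) :=
    contDiffOn_snd.inner ℝ (hcc.comp contDiffOn_fst fun z hz => hz.1)
  exact h4

/-- The velocity at `x` of the rotation about the axis `c`. -/
def rotationVelocity (c x : E3) : E3 :=
  !₂[c 1 * x 2 - c 2 * x 1, c 2 * x 0 - c 0 * x 2, c 0 * x 1 - c 1 * x 0]

theorem exists_rotationField (c : E3) (x : S2) :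
    ∃ v : TangentSpace (𝓡 2) x, inclusionDeriv x v = rotationVelocity c x := by
  have h1 := range_mvfderiv_subtypeVal (n := 2) x
  have h2 : rotationVelocity c x ∈ (Submodule.span ℝ {(x : E3)})ᗮ := by
    rw [Submodule.mem_orthogonal_singleton_iff_inner_right]
    simp only [PiLp.inner_apply, Fin.sum_univ_three, rotationVelocity]
    simp
    ring
  rw [← h1] at h2
  exact h2

/-- The vector field on the sphere generating the rotations about the axis `c`. -/
def rotationField (c : E3) (x : S2) : TangentSpace (𝓡 2) x :=
  Classical.choose (exists_rotationField c x)

theorem inclusionDeriv_rotationField (c : E3) (x : S2) :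
    inclusionDeriv x (rotationField c x) = rotationVelocity c x :=
  Classical.choose_spec (exists_rotationField c x)

/-- The angular momentum about the axis `c`. -/
def angularMomentum (c : E3) (ξ : CotangentBundle 2 S2) : ℝ := ξ.2 (rotationField c ξ.1)

theorem isSmoothOnCotangent_angularMomentum (c : E3) :
    IsSmoothOnCotangent (angularMomentum c) := by
  refine isSmoothOnCotangent_momentum (Y := fun x => rotationVelocity c x) ?_
    (inclusionDeriv_rotationField c)
  have h1 : ContDiff ℝ ∞ (rotationVelocity c) := by
    have h0 : ∀ i : Fin 3, ContDiff ℝ ∞ (fun z : E3 => z i) := fun i =>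
      (EuclideanSpace.proj i : E3 →L[ℝ] ℝ).contDiff
    rw [contDiff_euclidean]
    intro i
    fin_cases i
    · exact (contDiff_const.mul (h0 2)).sub (contDiff_const.mul (h0 1))
    · exact (contDiff_const.mul (h0 0)).sub (contDiff_const.mul (h0 2))
    · exact (contDiff_const.mul (h0 1)).sub (contDiff_const.mul (h0 0))
  exact h1.contMDiff.comp contMDiff_coe_sphere

theorem rotationField_polarMap {c : E3} {z v : E2}
    (h : rotationVelocity c (polarMap z) = v 0 • polarTangentφ z + v 1 • polarTangentY z) :
    rotationField c (polarMap z) = polarDeriv z v := by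
  apply inclusionDeriv_injective
  rw [inclusionDeriv_rotationField, inclusionDeriv_polarDeriv, h]

theorem rotationField_axis (z : E2) :
    rotationField !₂[0, 0, 1] (polarMap z) = polarDeriv z !₂[1, 0] := by
  apply rotationField_polarMap
  ext i
  fin_cases i <;> simp [rotationVelocity, polarMap_coe, polarTangentφ, polarTangentY, neg_div]

theorem inPolar_angularMomentum_axis (w : E2 × E2) :
    inPolar (angularMomentum !₂[0, 0, 1]) w = w.2 0 := by
  have h := polarPoint_polarDeriv w !₂[1, 0]
  rw [← rotationField_axis] at h
  refine h.trans ?_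
  simp [PiLp.inner_apply, Fin.sum_univ_two]

theorem inPolar_angularMomentum_first (w : E2 × E2) :
    inPolar (angularMomentum !₂[1, 0, 0]) w =
      Real.cosh (w.1 1) * Real.sin (w.1 0) * w.2 1 -
        Real.sinh (w.1 1) * Real.cos (w.1 0) * w.2 0 := by
  have h := polarPoint_polarDeriv w
    !₂[-(Real.sinh (w.1 1) * Real.cos (w.1 0)), Real.cosh (w.1 1) * Real.sin (w.1 0)]
  rw [← rotationField_polarMap (c := !₂[1, 0, 0])] at h
  · refine h.trans ?_
    simp [PiLp.inner_apply, Fin.sum_univ_two]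
    ring
  · have hne : Real.cosh (w.1 1) ≠ 0 := (Real.cosh_pos _).ne'
    have h1 := Real.sin_sq_add_cos_sq (w.1 0)
    ext i
    fin_cases i
    · simp [rotationVelocity, polarMap_coe, polarTangentφ, polarTangentY]
      field_simp
      ring
    · simp [rotationVelocity, polarMap_coe, polarTangentφ, polarTangentY]
      field_simp
      linear_combination Real.sinh (w.1 1) * h1
    · simp [rotationVelocity, polarMap_coe, polarTangentφ, polarTangentY]
      field_simp

end Rotations

/-! ### Brackets from partial derivatives, and rotationally symmetric metrics. -/

section PolarSystems

theorem hasDerivAt_vec_fst (s t : ℝ) :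
    HasDerivAt (fun x : ℝ => (!₂[x, t] : E2)) (EuclideanSpace.single 0 1) s := by
  have h1 : (fun x : ℝ => (!₂[x, t] : E2)) =
      fun x => (!₂[0, t] : E2) + x • EuclideanSpace.single 0 1 := by
    funext x
    ext i
    fin_cases i <;> simp
  rw [h1]
  simpa using ((hasDerivAt_id' s).smul_const (EuclideanSpace.single 0 1 : E2)).const_add
    (!₂[0, t] : E2)

theorem hasDerivAt_vec_snd (s t : ℝ) :
    HasDerivAt (fun x : ℝ => (!₂[t, x] : E2)) (EuclideanSpace.single 1 1) s := by
  have h1 : (fun x : ℝ => (!₂[t, x] : E2)) =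
      fun x => (!₂[t, 0] : E2) + x • EuclideanSpace.single 1 1 := by
    funext x
    ext i
    fin_cases i <;> simp
  rw [h1]
  simpa using ((hasDerivAt_id' s).smul_const (EuclideanSpace.single 1 1 : E2)).const_add
    (!₂[t, 0] : E2)

section Slices

variable {g : E2 × E2 → ℝ} {φ y P Q d : ℝ}

theorem fderiv_position_zero (hg : DifferentiableAt ℝ g (!₂[φ, y], !₂[P, Q]))
    (hd : HasDerivAt (fun t => g (!₂[t, y], !₂[P, Q])) d φ) :
    fderiv ℝ g (!₂[φ, y], !₂[P, Q]) (EuclideanSpace.single 0 1, 0) = d :=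
  (HasFDerivAt.comp_hasDerivAt (f := fun t => ((!₂[t, y], !₂[P, Q]) : E2 × E2)) φ hg.hasFDerivAt
    ((hasDerivAt_vec_fst φ y).prodMk (hasDerivAt_const _ _))).unique hd

theorem fderiv_position_one (hg : DifferentiableAt ℝ g (!₂[φ, y], !₂[P, Q]))
    (hd : HasDerivAt (fun t => g (!₂[φ, t], !₂[P, Q])) d y) :
    fderiv ℝ g (!₂[φ, y], !₂[P, Q]) (EuclideanSpace.single 1 1, 0) = d :=
  (HasFDerivAt.comp_hasDerivAt (f := fun t => ((!₂[φ, t], !₂[P, Q]) : E2 × E2)) y hg.hasFDerivAt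
    ((hasDerivAt_vec_snd y φ).prodMk (hasDerivAt_const _ _))).unique hd

theorem fderiv_momentum_zero (hg : DifferentiableAt ℝ g (!₂[φ, y], !₂[P, Q]))
    (hd : HasDerivAt (fun t => g (!₂[φ, y], !₂[t, Q])) d P) :
    fderiv ℝ g (!₂[φ, y], !₂[P, Q]) (0, EuclideanSpace.single 0 1) = d :=
  (HasFDerivAt.comp_hasDerivAt (f := fun t => ((!₂[φ, y], !₂[t, Q]) : E2 × E2)) P hg.hasFDerivAt
    ((hasDerivAt_const _ _).prodMk (hasDerivAt_vec_fst P Q))).unique hd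

theorem fderiv_momentum_one (hg : DifferentiableAt ℝ g (!₂[φ, y], !₂[P, Q]))
    (hd : HasDerivAt (fun t => g (!₂[φ, y], !₂[P, t])) d Q) :
    fderiv ℝ g (!₂[φ, y], !₂[P, Q]) (0, EuclideanSpace.single 1 1) = d :=
  (HasFDerivAt.comp_hasDerivAt (f := fun t => ((!₂[φ, y], !₂[P, t]) : E2 × E2)) Q hg.hasFDerivAt
    ((hasDerivAt_const _ _).prodMk (hasDerivAt_vec_snd Q P))).unique hd

end Slices

theorem poissonBracket_eq_of_hasDerivAt {f h : E2 × E2 → ℝ} {φ y P Q f₁ f₂ f₃ f₄ h₁ h₂ h₃ h₄ : ℝ}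
    (hf : DifferentiableAt ℝ f (!₂[φ, y], !₂[P, Q]))
    (hh : DifferentiableAt ℝ h (!₂[φ, y], !₂[P, Q]))
    (hf₁ : HasDerivAt (fun t => f (!₂[t, y], !₂[P, Q])) f₁ φ)
    (hf₂ : HasDerivAt (fun t => f (!₂[φ, t], !₂[P, Q])) f₂ y)
    (hf₃ : HasDerivAt (fun t => f (!₂[φ, y], !₂[t, Q])) f₃ P)
    (hf₄ : HasDerivAt (fun t => f (!₂[φ, y], !₂[P, t])) f₄ Q)
    (hh₁ : HasDerivAt (fun t => h (!₂[t, y], !₂[P, Q])) h₁ φ)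
    (hh₂ : HasDerivAt (fun t => h (!₂[φ, t], !₂[P, Q])) h₂ y)
    (hh₃ : HasDerivAt (fun t => h (!₂[φ, y], !₂[t, Q])) h₃ P)
    (hh₄ : HasDerivAt (fun t => h (!₂[φ, y], !₂[P, t])) h₄ Q) :
    poissonBracket f h (!₂[φ, y], !₂[P, Q]) = f₁ * h₃ - f₃ * h₁ + (f₂ * h₄ - f₄ * h₂) := by
  rw [poissonBracket, Fin.sum_univ_two, fderiv_position_zero hf hf₁, fderiv_position_zero hh hh₁,
    fderiv_position_one hf hf₂, fderiv_position_one hh hh₂, fderiv_momentum_zero hf hf₃,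
    fderiv_momentum_zero hh hh₃, fderiv_momentum_one hf hf₄, fderiv_momentum_one hh hh₄]

/-- In the coordinates `(φ, y)` the metric of `S` is `A(y) dφ² + B(y) dy²`. -/
def HasPolarMetric (S : ConservativeSystem 2 S2) (A B : ℝ → ℝ) : Prop :=
  (∀ y, 0 < A y) ∧ (∀ y, 0 < B y) ∧ ∀ z v w : E2,
    S.metric.inner (polarMap z) (polarDeriv z v) (polarDeriv z w) =
      A (z 1) * (v 0 * w 0) + B (z 1) * (v 1 * w 1)

theorem HasPolarMetric.inPolar_kinetic {S : ConservativeSystem 2 S2} {A B : ℝ → ℝ}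
    (h : HasPolarMetric S A B) (w : E2 × E2) :
    inPolar S.kinetic w = 1 / 2 * (w.2 0 ^ 2 / A (w.1 1) + w.2 1 ^ 2 / B (w.1 1)) := by
  obtain ⟨hA, hB, hm⟩ := h
  have hA' := (hA (w.1 1)).ne'
  have hB' := (hB (w.1 1)).ne'
  have h1 : S.kinetic (polarPoint w) = 1 / 2 * (polarPoint w).2
      (polarDeriv w.1 !₂[w.2 0 / A (w.1 1), w.2 1 / B (w.1 1)]) := by
    refine S.kinetic_eq (x := polarMap w.1) (w := polarDeriv w.1 _) fun v => ?_
    obtain ⟨u, rfl⟩ : ∃ u, polarDeriv w.1 u = v :=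
      ⟨(polarEquiv w.1).symm v, by
        rw [← polarEquiv_apply]; exact (polarEquiv w.1).apply_symm_apply v⟩
    rw [hm]
    refine Eq.trans ?_ (polarPoint_polarDeriv w u).symm
    simp [PiLp.inner_apply, Fin.sum_univ_two]
    field_simp
  rw [inPolar, h1, polarPoint_polarDeriv]
  simp [PiLp.inner_apply, Fin.sum_univ_two]
  field_simp

theorem eq_vec_two (v : E2) : v = !₂[v 0, v 1] := by
  ext i
  fin_cases i <;> rfl

/-- The angle φ is cyclic: the bracket reduces to -2P ∂K/∂φ = 0. The square of P is used because the
later classification deals with even quadratic functions of the momenta. -/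
theorem HasPolarMetric.isConserved_angularMomentum_sq {S : ConservativeSystem 2 S2} {A B : ℝ → ℝ}
    (h : HasPolarMetric S A B) : IsConserved
      (fun ξ => angularMomentum !₂[0, 0, 1] ξ * angularMomentum !₂[0, 0, 1] ξ) S.kinetic := by
  have hs := isSmoothOnCotangent_angularMomentum !₂[0, 0, 1]
  refine isConserved_of_inPolar (hs.mul hs) S.isSmoothOnCotangent_kinetic fun w => ?_
  have hf : inPolar (fun ξ => angularMomentum !₂[0, 0, 1] ξ * angularMomentum !₂[0, 0, 1] ξ) =
      fun w => w.2 0 * w.2 0 := by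
    funext w
    rw [← inPolar_angularMomentum_axis w]
    rfl
  have hd := (hs.mul hs).contDiff_inPolar.differentiable (by simp)
  have hk := S.isSmoothOnCotangent_kinetic.contDiff_inPolar.differentiable (by simp)
  have hline : ∀ {g : E2 × E2 → ℝ}, Differentiable ℝ g → ∀ {c : ℝ → E2 × E2} {t : ℝ},
      DifferentiableAt ℝ c t → HasDerivAt (fun t => g (c t)) (deriv (fun t => g (c t)) t) t :=
    fun hg c t hc => (DifferentiableAt.comp t (hg _) hc).hasDerivAt
  obtain ⟨z, p⟩ := w
  rw [eq_vec_two z, eq_vec_two p]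
  have c1 : ∀ a b : ℝ, DifferentiableAt ℝ (fun t : ℝ => (!₂[t, b] : E2)) a := fun a b => by
    rw [differentiableAt_piLp]; intro i; fin_cases i <;> simp
  have c2 : ∀ a b : ℝ, DifferentiableAt ℝ (fun t : ℝ => (!₂[b, t] : E2)) a := fun a b => by
    rw [differentiableAt_piLp]; intro i; fin_cases i <;> simp
  rw [poissonBracket_eq_of_hasDerivAt (hd _) (hk _) (f₁ := 0) (f₂ := 0) (f₃ := 1 * p 0 + p 0 * 1)
    (f₄ := 0) (h₁ := 0) (by simpa [hf] using hasDerivAt_const _ _)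
    (by simpa [hf] using hasDerivAt_const _ _)
    (by simpa [hf] using (hasDerivAt_id' (p 0)).fun_mul (hasDerivAt_id' (p 0)))
    (by simpa [hf] using hasDerivAt_const _ _)
    (by simpa [h.inPolar_kinetic] using hasDerivAt_const _ _)
    (hline hk ((c2 _ _).prodMk (differentiableAt_const _)))
    (hline hk ((differentiableAt_const _).prodMk (c1 _ _)))
    (hline hk ((differentiableAt_const _).prodMk (c2 _ _)))]
  simp

end PolarSystems

/-! ### The change of variable y(u), its inverse U(y), and the speed w = A^(1/4). -/

section ConformalCoordinate

variable {a : ℝ}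

theorem quarticA_pos (ha : -2 < a) (u : ℝ) : 0 < quarticA a u := by
  have h : quarticA a u = (1 - u ^ 2) ^ 2 + (a + 2) * u ^ 2 := by rw [quarticA]; ring
  rw [h]
  rcases eq_or_ne u 0 with rfl | hu
  · norm_num
  · have : 0 < (a + 2) * u ^ 2 := mul_pos (by linarith) (by positivity)
    nlinarith [sq_nonneg (1 - u ^ 2)]

theorem contDiff_quarticA : ContDiff ℝ ∞ (quarticA a) := by
  unfold quarticA
  fun_prop

theorem rpow_quarticA (ha : -2 < a) (u : ℝ) :
    quarticA a u ^ (-(1 / 4) : ℝ) = (√√(quarticA a u))⁻¹ := by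
  have h := (quarticA_pos ha u).le
  rw [Real.rpow_neg h, Real.sqrt_eq_rpow, Real.sqrt_eq_rpow, ← Real.rpow_mul h]
  norm_num

theorem sqrt_quarticA_pos (ha : -2 < a) (u : ℝ) : 0 < √√(quarticA a u) :=
  Real.sqrt_pos.2 (Real.sqrt_pos.2 (quarticA_pos ha u))

theorem hasDerivAt_conformalCoord (ha : -2 < a) (u : ℝ) :
    HasDerivAt (conformalCoord a) (√√(quarticA a u))⁻¹ u := by
  have hc : Continuous fun t => quarticA a t ^ (-(1 / 4) : ℝ) :=
    contDiff_quarticA.continuous.rpow_const fun t => Or.inl (quarticA_pos ha t).ne'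
  rw [← rpow_quarticA ha]
  exact intervalIntegral.integral_hasDerivAt_right (hc.intervalIntegrable _ _)
    (hc.stronglyMeasurableAtFilter _ _) hc.continuousAt

theorem contDiff_conformalCoord (ha : -2 < a) : ContDiff ℝ ∞ (conformalCoord a) := by
  have h1 : deriv (conformalCoord a) = fun u => (√√(quarticA a u))⁻¹ :=
    funext fun u => (hasDerivAt_conformalCoord ha u).deriv
  rw [contDiff_infty_iff_deriv, h1]
  refine ⟨fun u => (hasDerivAt_conformalCoord ha u).differentiableAt, ?_⟩
  refine ContDiff.inv ?_ fun u => (sqrt_quarticA_pos ha u).ne'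
  exact (contDiff_quarticA.sqrt fun u => (quarticA_pos ha u).ne').sqrt
    fun u => (Real.sqrt_pos.2 (quarticA_pos ha u)).ne'

theorem strictMono_conformalCoord (ha : -2 < a) : StrictMono (conformalCoord a) :=
  strictMono_of_deriv_pos fun u => by
    rw [(hasDerivAt_conformalCoord ha u).deriv]
    exact inv_pos.2 (sqrt_quarticA_pos ha u)

theorem conformalCoord_neg (u : ℝ) : conformalCoord a (-u) = -conformalCoord a u := by
  have h := intervalIntegral.integral_comp_neg (a := 0) (b := u)
    fun t => quarticA a t ^ (-(1 / 4) : ℝ)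
  have h2 : (fun t => quarticA a (-t) ^ (-(1 / 4) : ℝ)) = fun t => quarticA a t ^ (-(1 / 4) : ℝ) := by
    funext t
    rw [quarticA, quarticA]
    ring_nf
  rw [h2, neg_zero] at h
  rw [conformalCoord, conformalCoord, h, ← intervalIntegral.integral_symm]

theorem conformalCoord_zero : conformalCoord a 0 = 0 := by
  rw [conformalCoord, intervalIntegral.integral_same]

/-- Since A ≤ (|a| + 2)(1 + u²)², the derivative A^(-1/4) is at least k/√(1 + u²), the derivative of
k arsinh u. Hence y(u) is unbounded, which gives surjectivity onto the line. -/
theorem arsinh_le_conformalCoord (ha : -2 < a) :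
    ∃ k > 0, ∀ u, 0 ≤ u → k * Real.arsinh u ≤ conformalCoord a u := by
  set k : ℝ := (√√(|a| + 2))⁻¹ with hk
  have hk0 : 0 < k := by positivity
  refine ⟨k, hk0, fun u hu => ?_⟩
  have hd : ∀ t, HasDerivAt (fun t => conformalCoord a t - k * Real.arsinh t)
      ((√√(quarticA a t))⁻¹ - k * (√(1 + t ^ 2))⁻¹) t := fun t =>
    (hasDerivAt_conformalCoord ha t).sub ((Real.hasDerivAt_arsinh t).const_mul k)
  have hm : Monotone fun t => conformalCoord a t - k * Real.arsinh t := by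
    refine monotone_of_deriv_nonneg (fun t => (hd t).differentiableAt) fun t => ?_
    rw [(hd t).deriv, hk, ← mul_inv, ← Real.sqrt_mul (by positivity), sub_nonneg]
    refine inv_anti₀ (sqrt_quarticA_pos ha t) (Real.sqrt_le_sqrt ?_)
    have h1 : (1 + t ^ 2) = √((1 + t ^ 2) ^ 2) := (Real.sqrt_sq (by positivity)).symm
    rw [h1, ← Real.sqrt_mul (by positivity)]
    refine Real.sqrt_le_sqrt ?_
    rw [quarticA]
    nlinarith [le_abs_self a, abs_nonneg a, sq_nonneg t, sq_nonneg (t ^ 2),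
      mul_nonneg (sub_nonneg.2 (le_abs_self a)) (sq_nonneg t), mul_nonneg (abs_nonneg a) (sq_nonneg t),
      mul_nonneg (abs_nonneg a) (sq_nonneg (t ^ 2))]
  have h2 := hm hu
  simp only [conformalCoord_zero, Real.arsinh_zero, mul_zero, sub_zero] at h2
  linarith

theorem surjective_conformalCoord (ha : -2 < a) : Function.Surjective (conformalCoord a) := by
  obtain ⟨k, hk, h⟩ := arsinh_le_conformalCoord ha
  have hkey : ∀ y, 0 ≤ y → y ≤ conformalCoord a (Real.sinh (y / k)) := fun y hy => by
    have h1 := h (Real.sinh (y / k)) (Real.sinh_nonneg_iff.2 (by positivity))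
    rwa [Real.arsinh_sinh, mul_div_cancel₀ _ hk.ne'] at h1
  intro y
  have hc : Continuous (conformalCoord a) := (contDiff_conformalCoord ha).continuous
  refine mem_range_of_exists_le_of_exists_ge hc ⟨-Real.sinh (|y| / k), ?_⟩ ⟨Real.sinh (|y| / k), ?_⟩
  · rw [conformalCoord_neg]
    linarith [hkey |y| (abs_nonneg y), neg_abs_le y]
  · linarith [hkey |y| (abs_nonneg y), le_abs_self y]

/-- The inverse of `conformalCoord a`. -/
def invCoord (a : ℝ) : ℝ → ℝ := Function.invFun (conformalCoord a)

/-- The derivative `A^(1/4)` of `invCoord a`. -/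
def coordSpeed (a y : ℝ) : ℝ := √√(quarticA a (invCoord a y))

theorem conformalCoord_invCoord (ha : -2 < a) (y : ℝ) : conformalCoord a (invCoord a y) = y :=
  Function.rightInverse_invFun (surjective_conformalCoord ha) y

theorem invCoord_conformalCoord (ha : -2 < a) (u : ℝ) : invCoord a (conformalCoord a u) = u :=
  Function.leftInverse_invFun (strictMono_conformalCoord ha).injective u

theorem coordSpeed_pos (ha : -2 < a) (y : ℝ) : 0 < coordSpeed a y := sqrt_quarticA_pos ha _

theorem coordSpeed_sq (y : ℝ) : coordSpeed a y ^ 2 = √(quarticA a (invCoord a y)) :=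
  Real.sq_sqrt (Real.sqrt_nonneg _)

theorem coordSpeed_pow_four (ha : -2 < a) (y : ℝ) :
    coordSpeed a y ^ 4 = 1 + a * invCoord a y ^ 2 + invCoord a y ^ 4 := by
  have h : coordSpeed a y ^ 4 = (coordSpeed a y ^ 2) ^ 2 := by ring
  rw [h, coordSpeed_sq, Real.sq_sqrt (quarticA_pos ha _).le, quarticA]

/-- `conformalCoord a` as a homeomorphism of the line. -/
def conformalHomeomorph (ha : -2 < a) : ℝ ≃ₜ ℝ :=
  ((strictMono_conformalCoord ha).orderIsoOfSurjective _ (surjective_conformalCoord ha)).toHomeomorph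

theorem conformalHomeomorph_symm (ha : -2 < a) :
    ((conformalHomeomorph ha).symm : ℝ → ℝ) = invCoord a := by
  funext y
  apply (strictMono_conformalCoord ha).injective
  rw [conformalCoord_invCoord ha]
  exact (conformalHomeomorph ha).apply_symm_apply y

theorem contDiff_invCoord (ha : -2 < a) : ContDiff ℝ ∞ (invCoord a) := by
  rw [← conformalHomeomorph_symm ha]
  exact (conformalHomeomorph ha).contDiff_symm_deriv
    (fun u => inv_ne_zero (sqrt_quarticA_pos ha u).ne') (hasDerivAt_conformalCoord ha)
    (contDiff_conformalCoord ha)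

theorem hasDerivAt_invCoord (ha : -2 < a) (y : ℝ) :
    HasDerivAt (invCoord a) (coordSpeed a y) y := by
  have h := HasDerivAt.of_local_left_inverse (contDiff_invCoord ha).continuous.continuousAt
    (hasDerivAt_conformalCoord ha (invCoord a y)) (inv_ne_zero (sqrt_quarticA_pos ha _).ne')
    (Filter.Eventually.of_forall (conformalCoord_invCoord ha))
  rwa [inv_inv] at h

theorem contDiff_coordSpeed (ha : -2 < a) : ContDiff ℝ ∞ (coordSpeed a) :=
  ((contDiff_quarticA.comp (contDiff_invCoord ha)).sqrt fun _ => (quarticA_pos ha _).ne').sqrt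
    fun _ => (Real.sqrt_pos.2 (quarticA_pos ha _)).ne'

/-- Differentiate w⁴ = 1 + aU² + U⁴ along U' = w and cancel 4w³. -/
theorem hasDerivAt_coordSpeed (ha : -2 < a) (y : ℝ) : HasDerivAt (coordSpeed a)
    ((a * invCoord a y + 2 * invCoord a y ^ 3) / (2 * coordSpeed a y ^ 2)) y := by
  have h1 := ((contDiff_coordSpeed ha).differentiable (by simp) y).hasDerivAt
  have h2 := h1.fun_pow 4
  have hU := hasDerivAt_invCoord ha y
  have h3 := (((hU.fun_pow 2).const_mul a).const_add 1).add (hU.fun_pow 4)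
  have h4 := h2.unique (h3.congr_of_eventuallyEq
    (Filter.Eventually.of_forall fun y => coordSpeed_pow_four ha y))
  have hw := (coordSpeed_pos ha y).ne'
  have h5 : deriv (coordSpeed a) y =
      (a * invCoord a y + 2 * invCoord a y ^ 3) / (2 * coordSpeed a y ^ 2) := by
    norm_num at h4
    field_simp
    have h6 : coordSpeed a y * (4 * (coordSpeed a y ^ 2 * deriv (coordSpeed a) y)) =
        coordSpeed a y * (2 * (a * invCoord a y + 2 * invCoord a y ^ 3)) := by
      linear_combination h4
    linarith [mul_left_cancel₀ hw h6]
  rwa [h5] at h1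

theorem invCoord_neg (ha : -2 < a) (y : ℝ) : invCoord a (-y) = -invCoord a y := by
  apply (strictMono_conformalCoord ha).injective
  rw [conformalCoord_neg, conformalCoord_invCoord ha, conformalCoord_invCoord ha]

theorem invCoord_zero (ha : -2 < a) : invCoord a 0 = 0 := by
  have h := invCoord_conformalCoord ha 0
  rwa [conformalCoord_zero] at h

theorem invCoord_eq_zero (ha : -2 < a) {y : ℝ} : invCoord a y = 0 ↔ y = 0 := by
  constructor
  · intro h
    rw [← conformalCoord_invCoord ha y, h, conformalCoord_zero]
  · rintro rfl
    exact invCoord_zero ha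

theorem coordSpeed_neg (ha : -2 < a) (y : ℝ) : coordSpeed a (-y) = coordSpeed a y := by
  have h : quarticA a (-invCoord a y) = quarticA a (invCoord a y) := by
    rw [quarticA, quarticA]; ring
  rw [coordSpeed, coordSpeed, invCoord_neg ha, h]

theorem coordSpeed_zero (ha : -2 < a) : coordSpeed a 0 = 1 := by
  rw [coordSpeed, invCoord_zero ha, quarticA]
  norm_num

end ConformalCoordinate

/-! ### (φ, u) as cylindrical coordinates on the complement of the poles. -/

section CylinderMap

variable {a : ℝ}

/-- The change of coordinates from `(φ, u)` to `(φ, y)`. -/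
def cylinderChange (a : ℝ) (z : ℝ × ℝ) : E2 := !₂[z.1, conformalCoord a z.2]

theorem cylinderMap_eq (z : ℝ × ℝ) : cylinderMap a z = polarMap (cylinderChange a z) := rfl

theorem contDiff_cylinderChange (ha : -2 < a) : ContDiff ℝ ∞ (cylinderChange a) := by
  rw [contDiff_euclidean]
  intro i
  fin_cases i
  · exact contDiff_fst
  · exact (contDiff_conformalCoord ha).comp contDiff_snd

theorem hasFDerivAt_cylinderChange (ha : -2 < a) (z X : ℝ × ℝ) :
    fderiv ℝ (cylinderChange a) z X = !₂[X.1, (√√(quarticA a z.2))⁻¹ * X.2] := by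
  have h := ((contDiff_cylinderChange ha).differentiable (by simp) z).hasFDerivAt
  have hi : ∀ i, HasFDerivAt (fun z => cylinderChange a z i) _ z := fun i =>
    (EuclideanSpace.proj i : E2 →L[ℝ] ℝ).hasFDerivAt.comp z h
  ext i
  fin_cases i
  · have h1 := (hi 0).unique (hasFDerivAt_fst (p := z))
    exact DFunLike.congr_fun h1 X
  · have h1 := (hi 1).unique (HasDerivAt.comp_hasFDerivAt (f := Prod.snd) z
      (hasDerivAt_conformalCoord ha z.2) hasFDerivAt_snd)
    exact DFunLike.congr_fun h1 X

theorem mfderiv_cylinderMap (ha : -2 < a) (z X : ℝ × ℝ) :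
    mfderiv 𝓘(ℝ, ℝ × ℝ) (𝓡 2) (cylinderMap a) z X =
      polarDeriv (cylinderChange a z) !₂[X.1, (√√(quarticA a z.2))⁻¹ * X.2] := by
  have h1 : MDifferentiableAt (𝓡 2) (𝓡 2) polarMap (cylinderChange a z) :=
    contMDiff_polarMap.mdifferentiable (by simp) _
  have h2 : MDifferentiableAt 𝓘(ℝ, ℝ × ℝ) (𝓡 2) (cylinderChange a) z :=
    (contDiff_cylinderChange ha).contMDiff.mdifferentiable (by simp) _
  have h3 := DFunLike.congr_fun (mfderiv_comp z h1 h2) X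
  refine h3.trans ?_
  have h4 : mfderiv 𝓘(ℝ, ℝ × ℝ) (𝓡 2) (cylinderChange a) z X = _ :=
    (DFunLike.congr_fun mfderiv_eq_fderiv X).trans (hasFDerivAt_cylinderChange ha z X)
  exact congrArg (polarDeriv (cylinderChange a z)) h4

theorem exists_cylinderChange_eq (ha : -2 < a) (z : E2) : ∃ z', cylinderChange a z' = z := by
  refine ⟨(z 0, invCoord a (z 1)), ?_⟩
  rw [cylinderChange, conformalCoord_invCoord ha]
  exact (eq_vec_two z).symm

/-- The poles of the sphere. -/
def northPole : S2 := ⟨!₂[0, 0, 1], by simp [EuclideanSpace.norm_eq, Fin.sum_univ_three]⟩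

/-- The poles of the sphere. -/
def southPole : S2 := ⟨!₂[0, 0, -1], by simp [EuclideanSpace.norm_eq, Fin.sum_univ_three]⟩

theorem range_polarMap : Set.range polarMap = {northPole, southPole}ᶜ := by
  ext x
  constructor
  · intro hx h
    rw [mem_range_polarMap] at hx
    rcases h with h | h
    · rw [h, northPole] at hx
      simp at hx
    · rw [Set.mem_singleton_iff.1 h, southPole] at hx
      simp at hx
  · intro hx
    by_contra h
    rcases pole_of_notMem_range h with h | h
    · exact hx (Or.inl (Subtype.ext h))
    · exact hx (Or.inr (Subtype.ext h))

theorem injective_mfderiv_cylinderMap (ha : -2 < a) (z : ℝ × ℝ) :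
    Function.Injective (mfderiv 𝓘(ℝ, ℝ × ℝ) (𝓡 2) (cylinderMap a) z) := by
  intro X Y h
  have h2 := injective_polarDeriv (cylinderChange a z)
    ((mfderiv_cylinderMap ha z X).symm.trans (h.trans (mfderiv_cylinderMap ha z Y)))
  have h3 : X.1 = Y.1 := congrArg (fun v : E2 => v 0) h2
  have h4 : (√√(quarticA a z.2))⁻¹ * X.2 = (√√(quarticA a z.2))⁻¹ * Y.2 :=
    congrArg (fun v : E2 => v 1) h2
  exact Prod.ext h3 (mul_left_cancel₀ (inv_ne_zero (sqrt_quarticA_pos ha z.2).ne') h4)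

theorem contMDiff_cylinderMap (ha : -2 < a) :
    ContMDiff 𝓘(ℝ, ℝ × ℝ) (𝓡 2) ∞ (cylinderMap a) :=
  ContMDiff.comp (g := polarMap) (f := cylinderChange a) contMDiff_polarMap
    (contDiff_cylinderChange ha).contMDiff

theorem cylinderMap_eq_iff (ha : -2 < a) (z z' : ℝ × ℝ) : cylinderMap a z = cylinderMap a z' ↔
    (∃ k : ℤ, z.1 = z'.1 + k * (2 * Real.pi)) ∧ z.2 = z'.2 := by
  rw [cylinderMap_eq, cylinderMap_eq, polarMap_eq_iff]
  exact and_congr Iff.rfl (strictMono_conformalCoord ha).injective.eq_iff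

theorem northPole_ne_southPole : northPole ≠ southPole := by
  intro h
  have h1 := congrArg (fun x : S2 => (x : E3) 2) h
  simp [northPole, southPole] at h1
  norm_num at h1

theorem range_cylinderMap (ha : -2 < a) :
    Set.range (cylinderMap a) = {northPole, southPole}ᶜ := by
  have h : Function.Surjective (cylinderChange a) := exists_cylinderChange_eq ha
  rw [← range_polarMap]
  exact h.range_comp polarMap

theorem isCylindricalCoordinates_cylinderMap (ha : -2 < a) :
    IsCylindricalCoordinates (cylinderMap a) :=
  ⟨contMDiff_cylinderMap ha, injective_mfderiv_cylinderMap ha, cylinderMap_eq_iff ha,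
    northPole, southPole, northPole_ne_southPole, range_cylinderMap ha⟩

end CylinderMap

/-! ### The systems H_p rewritten in the coordinates (φ, y). -/

section HpSystems

/-- The conformal factor of `H_p` in the coordinates `(φ, y)`. -/
def hpFactor (a p y : ℝ) : ℝ :=
  (coordSpeed a y ^ 2 - invCoord a y ^ 2 + p) / coordSpeed a y ^ 2

/-- The potential of `H_p` in the coordinates `(φ, y)` is `hpPotential a p y * cos φ`. -/
def hpPotential (a p y : ℝ) : ℝ :=
  -(invCoord a y * (a + 2 * invCoord a y ^ 2 - 2 * coordSpeed a y ^ 2) /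
    (2 * (coordSpeed a y ^ 2 - invCoord a y ^ 2 + p)))

/-- `S` has conformal factor `ε * hpFactor a p` and potential `ε * hpPotential a p * cos φ`. -/
structure IsPolarHp (a p ε : ℝ) (S : ConservativeSystem 2 S2) : Prop where
  gt : -2 < a
  sign : ε * ε = 1
  metric : HasPolarMetric S (fun y => ε * hpFactor a p y) (fun y => ε * hpFactor a p y)
  potential : ∀ z : E2, S.potential (polarMap z) = ε * hpPotential a p (z 1) * Real.cos (z 0)

variable {a p ε : ℝ} {S : ConservativeSystem 2 S2}

theorem IsSystemHp.isPolarHp (ha : -2 < a) (h : IsSystemHp a p S) : ∃ ε, IsPolarHp a p ε S := by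
  obtain ⟨ε, hε, h⟩ := h
  have hmet : ∀ z v w : E2, S.metric.inner (polarMap z) (polarDeriv z v) (polarDeriv z w) =
      ε * hpFactor a p (z 1) * (v 0 * w 0) + ε * hpFactor a p (z 1) * (v 1 * w 1) := by
    intro z v w
    obtain ⟨z, rfl⟩ := exists_cylinderChange_eq ha z
    have hs := (sqrt_quarticA_pos ha z.2).ne'
    have hX : ∀ v : E2, polarDeriv (cylinderChange a z) v =
        mfderiv 𝓘(ℝ, ℝ × ℝ) (𝓡 2) (cylinderMap a) z (v 0, √√(quarticA a z.2) * v 1) := by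
      intro v
      refine Eq.trans ?_ (mfderiv_cylinderMap ha z _).symm
      congr 1
      rw [inv_mul_cancel_left₀ hs]
      exact eq_vec_two v
    have h1 := (h z).1 (v 0, √√(quarticA a z.2) * v 1) (w 0, √√(quarticA a z.2) * w 1)
    rw [hX v, hX w]
    refine h1.trans ?_
    have h2 : √(quarticA a z.2) = √√(quarticA a z.2) ^ 2 := (Real.sq_sqrt (Real.sqrt_nonneg _)).symm
    have h3 : invCoord a (cylinderChange a z 1) = z.2 := invCoord_conformalCoord ha z.2
    have h4 : coordSpeed a (cylinderChange a z 1) = √√(quarticA a z.2) := by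
      rw [coordSpeed, h3]
    rw [formHp, hpFactor, h3, h4]
    simp only
    set s := √√(quarticA a z.2)
    rw [h2]
    field_simp
  -- The sign is not taken from the parameters: it follows from definiteness of the metric of `S`,
  -- tested on ∂/∂φ.
  have hpos : ∀ y, 0 < ε * hpFactor a p y := by
    intro y
    have hne : polarDeriv !₂[0, y] !₂[1, 0] ≠ 0 := by
      intro h0
      have h1 := injective_polarDeriv _ (h0.trans (map_zero (polarDeriv !₂[0, y])).symm)
      have h2 := congrArg (fun v : E2 => v 0) h1
      simp at h2
    have h1 := S.metric.pos (polarMap !₂[0, y]) _ hne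
    have h2 : 0 < ε * hpFactor a p y * (1 * 1) + ε * hpFactor a p y * (0 * 0) :=
      lt_of_lt_of_eq h1 (hmet _ _ _)
    simpa using h2
  refine ⟨ε, ha, by rcases hε with rfl | rfl <;> norm_num, ⟨hpos, hpos, hmet⟩, fun z => ?_⟩
  obtain ⟨z, rfl⟩ := exists_cylinderChange_eq ha z
  refine (h z).2.trans ?_
  have h3 : invCoord a (cylinderChange a z 1) = z.2 := invCoord_conformalCoord ha z.2
  have h4 : coordSpeed a (cylinderChange a z 1) ^ 2 = √(quarticA a z.2) := by
    rw [coordSpeed_sq, h3]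
  have h5 : cylinderChange a z 0 = z.1 := rfl
  rw [potentialHp, hpPotential, h3, h4, h5, mul_assoc]

theorem isSystemHp_of_polar (ha : -2 < a) (hε : ε = 1 ∨ ε = -1)
    (hm : ∀ z v w : E2, S.metric.inner (polarMap z) (polarDeriv z v) (polarDeriv z w) =
      ε * hpFactor a p (z 1) * (v 0 * w 0 + v 1 * w 1))
    (hV : ∀ z : E2, S.potential (polarMap z) = ε * hpPotential a p (z 1) * Real.cos (z 0)) :
    IsSystemHp a p S := by
  refine ⟨ε, hε, fun z => ?_⟩
  have h3 : invCoord a (cylinderChange a z 1) = z.2 := invCoord_conformalCoord ha z.2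
  have h4 : coordSpeed a (cylinderChange a z 1) = √√(quarticA a z.2) := by
    rw [coordSpeed, h3]
  have h2 : √(quarticA a z.2) = √√(quarticA a z.2) ^ 2 := (Real.sq_sqrt (Real.sqrt_nonneg _)).symm
  have hs := (sqrt_quarticA_pos ha z.2).ne'
  constructor
  · intro X Y
    have h6 : S.metric.inner (cylinderMap a z)
        (mfderiv 𝓘(ℝ, ℝ × ℝ) (𝓡 2) (cylinderMap a) z X)
        (mfderiv 𝓘(ℝ, ℝ × ℝ) (𝓡 2) (cylinderMap a) z Y) =
        S.metric.inner (polarMap (cylinderChange a z))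
          (polarDeriv (cylinderChange a z) !₂[X.1, (√√(quarticA a z.2))⁻¹ * X.2])
          (polarDeriv (cylinderChange a z) !₂[Y.1, (√√(quarticA a z.2))⁻¹ * Y.2]) :=
      congrArg₂ (fun v w => S.metric.inner (cylinderMap a z) v w)
        (mfderiv_cylinderMap ha z X) (mfderiv_cylinderMap ha z Y)
    refine h6.trans ((hm _ _ _).trans ?_)
    rw [formHp, hpFactor, h3, h4]
    simp only [PiLp.toLp_apply, Matrix.cons_val_zero, Matrix.cons_val_one]
    set s := √√(quarticA a z.2)
    rw [h2]
    field_simp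
  · refine (hV (cylinderChange a z)).trans ?_
    have h5 : cylinderChange a z 0 = z.1 := rfl
    rw [potentialHp, hpPotential, h3, h4, h5, ← h2, mul_assoc]

end HpSystems

/-! ### The parameter s = u/√(1 + u²) and smoothness at the poles. -/

section Compactification

variable {a : ℝ}

/-- The quartic `A` in the coordinate `s = u / √(1 + u²)`, times `(1 - s²)²`. -/
def compactA (a s : ℝ) : ℝ := 1 + (a - 2) * (s ^ 2 * (1 - s ^ 2))

/-- The fourth root of `compactA`. -/
def compactRoot (a s : ℝ) : ℝ := √√(compactA a s)

/-- The derivative of `y - artanh s` with respect to `s`. -/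
def shiftDeriv (a s : ℝ) : ℝ := -(a - 2) * s ^ 2 /
  (compactRoot a s * (1 + compactRoot a s) * (1 + compactRoot a s ^ 2))

/-- The difference `y - artanh s`. -/
def coordShift (a s : ℝ) : ℝ := ∫ τ in (0 : ℝ)..s, shiftDeriv a τ

/-- `√(1 - s²) cosh y`. -/
def compactCosh (a s : ℝ) : ℝ := Real.cosh (coordShift a s) + s * Real.sinh (coordShift a s)

/-- `√(1 - s²) sinh y`. -/
def compactSinh (a s : ℝ) : ℝ := s * Real.cosh (coordShift a s) + Real.sinh (coordShift a s)

/-- The length of an interval around `0` on which `compactA` is positive. -/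
def compactRadius (a : ℝ) : ℝ := √(1 + 1 / (2 * (|a - 2| + 1)))

theorem compactA_pos_of_sq_le (ha : -2 < a) {s : ℝ} (hs : s ^ 2 ≤ 1) : 0 < compactA a s := by
  have h1 : 0 ≤ s ^ 2 * (1 - s ^ 2) := mul_nonneg (sq_nonneg s) (by linarith)
  have h2 : s ^ 2 * (1 - s ^ 2) ≤ 1 / 4 := by nlinarith [sq_nonneg (s ^ 2 - 1 / 2)]
  rw [compactA]
  rcases h1.eq_or_lt with h | h
  · rw [← h]; norm_num
  · nlinarith

theorem mem_Ioo_compactRadius {s : ℝ} (h : s ^ 2 ≤ 1) :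
    s ∈ Set.Ioo (-compactRadius a) (compactRadius a) := by
  rw [Set.mem_Ioo, ← abs_lt, compactRadius]
  refine Real.lt_sqrt_of_sq_lt ?_
  rw [sq_abs]
  have : 0 < 1 / (2 * (|a - 2| + 1)) := by positivity
  linarith

theorem compactA_pos (ha : -2 < a) {s : ℝ}
    (hs : s ∈ Set.Ioo (-compactRadius a) (compactRadius a)) : 0 < compactA a s := by
  rcases le_or_gt (s ^ 2) 1 with h | h
  · exact compactA_pos_of_sq_le ha h
  -- The radius is chosen so that K(s² - 1) ≤ 1/2 and s² ≤ 3/2. The product is then at most 3/4, too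
  -- small to cancel the constant term 1 of `compactA`.
  · set K := |a - 2| + 1 with hK
    have hK1 : 1 ≤ K := by simp [hK]
    have h1 : s ^ 2 < 1 + 1 / (2 * K) := by
      have := abs_lt.2 hs
      have h2 := (Real.lt_sqrt (abs_nonneg s)).1 this
      rwa [sq_abs] at h2
    have h3 : (a - 2) ≤ K := by linarith [le_abs_self (a - 2)]
    have h4 : 1 / (2 * K) ≤ 1 / 2 := by
      apply one_div_le_one_div_of_le <;> linarith
    have h5 : K * (1 / (2 * K)) = 1 / 2 := by field_simp
    have h6 : K * (s ^ 2 - 1) ≤ 1 / 2 := by nlinarith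
    have h7 : s ^ 2 * (K * (s ^ 2 - 1)) < 1 := by nlinarith
    rw [compactA]
    have h8 : 0 ≤ s ^ 2 * (s ^ 2 - 1) := mul_nonneg (sq_nonneg s) (by linarith)
    nlinarith [mul_le_mul_of_nonneg_right h3 h8]

theorem contDiffAt_compactA {s : ℝ} : ContDiffAt ℝ ∞ (compactA a) s := by
  unfold compactA
  fun_prop

theorem compactRoot_pos {s : ℝ} (h : 0 < compactA a s) : 0 < compactRoot a s :=
  Real.sqrt_pos.2 (Real.sqrt_pos.2 h)

theorem compactRoot_pow_four {s : ℝ} (h : 0 < compactA a s) :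
    compactRoot a s ^ 4 = compactA a s := by
  have h1 : compactRoot a s ^ 4 = (compactRoot a s ^ 2) ^ 2 := by ring
  rw [h1, compactRoot, Real.sq_sqrt (Real.sqrt_nonneg _), Real.sq_sqrt h.le]

theorem contDiffAt_compactRoot {s : ℝ} (h : 0 < compactA a s) :
    ContDiffAt ℝ ∞ (compactRoot a) s :=
  (contDiffAt_compactA.sqrt h.ne').sqrt (Real.sqrt_pos.2 h).ne'

theorem contDiffAt_shiftDeriv {s : ℝ} (h : 0 < compactA a s) :
    ContDiffAt ℝ ∞ (shiftDeriv a) s := by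
  have hn := contDiffAt_compactRoot h
  have hp := compactRoot_pos h
  refine ContDiffAt.div (contDiffAt_const.mul (contDiffAt_id.pow 2))
    ((hn.mul (contDiffAt_const.add hn)).mul (contDiffAt_const.add (hn.pow 2))) ?_
  positivity

/-- With n = `compactRoot`, dy/ds = 1/(n(1 - s²)), while artanh s has derivative 1/(1 - s²). Their
difference (1 - n)/(n(1 - s²)) is regular at s = ±1, because (1 - n)(1 + n)(1 + n²) = 1 - n⁴
contains the factor 1 - s². This is why y - artanh s extends smoothly past the poles. -/
theorem one_add_shiftDeriv {s : ℝ} (h : 0 < compactA a s) :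
    1 + shiftDeriv a s * (1 - s ^ 2) = (compactRoot a s)⁻¹ := by
  have h1 := compactRoot_pow_four h
  have hp := compactRoot_pos h
  rw [shiftDeriv]
  rw [compactA] at h1
  field_simp
  linear_combination h1

theorem hasDerivAt_coordShift (ha : -2 < a) {s : ℝ}
    (hs : s ∈ Set.Ioo (-compactRadius a) (compactRadius a)) :
    HasDerivAt (coordShift a) (shiftDeriv a s) s := by
  have hc : ContinuousOn (shiftDeriv a) (Set.Ioo (-compactRadius a) (compactRadius a)) :=
    fun t ht => (contDiffAt_shiftDeriv (compactA_pos ha ht)).continuousAt.continuousWithinAt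
  have h0 : (0 : ℝ) ∈ Set.Ioo (-compactRadius a) (compactRadius a) :=
    mem_Ioo_compactRadius (by norm_num)
  refine intervalIntegral.integral_hasDerivAt_right ?_ ?_ ?_
  · exact (hc.mono (Set.OrdConnected.uIcc_subset Set.ordConnected_Ioo h0 hs)).intervalIntegrable
  · exact hc.stronglyMeasurableAtFilter isOpen_Ioo s hs
  · exact hc.continuousAt (isOpen_Ioo.mem_nhds hs)

theorem contDiffAt_coordShift (ha : -2 < a) {s : ℝ}
    (hs : s ∈ Set.Ioo (-compactRadius a) (compactRadius a)) :
    ContDiffAt ℝ ∞ (coordShift a) s := by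
  have h : ContDiffOn ℝ ∞ (coordShift a) (Set.Ioo (-compactRadius a) (compactRadius a)) := by
    rw [contDiffOn_infty_iff_deriv_of_isOpen isOpen_Ioo]
    refine ⟨fun t ht => (hasDerivAt_coordShift ha ht).differentiableAt.differentiableWithinAt, ?_⟩
    refine ContDiffOn.congr (f := shiftDeriv a) ?_ fun t ht => (hasDerivAt_coordShift ha ht).deriv
    exact fun t ht => (contDiffAt_shiftDeriv (compactA_pos ha ht)).contDiffWithinAt
  exact h.contDiffAt (isOpen_Ioo.mem_nhds hs)

theorem contDiffAt_compactCosh (ha : -2 < a) {s : ℝ}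
    (hs : s ∈ Set.Ioo (-compactRadius a) (compactRadius a)) :
    ContDiffAt ℝ ∞ (compactCosh a) s := by
  have h := contDiffAt_coordShift ha hs
  exact h.cosh.add (contDiffAt_id.mul h.sinh)

theorem contDiffAt_compactSinh (ha : -2 < a) {s : ℝ}
    (hs : s ∈ Set.Ioo (-compactRadius a) (compactRadius a)) :
    ContDiffAt ℝ ∞ (compactSinh a) s := by
  have h := contDiffAt_coordShift ha hs
  exact (contDiffAt_id.mul h.cosh).add h.sinh

theorem compactCosh_pos {s : ℝ} (hs : s ^ 2 ≤ 1) : 0 < compactCosh a s := by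
  rw [compactCosh]
  have h1 := Real.cosh_sq (coordShift a s)
  have h2 := Real.cosh_pos (coordShift a s)
  have h3 : |s * Real.sinh (coordShift a s)| < Real.cosh (coordShift a s) := by
    refine abs_lt_of_sq_lt_sq ?_ h2.le
    rw [mul_pow]
    nlinarith [mul_le_mul_of_nonneg_right hs (sq_nonneg (Real.sinh (coordShift a s)))]
  linarith [neg_abs_le (s * Real.sinh (coordShift a s))]

/-- The height `tanh y` as a function of `s`. -/
def compactHeight (a s : ℝ) : ℝ := compactSinh a s / compactCosh a s

/-- The derivative does not vanish at s = ±1, so s and the height tanh y are equivalent smooth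
parameters up to and including the poles. -/
theorem hasDerivAt_compactHeight (ha : -2 < a) {s : ℝ}
    (hs : s ∈ Set.Ioo (-compactRadius a) (compactRadius a)) (hD : 0 < compactCosh a s) :
    HasDerivAt (compactHeight a) ((compactRoot a s)⁻¹ / compactCosh a s ^ 2) s := by
  have hJ := hasDerivAt_coordShift ha hs
  have h1 : HasDerivAt (compactSinh a) _ s := ((hasDerivAt_id' s).fun_mul hJ.cosh).add hJ.sinh
  have h2 : HasDerivAt (compactCosh a) _ s := hJ.cosh.add ((hasDerivAt_id' s).fun_mul hJ.sinh)
  have h3 := h1.div h2 hD.ne'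
  have h4 := one_add_shiftDeriv (compactA_pos ha hs)
  have h5 := Real.cosh_sq (coordShift a s)
  refine h3.congr_deriv ?_
  rw [← h4]
  congr 1
  rw [compactCosh, compactSinh]
  linear_combination (1 + shiftDeriv a s * (1 - s ^ 2)) * h5

theorem contDiffAt_compactHeight (ha : -2 < a) {s : ℝ}
    (hs : s ∈ Set.Ioo (-compactRadius a) (compactRadius a)) (hD : 0 < compactCosh a s) :
    ContDiffAt ℝ ∞ (compactHeight a) s :=
  (contDiffAt_compactSinh ha hs).div (contDiffAt_compactCosh ha hs) hD.ne'

/-- An interval strictly larger than [-1, 1] is needed for the inverse function to be smooth in the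
two-sided sense at the endpoints. It exists because positivity of `compactCosh` is open and [-1, 1]
is compact. -/
theorem exists_strictMonoOn_compactHeight (ha : -2 < a) : ∃ r > 1,
    (∀ s ∈ Set.Ioo (-r) r, s ∈ Set.Ioo (-compactRadius a) (compactRadius a) ∧
      0 < compactCosh a s) ∧ StrictMonoOn (compactHeight a) (Set.Ioo (-r) r) := by
  set I := Set.Ioo (-compactRadius a) (compactRadius a) with hI
  set W : Set ℝ := {s | s ∈ I ∧ 0 < compactCosh a s} with hW
  have hWo : IsOpen W := by
    have hc : ContinuousOn (compactCosh a) I :=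
      fun s hs => (contDiffAt_compactCosh ha hs).continuousAt.continuousWithinAt
    exact hc.isOpen_inter_preimage isOpen_Ioo isOpen_Ioi
  have hsub : Set.Icc (-1 : ℝ) 1 ⊆ W := fun s hs => by
    have h : s ^ 2 ≤ 1 := by rw [sq_le_one_iff_abs_le_one]; exact abs_le.2 hs
    exact ⟨mem_Ioo_compactRadius h, compactCosh_pos h⟩
  obtain ⟨δ, hδ, hsub'⟩ := isCompact_Icc.exists_thickening_subset_open hWo hsub
  have hr : Set.Ioo (-(1 + δ)) (1 + δ) ⊆ W := by
    intro s hs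
    apply hsub'
    rw [Metric.mem_thickening_iff]
    rcases le_total s 1 with h1 | h1
    · rcases le_total (-1) s with h2 | h2
      · exact ⟨s, ⟨h2, h1⟩, by simpa using hδ⟩
      · refine ⟨-1, by norm_num, ?_⟩
        rw [Real.dist_eq, abs_lt]
        constructor <;> linarith [hs.1, hs.2]
    · refine ⟨1, by norm_num, ?_⟩
      rw [Real.dist_eq, abs_lt]
      constructor <;> linarith [hs.1, hs.2]
  refine ⟨1 + δ, by linarith, fun s hs => hr hs, ?_⟩
  refine strictMonoOn_of_deriv_pos (convex_Ioo _ _) (fun s hs =>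
    (hasDerivAt_compactHeight ha (hr hs).1 (hr hs).2).continuousAt.continuousWithinAt) ?_
  intro s hs
  rw [interior_Ioo] at hs
  rw [(hasDerivAt_compactHeight ha (hr hs).1 (hr hs).2).deriv]
  have := compactRoot_pos (compactA_pos ha (hr hs).1)
  have := (hr hs).2
  positivity

/-- `compactHeight` maps [-1, 1] onto itself, fixing the endpoints, and is injective with nonzero
derivative on a larger interval. The inverse function theorem then gives smoothness of the inverse
at every height, the two poles included. -/
theorem exists_inverse_compactHeight (ha : -2 < a) : ∃ σ : ℝ → ℝ,
    (∀ t, t ^ 2 ≤ 1 → ContDiffAt ℝ ∞ σ t ∧ (σ t) ^ 2 ≤ 1) ∧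
      ∀ s, s ^ 2 ≤ 1 → σ (compactHeight a s) = s := by
  obtain ⟨r, hr, hW, hmono⟩ := exists_strictMonoOn_compactHeight ha
  have hIcc : ∀ {s : ℝ}, s ^ 2 ≤ 1 ↔ s ∈ Set.Icc (-1 : ℝ) 1 := fun {s} => by
    rw [sq_le_one_iff_abs_le_one]; exact abs_le
  have hsub : Set.Icc (-1 : ℝ) 1 ⊆ Set.Ioo (-r) r :=
    fun s hs => ⟨by linarith [hs.1], by linarith [hs.2]⟩
  set σ := Function.invFunOn (compactHeight a) (Set.Ioo (-r) r) with hσ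
  have hleft : ∀ s ∈ Set.Ioo (-r) r, σ (compactHeight a s) = s :=
    fun s hs => hmono.injOn.leftInvOn_invFunOn hs
  have hsurj : Set.Icc (-1 : ℝ) 1 ⊆ compactHeight a '' Set.Icc (-1) 1 := by
    have hc : ContinuousOn (compactHeight a) (Set.Icc (-1) 1) := fun s hs =>
      (contDiffAt_compactHeight ha (hW s (hsub hs)).1
        (hW s (hsub hs)).2).continuousAt.continuousWithinAt
    have h1 : compactHeight a (-1) = -1 := by
      have := (compactCosh_pos (a := a) (s := -1) (by norm_num)).ne'
      rw [compactHeight, div_eq_iff this, compactSinh, compactCosh]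
      ring
    have h2 : compactHeight a 1 = 1 := by
      have := (compactCosh_pos (a := a) (s := 1) (by norm_num)).ne'
      rw [compactHeight, div_eq_iff this, compactSinh, compactCosh]
      ring
    have h3 := intermediate_value_Icc (by norm_num : (-1 : ℝ) ≤ 1) hc
    rwa [h1, h2] at h3
  refine ⟨σ, fun t ht => ?_, fun s hs => hleft s (hsub (hIcc.1 hs))⟩
  obtain ⟨s, hs, rfl⟩ := hsurj (hIcc.1 ht)
  rw [hleft s (hsub hs)]
  refine ⟨?_, hIcc.2 hs⟩
  obtain ⟨hsI, hsD⟩ := hW s (hsub hs)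
  have hcd := contDiffAt_compactHeight ha hsI hsD
  have hd := hasDerivAt_compactHeight ha hsI hsD
  have hne : (compactRoot a s)⁻¹ / compactCosh a s ^ 2 ≠ 0 := by
    have := compactRoot_pos (compactA_pos ha hsI)
    positivity
  set G : ℝ ≃L[ℝ] ℝ := ContinuousLinearEquiv.unitsEquivAut ℝ (Units.mk0 _ hne) with hG
  have hF : HasFDerivAt (compactHeight a) (G : ℝ →L[ℝ] ℝ) s := by
    have h : (G : ℝ →L[ℝ] ℝ) = ContinuousLinearMap.toSpanSingleton ℝ
        ((compactRoot a s)⁻¹ / compactCosh a s ^ 2) := by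
      ext
      simp [hG]
    rw [h]
    exact hd.hasFDerivAt
  have hloc := hcd.to_localInverse hF (by simp)
  -- The globally chosen inverse `σ` agrees near the point with the smooth local inverse: the latter
  -- takes values in (-r, r), where `compactHeight` is injective.
  refine hloc.congr_of_eventuallyEq ?_
  set e := hcd.toOpenPartialHomeomorph (compactHeight a) hF (by simp) with he
  have hes : s ∈ e.source := hcd.mem_toOpenPartialHomeomorph_source hF (by simp)
  have het : compactHeight a s ∈ e.target := e.map_source hes
  have hcont : ContinuousAt e.symm (compactHeight a s) := e.continuousAt_symm het
  have hval : e.symm (compactHeight a s) = s := e.left_inv hes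
  have hnb : Set.Ioo (-r) r ∈ 𝓝 (e.symm (compactHeight a s)) := by
    rw [hval]; exact isOpen_Ioo.mem_nhds (hsub hs)
  filter_upwards [e.open_target.mem_nhds het, hcont hnb] with τ hτ hτ2
  have h1 : compactHeight a (e.symm τ) = τ := e.right_inv hτ
  calc σ τ = σ (compactHeight a (e.symm τ)) := by rw [h1]
    _ = e.symm τ := hleft _ hτ2

/-- The value of `s = u / √(1 + u²)` as a function of `y`. -/
def compactCoord (a y : ℝ) : ℝ := invCoord a y / √(1 + invCoord a y ^ 2)

theorem compactCoord_sq (y : ℝ) :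
    compactCoord a y ^ 2 = invCoord a y ^ 2 / (1 + invCoord a y ^ 2) := by
  rw [compactCoord, div_pow, Real.sq_sqrt (by positivity)]

theorem compactCoord_sq_lt_one (y : ℝ) : compactCoord a y ^ 2 < 1 := by
  rw [compactCoord_sq, div_lt_one (by positivity)]
  linarith

theorem compactRoot_compactCoord (ha : -2 < a) (y : ℝ) :
    compactRoot a (compactCoord a y) = coordSpeed a y / √(1 + invCoord a y ^ 2) := by
  have hr : 0 < √(1 + invCoord a y ^ 2) := Real.sqrt_pos.2 (by positivity)
  have h1 : compactA a (compactCoord a y) =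
      quarticA a (invCoord a y) / (1 + invCoord a y ^ 2) ^ 2 := by
    have hne : (1 + invCoord a y ^ 2) ≠ 0 := by positivity
    rw [compactA, compactCoord_sq, quarticA]
    field_simp
    ring
  rw [compactRoot, h1, coordSpeed, Real.sqrt_div (quarticA_pos ha _).le,
    Real.sqrt_sq (by positivity), Real.sqrt_div (Real.sqrt_nonneg _)]

/-- As arsinh u = artanh s, this identifies the integral `coordShift` with y - artanh s. The two
sides agree at y = 0 and have the same derivative. -/
theorem arsinh_invCoord_add_coordShift (ha : -2 < a) (y : ℝ) :
    Real.arsinh (invCoord a y) + coordShift a (compactCoord a y) = y := by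
  have hd : ∀ y, HasDerivAt (fun y => Real.arsinh (invCoord a y) +
      coordShift a (compactCoord a y) - y) 0 y := by
    intro y
    have hU := hasDerivAt_invCoord ha y
    set u := invCoord a y with hu
    set w := coordSpeed a y with hw
    have hw0 : 0 < w := coordSpeed_pos ha y
    have hr : 0 < √(1 + u ^ 2) := Real.sqrt_pos.2 (by positivity)
    have hr2 : √(1 + u ^ 2) ^ 2 = 1 + u ^ 2 := Real.sq_sqrt (by positivity)
    have h1 := hU.arsinh
    have h2 : HasDerivAt (fun y => √(1 + invCoord a y ^ 2)) _ y :=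
      ((hU.fun_pow 2).const_add 1).sqrt (by positivity)
    have h3 : HasDerivAt (compactCoord a) _ y := hU.div h2 hr.ne'
    have h4 := (hasDerivAt_coordShift ha
      (mem_Ioo_compactRadius (compactCoord_sq_lt_one y).le)).comp y h3
    have h5 := (h1.add h4).sub (hasDerivAt_id' y)
    refine h5.congr_deriv ?_
    have h6 := one_add_shiftDeriv (compactA_pos ha
      (mem_Ioo_compactRadius (compactCoord_sq_lt_one (a := a) y).le))
    rw [compactRoot_compactCoord ha, compactCoord_sq, ← hu, ← hw] at h6
    set g := shiftDeriv a (compactCoord a y)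
    have hne : (1 + u ^ 2) ≠ 0 := by positivity
    rw [inv_div] at h6
    rw [← hu]
    set r := √(1 + u ^ 2)
    simp only [smul_eq_mul]
    norm_num
    rw [← hr2] at h6
    have h7 : u ^ 2 = r ^ 2 - 1 := by linarith
    have h8 : w * (r ^ 2 + g) = r ^ 3 := by
      rw [h7] at h6
      field_simp at h6
      linear_combination h6
    field_simp
    linear_combination h8 - g * w * h7
  have h0 := is_const_of_deriv_eq_zero (fun y => (hd y).differentiableAt)
    (fun y => (hd y).deriv) y 0
  simp only [compactCoord, invCoord_zero ha, Real.arsinh_zero] at h0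
  simp [coordShift] at h0
  rw [compactCoord, coordShift]
  linarith

/-- Addition formula for y = arsinh U + `coordShift`. All the growth at the poles is in the factor
√(1 + U²); the other factor is smooth and positive for s in [-1, 1]. -/
theorem cosh_eq_compactCosh (ha : -2 < a) (y : ℝ) :
    Real.cosh y = √(1 + invCoord a y ^ 2) * compactCosh a (compactCoord a y) := by
  have hr : 0 < √(1 + invCoord a y ^ 2) := Real.sqrt_pos.2 (by positivity)
  have h := arsinh_invCoord_add_coordShift ha y
  conv_lhs => rw [← h, Real.cosh_add, Real.cosh_arsinh, Real.sinh_arsinh]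
  have h2 : √(1 + invCoord a y ^ 2) * compactCoord a y = invCoord a y :=
    mul_div_cancel₀ _ hr.ne'
  rw [compactCosh]
  linear_combination (-Real.sinh (coordShift a (compactCoord a y))) * h2

theorem sinh_eq_compactSinh (ha : -2 < a) (y : ℝ) :
    Real.sinh y = √(1 + invCoord a y ^ 2) * compactSinh a (compactCoord a y) := by
  have hr : 0 < √(1 + invCoord a y ^ 2) := Real.sqrt_pos.2 (by positivity)
  have h := arsinh_invCoord_add_coordShift ha y
  conv_lhs => rw [← h, Real.sinh_add, Real.cosh_arsinh, Real.sinh_arsinh]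
  have h2 : √(1 + invCoord a y ^ 2) * compactCoord a y = invCoord a y :=
    mul_div_cancel₀ _ hr.ne'
  rw [compactSinh]
  linear_combination (-Real.cosh (coordShift a (compactCoord a y))) * h2

theorem compactHeight_compactCoord (ha : -2 < a) (y : ℝ) :
    compactHeight a (compactCoord a y) = Real.tanh y := by
  have hr : √(1 + invCoord a y ^ 2) ≠ 0 := (Real.sqrt_pos.2 (by positivity)).ne'
  rw [Real.tanh_eq_sinh_div_cosh, cosh_eq_compactCosh ha, sinh_eq_compactSinh ha,
    mul_div_mul_left _ _ hr, compactHeight]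

/-- The function s is a smooth function of the height u₃ on [-1, 1], so it lives on the whole
sphere. Every coefficient that is smooth in s is thereby smooth at the poles. -/
theorem exists_sphereCoord (ha : -2 < a) : ∃ s : S2 → ℝ, ContMDiff (𝓡 2) 𝓘(ℝ, ℝ) ∞ s ∧
    (∀ x, s x ^ 2 ≤ 1) ∧ ∀ z, s (polarMap z) = compactCoord a (z 1) := by
  obtain ⟨σ, h1, h2⟩ := exists_inverse_compactHeight ha
  have hx : ∀ x : S2, ((x : E3) 2) ^ 2 ≤ 1 := fun x => by
    nlinarith [sphere_sq_sum x, sq_nonneg ((x : E3) 0), sq_nonneg ((x : E3) 1)]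
  refine ⟨fun x => σ ((x : E3) 2), fun x => ?_, fun x => (h1 _ (hx x)).2, fun z => ?_⟩
  · exact (h1 _ (hx x)).1.contMDiffAt.comp x (contMDiff_sphere_coord 2).contMDiffAt
  · simp only [polarMap_two]
    rw [← compactHeight_compactCoord ha, h2 _ (compactCoord_sq_lt_one _).le]

end Compactification

/-! ### The coefficients √A - u² and a + 2u² - 2√A up to the poles. -/

section CompactCoefficients

variable {a : ℝ}

/-- The function `√A - u²` of `s = u / √(1 + u²)`. -/
def compactGap (a s : ℝ) : ℝ := (1 - s ^ 2 + a * s ^ 2) / (compactRoot a s ^ 2 + s ^ 2)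

/-- The function `(a + 2 u² - 2 √A) (1 + u²)` of `s = u / √(1 + u²)`. -/
def compactSlope (a s : ℝ) : ℝ :=
  (a ^ 2 - 4) / (a * (1 - s ^ 2) + 2 * s ^ 2 + 2 * compactRoot a s ^ 2)

theorem compactRoot_sq_sq (ha : -2 < a) {s : ℝ} (hs : s ^ 2 ≤ 1) :
    (compactRoot a s ^ 2) ^ 2 = 1 + (a - 2) * (s ^ 2 * (1 - s ^ 2)) := by
  rw [← pow_mul]
  exact compactRoot_pow_four (compactA_pos_of_sq_le ha hs)

/-- If it failed, squaring would give (1 - a²/4)(1 - s²)² ≤ 0. For s² < 1 this leaves a ≥ 2, where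
positivity is evident, and at s² = 1 the value is 2 + 2n² > 0. -/
theorem compactSlope_denom_pos (ha : -2 < a) {s : ℝ} (hs : s ^ 2 ≤ 1) :
    0 < a * (1 - s ^ 2) + 2 * s ^ 2 + 2 * compactRoot a s ^ 2 := by
  have h1 := compactRoot_sq_sq ha hs
  have hk : 0 < compactRoot a s ^ 2 := pow_pos (compactRoot_pos (compactA_pos_of_sq_le ha hs)) 2
  set k := compactRoot a s ^ 2
  set t := s ^ 2 with ht
  have ht0 : 0 ≤ t := sq_nonneg s
  by_contra hn
  push Not at hn
  have h2 : k ≤ -(a / 2 * (1 - t) + t) := by linarith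
  have h3 : k ^ 2 ≤ (a / 2 * (1 - t) + t) ^ 2 := by nlinarith
  have h4 : (1 - a ^ 2 / 4) * (1 - t) ^ 2 ≤ 0 := by rw [h1] at h3; linarith
  rcases hs.eq_or_lt with h | h
  · rw [h] at h2
    linarith
  · have h5 : a < 2 := by
      by_contra h6
      push Not at h6
      nlinarith
    have h6 : 0 < (1 - a ^ 2 / 4) * (1 - t) ^ 2 :=
      mul_pos (by nlinarith) (pow_pos (by linarith) 2)
    linarith

theorem compactGap_denom_pos (ha : -2 < a) {s : ℝ} (hs : s ^ 2 ≤ 1) :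
    0 < compactRoot a s ^ 2 + s ^ 2 := by
  have := compactRoot_pos (compactA_pos_of_sq_le ha hs)
  positivity

/-- The bounds are the values of √A - u² at u = 0 and in the limit u = ±∞. After clearing the
positive denominator both are inequalities between n² and polynomials in s², proved by squaring. -/
theorem compactGap_bounds_of_gt (ha : 2 < a) {s : ℝ} (hs : s ^ 2 ≤ 1) :
    1 ≤ compactGap a s ∧ compactGap a s ≤ a / 2 := by
  have ha' : -2 < a := by linarith
  have h1 := compactRoot_sq_sq ha' hs
  have hk : 0 < compactRoot a s ^ 2 := pow_pos (compactRoot_pos (compactA_pos_of_sq_le ha' hs)) 2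
  have hd := compactGap_denom_pos ha' hs
  rw [compactGap, le_div_iff₀ hd, div_le_iff₀ hd]
  set k := compactRoot a s ^ 2
  set t := s ^ 2 with ht
  have ht0 : 0 ≤ t := sq_nonneg s
  have h0 : 0 ≤ (a - 2) * t := mul_nonneg (by linarith) ht0
  constructor
  · have h2 : k ≤ 1 + (a - 2) * t := by
      refine le_of_sq_le_sq ?_ (by linarith)
      rw [h1]
      nlinarith [mul_nonneg h0 ht0, mul_nonneg h0 h0]
    linarith
  · have h2 : 1 - t + a / 2 * t ≤ a / 2 * k := by
      refine le_of_sq_le_sq ?_ (by positivity)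
      rw [mul_pow, h1]
      have h3 : 0 ≤ (a ^ 2 / 4 - 1) * ((1 - t) * (1 - t + a * t)) :=
        mul_nonneg (by nlinarith) (mul_nonneg (by linarith) (by nlinarith))
      linarith
    linarith

theorem compactGap_bounds_of_lt (ha : -2 < a) (ha2 : a < 2) {s : ℝ} (hs : s ^ 2 ≤ 1) :
    a / 2 ≤ compactGap a s ∧ compactGap a s ≤ 1 := by
  have h1 := compactRoot_sq_sq ha hs
  have hk : 0 < compactRoot a s ^ 2 := pow_pos (compactRoot_pos (compactA_pos_of_sq_le ha hs)) 2
  have hd := compactGap_denom_pos ha hs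
  rw [compactGap, le_div_iff₀ hd, div_le_iff₀ hd]
  set k := compactRoot a s ^ 2
  set t := s ^ 2 with ht
  have ht0 : 0 ≤ t := sq_nonneg s
  have hA : (a / 2 * k) ^ 2 - (1 - t + a / 2 * t) ^ 2 =
      (a ^ 2 / 4 - 1) * ((1 - t) * (1 - t + a * t)) := by
    rw [mul_pow, h1]; ring
  have hc : 0 < 1 - a ^ 2 / 4 := by nlinarith
  constructor
  · have h2 : a / 2 * k ≤ 1 - t + a / 2 * t := by
      by_contra hn
      push Not at hn
      -- For negative `a` both sides of the inequality may be negative, and squaring then reverses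
      -- it; the two signs need separate arguments.
      rcases le_or_gt 0 (1 - t + a / 2 * t) with h3 | h3
      · have h4 : 0 < a := by
          by_contra h4
          push Not at h4
          nlinarith
        have h5 : (1 - t + a / 2 * t) ^ 2 < (a / 2 * k) ^ 2 := pow_lt_pow_left₀ hn h3 two_ne_zero
        have h6 : 0 ≤ (1 - a ^ 2 / 4) * ((1 - t) * (1 - t + a * t)) :=
          mul_nonneg hc.le (mul_nonneg (by linarith) (by nlinarith))
        linarith
      · have h4 : a < 0 := by
          by_contra h4
          push Not at h4
          nlinarith
        have h7 : 1 - t + a * t < 0 := by nlinarith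
        rcases hs.eq_or_lt with h | h
        · have hk1 : k = 1 := by
            have : k ^ 2 = 1 := by rw [h1, h]; ring
            nlinarith
          rw [h, hk1] at hn
          linarith
        · have h8 : 0 < (1 - a ^ 2 / 4) * ((1 - t) * -(1 - t + a * t)) :=
            mul_pos hc (mul_pos (by linarith) (by linarith))
          rcases le_or_gt (a / 2 * k) 0 with h9 | h9
          · have h10 : (a / 2 * k) ^ 2 ≤ (1 - t + a / 2 * t) ^ 2 := by nlinarith
            linarith
          · nlinarith
    linarith
  · have h2 : 1 + (a - 2) * t ≤ k := by
      by_contra hn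
      push Not at hn
      have h3 : k ^ 2 < (1 + (a - 2) * t) ^ 2 := pow_lt_pow_left₀ hn hk.le two_ne_zero
      rw [h1] at h3
      have h4 : 0 ≤ (2 - a) * t := mul_nonneg (by linarith) ht0
      nlinarith [mul_nonneg h4 ht0, mul_nonneg h4 (show 0 ≤ 1 - t by linarith), mul_nonneg h4 h4]
    linarith

/-- The gap stays between 1 and a/2, and admissibility says exactly that -p is outside the closed
interval between them. So gap + p has a constant sign `ε` up to the poles, which decides between H_p
and -H_p. -/
theorem exists_sign (a p : ℝ) (h : Admissible a p) : ∃ ε : ℝ, (ε = 1 ∨ ε = -1) ∧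
    ∀ s, s ^ 2 ≤ 1 → 0 < ε * (compactGap a s + p) := by
  rcases h with ⟨ha, hp | hp⟩ | ⟨ha, ha2, hp | hp⟩
  · exact ⟨-1, Or.inr rfl, fun s hs => by linarith [(compactGap_bounds_of_gt ha hs).2]⟩
  · exact ⟨1, Or.inl rfl, fun s hs => by linarith [(compactGap_bounds_of_gt ha hs).1]⟩
  · exact ⟨-1, Or.inr rfl, fun s hs => by linarith [(compactGap_bounds_of_lt ha ha2 hs).2]⟩
  · exact ⟨1, Or.inl rfl, fun s hs => by linarith [(compactGap_bounds_of_lt ha ha2 hs).1]⟩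

theorem contDiffAt_compactGap (ha : -2 < a) {s : ℝ} (hs : s ^ 2 ≤ 1) :
    ContDiffAt ℝ ∞ (compactGap a) s := by
  have hn := contDiffAt_compactRoot (compactA_pos_of_sq_le ha hs)
  refine ContDiffAt.div ?_ ((hn.pow 2).add (contDiffAt_id.pow 2)) (compactGap_denom_pos ha hs).ne'
  fun_prop

theorem contDiffAt_compactSlope (ha : -2 < a) {s : ℝ} (hs : s ^ 2 ≤ 1) :
    ContDiffAt ℝ ∞ (compactSlope a) s := by
  have hn := contDiffAt_compactRoot (compactA_pos_of_sq_le ha hs)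
  refine ContDiffAt.div contDiffAt_const (ContDiffAt.add (f := fun s => a * (1 - s ^ 2) + 2 * s ^ 2)
    ?_ (contDiffAt_const.mul (hn.pow 2))) (compactSlope_denom_pos ha hs).ne'
  fun_prop

/-- Rationalization: (√A - u²)(√A + u²) = 1 + au². The rationalized form has no difference of
infinite terms at u = ±∞. -/
theorem compactGap_compactCoord (ha : -2 < a) (y : ℝ) :
    compactGap a (compactCoord a y) = coordSpeed a y ^ 2 - invCoord a y ^ 2 := by
  have hw := coordSpeed_pos ha y
  have h4 := coordSpeed_pow_four ha y
  have hr : √(1 + invCoord a y ^ 2) ^ 2 = 1 + invCoord a y ^ 2 := Real.sq_sqrt (by positivity)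
  rw [compactGap, compactRoot_compactCoord ha, div_pow, compactCoord_sq, hr]
  set U := invCoord a y
  set w := coordSpeed a y
  have h1 : 0 < 1 + U ^ 2 := by positivity
  have h2 : 0 < w ^ 2 + U ^ 2 := by positivity
  rw [← add_div, div_eq_iff (by positivity)]
  field_simp
  linear_combination -h4

/-- Rationalization: (a + 2u²)² - 4A = a² - 4. The factor 1 + u² compensates the decay of a + 2u² -
2√A at the poles. -/
theorem compactSlope_compactCoord (ha : -2 < a) (y : ℝ) :
    compactSlope a (compactCoord a y) =
      (a + 2 * invCoord a y ^ 2 - 2 * coordSpeed a y ^ 2) * (1 + invCoord a y ^ 2) := by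
  have hw := coordSpeed_pos ha y
  have h4 := coordSpeed_pow_four ha y
  have hr : √(1 + invCoord a y ^ 2) ^ 2 = 1 + invCoord a y ^ 2 := Real.sq_sqrt (by positivity)
  have hd := compactSlope_denom_pos ha (compactCoord_sq_lt_one (a := a) y).le
  rw [compactSlope, div_eq_iff hd.ne', compactRoot_compactCoord ha, div_pow,
    compactCoord_sq, hr]
  set U := invCoord a y
  set w := coordSpeed a y
  have h1 : 0 < 1 + U ^ 2 := by positivity
  field_simp
  linear_combination 4 * h4

end CompactCoefficients

/-! ### The system on the sphere, and the global coefficients of the quartic integral. -/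

section Existence

variable {a p : ℝ}

theorem contMDiff_comp_sphereCoord {s : S2 → ℝ} (hs : ContMDiff (𝓡 2) 𝓘(ℝ, ℝ) ∞ s)
    (hs1 : ∀ x, s x ^ 2 ≤ 1) {f : ℝ → ℝ} (hf : ∀ t, t ^ 2 ≤ 1 → ContDiffAt ℝ ∞ f t) :
    ContMDiff (𝓡 2) 𝓘(ℝ, ℝ) ∞ (fun x => f (s x)) := fun x =>
  (hf _ (hs1 x)).contMDiffAt.comp x hs.contMDiffAt

theorem exists_isSystemHp (h : Admissible a p) : ∃ S, IsSystemHp a p S := by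
  have ha : -2 < a := by rcases h with h | h <;> linarith [h.1]
  obtain ⟨ε, hε, hpos⟩ := exists_sign a p h
  obtain ⟨s, hs, hs1, hsp⟩ := exists_sphereCoord ha
  have hroot : ∀ t : ℝ, t ^ 2 ≤ 1 → 0 < compactRoot a t :=
    fun t ht => compactRoot_pos (compactA_pos_of_sq_le ha ht)
  have hgap : ∀ t : ℝ, t ^ 2 ≤ 1 → ContDiffAt ℝ ∞ (fun t => compactGap a t + p) t :=
    fun t ht => (contDiffAt_compactGap ha ht).add contDiffAt_const
  have hcosh : ∀ t : ℝ, t ^ 2 ≤ 1 → ContDiffAt ℝ ∞ (compactCosh a) t :=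
    fun t ht => contDiffAt_compactCosh ha (mem_Ioo_compactRadius ht)
  have hne : ∀ t : ℝ, t ^ 2 ≤ 1 → compactGap a t + p ≠ 0 := fun t ht h0 => by
    have := hpos t ht
    rw [h0] at this
    simp at this
  -- The round metric is (dφ² + dy²)/cosh² y and u₁ = cos φ/cosh y. So `f` and `g` are the conformal
  -- factor times cosh² y, and the coefficient of cos φ in the potential times cosh y, written
  -- through s.
  set f : ℝ → ℝ := fun t => ε * (compactGap a t + p) * compactCosh a t ^ 2 / compactRoot a t ^ 2
    with hf
  set g : ℝ → ℝ := fun t => -(ε / 2) * (t * compactCosh a t * compactSlope a t) /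
    (compactGap a t + p) with hg
  have hfc : ContMDiff (𝓡 2) 𝓘(ℝ, ℝ) ∞ (fun x => f (s x)) := by
    refine contMDiff_comp_sphereCoord hs hs1 fun t ht => ?_
    exact ((contDiffAt_const.mul (hgap t ht)).mul ((hcosh t ht).pow 2)).div
      ((contDiffAt_compactRoot (compactA_pos_of_sq_le ha ht)).pow 2) (pow_pos (hroot t ht) 2).ne'
  have hgc : ContMDiff (𝓡 2) 𝓘(ℝ, ℝ) ∞ (fun x => g (s x)) := by
    refine contMDiff_comp_sphereCoord hs hs1 fun t ht => ?_
    exact (contDiffAt_const.mul ((contDiffAt_id.mul (hcosh t ht)).mul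
      (contDiffAt_compactSlope ha ht))).div (hgap t ht) (hne t ht)
  have hfpos : ∀ x, 0 < f (s x) := fun x => by
    have h1 := hpos _ (hs1 x)
    have h2 := hroot _ (hs1 x)
    have h3 := compactCosh_pos (a := a) (hs1 x)
    positivity
  let S : ConservativeSystem 2 S2 :=
    { metric := conformalMetric (fun x => f (s x)) hfc hfpos
      potential := fun x => g (s x) * (x : E3) 0
      potential_smooth := hgc.mul (contMDiff_sphere_coord 0) }
  refine ⟨S, isSystemHp_of_polar ha hε (fun z v w => ?_) fun z => ?_⟩
  · have h1 : S.metric.inner (polarMap z) (polarDeriv z v) (polarDeriv z w) =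
        f (s (polarMap z)) * inner ℝ (inclusionDeriv (polarMap z) (polarDeriv z v))
          (inclusionDeriv (polarMap z) (polarDeriv z w)) := conformalMetric_inner _ hfc hfpos _ _ _
    rw [h1, inclusionDeriv_polarDeriv, inclusionDeriv_polarDeriv, inner_polarTangent, hsp]
    simp only [hf]
    rw [compactGap_compactCoord ha, compactRoot_compactCoord ha, cosh_eq_compactCosh ha, hpFactor]
    have h2 := compactCosh_pos (a := a) (compactCoord_sq_lt_one (a := a) (z 1)).le
    have hr : 0 < √(1 + invCoord a (z 1) ^ 2) := Real.sqrt_pos.2 (by positivity)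
    have hw := coordSpeed_pos ha (z 1)
    field_simp
  · have h0 : (polarMap z : E3) 0 = Real.cos (z 0) / Real.cosh (z 1) := rfl
    have h1 : S.potential (polarMap z) = g (s (polarMap z)) * (Real.cos (z 0) / Real.cosh (z 1)) :=
      rfl
    rw [h1, hsp]
    simp only [hg]
    have h2 := compactCosh_pos (a := a) (compactCoord_sq_lt_one (a := a) (z 1)).le
    have hr : 0 < √(1 + invCoord a (z 1) ^ 2) := Real.sqrt_pos.2 (by positivity)
    have hr2 : √(1 + invCoord a (z 1) ^ 2) ^ 2 = 1 + invCoord a (z 1) ^ 2 :=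
      Real.sq_sqrt (by positivity)
    have h3 := hne _ (compactCoord_sq_lt_one (a := a) (z 1)).le
    have h4 := compactSlope_compactCoord ha (z 1)
    have h5 : compactCoord a (z 1) * √(1 + invCoord a (z 1) ^ 2) = invCoord a (z 1) :=
      div_mul_cancel₀ _ hr.ne'
    rw [compactGap_compactCoord ha] at h3 ⊢
    rw [cosh_eq_compactCosh ha, hpPotential, h4]
    set r := √(1 + invCoord a (z 1) ^ 2)
    rw [← hr2]
    field_simp
    linear_combination (-(ε * (a + 2 * invCoord a (z 1) ^ 2 - 2 * coordSpeed a (z 1) ^ 2) *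
      Real.cos (z 0))) * h5

/-- The coefficients of the integral of degree four, in terms of the position on the sphere. -/
theorem exists_integral_coefficients (ha : -2 < a) : ∃ A B C : S2 → ℝ,
    ContMDiff (𝓡 2) 𝓘(ℝ, ℝ) ∞ A ∧ ContMDiff (𝓡 2) 𝓘(ℝ, ℝ) ∞ B ∧ ContMDiff (𝓡 2) 𝓘(ℝ, ℝ) ∞ C ∧
    (∀ z, A (polarMap z) * Real.cosh (z 1) = coordSpeed a (z 1)) ∧
    (∀ z, A (polarMap z) * Real.sinh (z 1) + B (polarMap z) / Real.cosh (z 1) =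
      invCoord a (z 1)) ∧
    ∀ z, C (polarMap z) / Real.cosh (z 1) ^ 2 =
      a + 2 * invCoord a (z 1) ^ 2 - 2 * coordSpeed a (z 1) ^ 2 := by
  obtain ⟨s, hs, hs1, hsp⟩ := exists_sphereCoord ha
  have hroot : ∀ t : ℝ, t ^ 2 ≤ 1 → 0 < compactRoot a t :=
    fun t ht => compactRoot_pos (compactA_pos_of_sq_le ha ht)
  have hrc : ∀ t : ℝ, t ^ 2 ≤ 1 → ContDiffAt ℝ ∞ (compactRoot a) t :=
    fun t ht => contDiffAt_compactRoot (compactA_pos_of_sq_le ha ht)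
  have hcosh : ∀ t : ℝ, t ^ 2 ≤ 1 → ContDiffAt ℝ ∞ (compactCosh a) t :=
    fun t ht => contDiffAt_compactCosh ha (mem_Ioo_compactRadius ht)
  have hsinh : ∀ t : ℝ, t ^ 2 ≤ 1 → ContDiffAt ℝ ∞ (compactSinh a) t :=
    fun t ht => contDiffAt_compactSinh ha (mem_Ioo_compactRadius ht)
  -- The equations force A = w/cosh y, B = cosh y (U - A sinh y) and C = c cosh² y. With r² = 1/(1 -
  -- s²), D = `compactCosh`, E = `compactSinh` and J = `coordShift`, B = r²(sD - nE) = (1 - n) r² E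
  -- - sinh J; and (1 - n) r² = -(a - 2)s²/((1 + n)(1 + n²)) is regular at s = ±1.
  refine ⟨fun x => (fun t => compactRoot a t / compactCosh a t) (s x),
    fun x => (fun t => -(a - 2) * t ^ 2 * compactSinh a t /
      ((1 + compactRoot a t) * (1 + compactRoot a t ^ 2)) - Real.sinh (coordShift a t)) (s x),
    fun x => (fun t => compactCosh a t ^ 2 * compactSlope a t) (s x),
    contMDiff_comp_sphereCoord hs hs1 fun t ht =>
      (hrc t ht).div (hcosh t ht) (compactCosh_pos ht).ne',
    contMDiff_comp_sphereCoord hs hs1 (f := fun t => -(a - 2) * t ^ 2 * compactSinh a t /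
      ((1 + compactRoot a t) * (1 + compactRoot a t ^ 2)) - Real.sinh (coordShift a t))
      fun t ht => ?_,
    contMDiff_comp_sphereCoord hs hs1 fun t ht =>
      ((hcosh t ht).pow 2).mul (contDiffAt_compactSlope ha ht), fun z => ?_, fun z => ?_, fun z => ?_⟩
  · refine ContDiffAt.sub (ContDiffAt.div ((contDiffAt_const.mul (contDiffAt_id.pow 2)).mul
      (hsinh t ht)) ((contDiffAt_const.add (hrc t ht)).mul (contDiffAt_const.add ((hrc t ht).pow 2)))
      ?_) (contDiffAt_coordShift ha (mem_Ioo_compactRadius ht)).sinh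
    have := hroot t ht
    positivity
  all_goals
    have h2 := compactCosh_pos (a := a) (compactCoord_sq_lt_one (a := a) (z 1)).le
    have hr : 0 < √(1 + invCoord a (z 1) ^ 2) := Real.sqrt_pos.2 (by positivity)
    have hr2 : √(1 + invCoord a (z 1) ^ 2) ^ 2 = 1 + invCoord a (z 1) ^ 2 :=
      Real.sq_sqrt (by positivity)
    have h5 : compactCoord a (z 1) * √(1 + invCoord a (z 1) ^ 2) = invCoord a (z 1) :=
      div_mul_cancel₀ _ hr.ne'
    have h6 := compactRoot_compactCoord ha (z 1)
    simp only [hsp]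
    rw [cosh_eq_compactCosh ha]
  · rw [h6]
    field_simp
  · rw [sinh_eq_compactSinh ha]
    have hn := hroot _ (compactCoord_sq_lt_one (a := a) (z 1)).le
    have hn4 := compactRoot_pow_four (compactA_pos_of_sq_le ha (compactCoord_sq_lt_one (a := a) (z 1)).le)
    have hsq := compactCoord_sq (a := a) (z 1)
    have hr3 : √(1 + invCoord a (z 1) ^ 2) ^ 2 * (1 - compactCoord a (z 1) ^ 2) = 1 := by
      rw [hr2, hsq]
      have : (1 + invCoord a (z 1) ^ 2) ≠ 0 := by positivity
      field_simp
      ring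
    rw [compactA] at hn4
    set t := compactCoord a (z 1)
    set n := compactRoot a t
    set r := √(1 + invCoord a (z 1) ^ 2)
    have hD : compactCosh a t = Real.cosh (coordShift a t) + t * Real.sinh (coordShift a t) := rfl
    have hE : compactSinh a t = t * Real.cosh (coordShift a t) + Real.sinh (coordShift a t) := rfl
    have h7 : -(a - 2) * t ^ 2 / ((1 + n) * (1 + n ^ 2)) = (1 - n) * r ^ 2 := by
      rw [div_eq_iff (by positivity)]
      linear_combination ((a - 2) * t ^ 2) * hr3 + r ^ 2 * hn4
    have h8 : -(a - 2) * t ^ 2 * compactSinh a t / ((1 + n) * (1 + n ^ 2)) =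
        (1 - n) * r ^ 2 * compactSinh a t := by
      rw [← h7]; ring
    rw [h8, ← h5]
    have h9 : compactSinh a t - t * compactCosh a t =
        (1 - t ^ 2) * Real.sinh (coordShift a t) := by rw [hD, hE]; ring
    field_simp
    linear_combination r ^ 2 * h9 + Real.sinh (coordShift a t) * hr3
  · rw [mul_pow, compactSlope_compactCoord ha, hr2]
    have : (1 + invCoord a (z 1) ^ 2) ≠ 0 := by positivity
    field_simp

end Existence

/-! ### The differential system for U, w, m, c and the Hamiltonian in polar form. -/

section PolarHamiltonian

variable {a p ε : ℝ} {S : ConservativeSystem 2 S2}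

/-- The function `√A - u² + p` of `y`. -/
def hpGap (a p y : ℝ) : ℝ := coordSpeed a y ^ 2 - invCoord a y ^ 2 + p

/-- The function `a + 2 u² - 2 √A` of `y`. -/
def hpSlope (a y : ℝ) : ℝ := a + 2 * invCoord a y ^ 2 - 2 * coordSpeed a y ^ 2

/-- Written through c = `hpSlope`, the derivatives of U, w, m and c are rational in U, w, c, without
`a` or `p`. This closed form is what makes the bracket with the quartic integral computable. -/
theorem hasDerivAt_coordSpeed_slope (ha : -2 < a) (y : ℝ) : HasDerivAt (coordSpeed a)
    (invCoord a y * (hpSlope a y + 2 * coordSpeed a y ^ 2) / (2 * coordSpeed a y ^ 2)) y := by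
  refine (hasDerivAt_coordSpeed ha y).congr_deriv ?_
  rw [hpSlope]
  ring

theorem hasDerivAt_hpGap (ha : -2 < a) (y : ℝ) : HasDerivAt (hpGap a p)
    (invCoord a y * hpSlope a y / coordSpeed a y) y := by
  have h := (((hasDerivAt_coordSpeed_slope ha y).fun_pow 2).sub
    ((hasDerivAt_invCoord ha y).fun_pow 2)).add_const p
  refine h.congr_deriv ?_
  have hw := (coordSpeed_pos ha y).ne'
  norm_num
  field_simp
  ring

theorem hasDerivAt_hpSlope (ha : -2 < a) (y : ℝ) : HasDerivAt (hpSlope a)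
    (-(2 * invCoord a y * hpSlope a y) / coordSpeed a y) y := by
  have h := ((((hasDerivAt_invCoord ha y).fun_pow 2).const_mul 2).const_add a).sub
    (((hasDerivAt_coordSpeed_slope ha y).fun_pow 2).const_mul 2)
  refine h.congr_deriv ?_
  have hw := (coordSpeed_pos ha y).ne'
  norm_num
  field_simp
  ring

theorem IsPolarHp.hpGap_pos (h : IsPolarHp a p ε S) (y : ℝ) : 0 < ε * hpGap a p y := by
  have h1 := h.metric.1 y
  have h2 := pow_pos (coordSpeed_pos h.gt y) 2
  have h3 : ε * hpGap a p y = ε * hpFactor a p y * coordSpeed a y ^ 2 := by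
    rw [hpFactor, hpGap, mul_assoc, div_mul_cancel₀ _ h2.ne']
  rw [h3]
  exact mul_pos h1 h2

theorem IsPolarHp.hpGap_ne_zero (h : IsPolarHp a p ε S) (y : ℝ) : hpGap a p y ≠ 0 :=
  right_ne_zero_of_mul (h.hpGap_pos y).ne'

theorem IsPolarHp.inPolar_hamiltonian (h : IsPolarHp a p ε S) (w : E2 × E2) :
    inPolar S.hamiltonian w = ε * (coordSpeed a (w.1 1) ^ 2 * (w.2 0 ^ 2 + w.2 1 ^ 2) -
      invCoord a (w.1 1) * hpSlope a (w.1 1) * Real.cos (w.1 0)) / (2 * hpGap a p (w.1 1)) := by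
  have h1 : inPolar S.hamiltonian w = inPolar S.kinetic w + S.potential (polarMap w.1) := rfl
  have h2 := (coordSpeed_pos h.gt (w.1 1)).ne'
  have h3 := h.hpGap_ne_zero (w.1 1)
  have h4 : ε ≠ 0 := left_ne_zero_of_mul (h.hpGap_pos 0).ne'
  have h5 := h.sign
  rw [h1, h.metric.inPolar_kinetic, h.potential, hpFactor, hpPotential]
  change _ = _ / (2 * hpGap a p (w.1 1))
  change 1 / 2 * (w.2 0 ^ 2 / (ε * (hpGap a p (w.1 1) / coordSpeed a (w.1 1) ^ 2)) +
    w.2 1 ^ 2 / (ε * (hpGap a p (w.1 1) / coordSpeed a (w.1 1) ^ 2))) +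
    ε * -(invCoord a (w.1 1) * hpSlope a (w.1 1) / (2 * hpGap a p (w.1 1))) * Real.cos (w.1 0) = _
  field_simp
  linear_combination (-coordSpeed a (w.1 1) ^ 2 * (w.2 0 ^ 2 + w.2 1 ^ 2)) * h5

end PolarHamiltonian

/-! ### The integral of degree four and its generic independence. -/

section QuarticIntegral

variable {a p ε : ℝ} {S : ConservativeSystem 2 S2}

/-- The integral of degree four, with coefficients `A`, `B`, `C` that depend on the position. -/
def quarticIntegral (ε : ℝ) (S : ConservativeSystem 2 S2) (A B C : S2 → ℝ)
    (ξ : CotangentBundle 2 S2) : ℝ :=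
  angularMomentum !₂[0, 0, 1] ξ * angularMomentum !₂[0, 0, 1] ξ *
      (angularMomentum !₂[0, 0, 1] ξ * angularMomentum !₂[0, 0, 1] ξ) +
    -(4 * ε) * (angularMomentum !₂[0, 0, 1] ξ * angularMomentum !₂[0, 0, 1] ξ * S.hamiltonian ξ) +
    (-4 * A ξ.1) * (angularMomentum !₂[0, 0, 1] ξ * angularMomentum !₂[1, 0, 0] ξ) +
    (4 * (B ξ.1 * (ξ.1 : E3) 0)) *
      (angularMomentum !₂[0, 0, 1] ξ * angularMomentum !₂[0, 0, 1] ξ) +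
    C ξ.1 * ((ξ.1 : E3) 1 * (ξ.1 : E3) 1)

variable {A B C : S2 → ℝ}

theorem isSmoothOnCotangent_quarticIntegral (hA : ContMDiff (𝓡 2) 𝓘(ℝ, ℝ) ∞ A)
    (hB : ContMDiff (𝓡 2) 𝓘(ℝ, ℝ) ∞ B) (hC : ContMDiff (𝓡 2) 𝓘(ℝ, ℝ) ∞ C) :
    IsSmoothOnCotangent (quarticIntegral ε S A B C) := by
  have hP := isSmoothOnCotangent_angularMomentum !₂[0, 0, 1]
  have hM := isSmoothOnCotangent_angularMomentum !₂[1, 0, 0]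
  have h0 := contMDiff_sphere_coord 0
  have h1 := contMDiff_sphere_coord 1
  have b1 := isSmoothOnCotangent_base (f := fun x => -4 * A x) (contMDiff_const.mul hA)
  have b2 := isSmoothOnCotangent_base (f := fun x : S2 => 4 * (B x * (x : E3) 0))
    (contMDiff_const.mul (hB.mul h0))
  have b3 := isSmoothOnCotangent_base (f := fun x : S2 => C x * ((x : E3) 1 * (x : E3) 1))
    (hC.mul (h1.mul h1))
  have b0 := isSmoothOnCotangent_base (n := 2) (M := S2) (f := fun _ => -(4 * ε)) contMDiff_const
  exact (((((hP.mul hP).mul (hP.mul hP)).add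
    (b0.mul ((hP.mul hP).mul S.isSmoothOnCotangent_hamiltonian))).add
    (b1.mul (hP.mul hM))).add (b2.mul (hP.mul hP))).add b3

theorem isPolynomialInMomenta_quarticIntegral :
    IsPolynomialInMomenta 4 (quarticIntegral ε S A B C) := by
  have hP : IsPolynomialInMomenta 1 (angularMomentum !₂[0, 0, 1]) :=
    isPolynomialInMomenta_momentum _
  have hM : IsPolynomialInMomenta 1 (angularMomentum !₂[1, 0, 0]) :=
    isPolynomialInMomenta_momentum _
  have b1 := isPolynomialInMomenta_base (n := 2) (M := S2) (fun x => -4 * A x)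
  have b2 := isPolynomialInMomenta_base (n := 2) (M := S2) (fun x : S2 => 4 * (B x * (x : E3) 0))
  have b3 := isPolynomialInMomenta_base (n := 2) (M := S2) (fun x : S2 => C x * ((x : E3) 1 * (x : E3) 1))
  have b0 := isPolynomialInMomenta_base (n := 2) (M := S2) (fun _ => -(4 * ε))
  exact (((((hP.mul hP).mul (hP.mul hP)).add
    ((b0.mul ((hP.mul hP).mul S.isPolynomialInMomenta_hamiltonian)).mono le_rfl)).add
    ((b1.mul (hP.mul hM)).mono (by norm_num))).add
    ((b2.mul (hP.mul hP)).mono (by norm_num))).add (b3.mono (by norm_num))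

/-- The coefficients are those of the integral of degree four. -/
structure IsIntegralCoefficients (a : ℝ) (A B C : S2 → ℝ) : Prop where
  smooth_A : ContMDiff (𝓡 2) 𝓘(ℝ, ℝ) ∞ A
  smooth_B : ContMDiff (𝓡 2) 𝓘(ℝ, ℝ) ∞ B
  smooth_C : ContMDiff (𝓡 2) 𝓘(ℝ, ℝ) ∞ C
  eq_A : ∀ z, A (polarMap z) * Real.cosh (z 1) = coordSpeed a (z 1)
  eq_B : ∀ z, A (polarMap z) * Real.sinh (z 1) + B (polarMap z) / Real.cosh (z 1) =
    invCoord a (z 1)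
  eq_C : ∀ z, C (polarMap z) / Real.cosh (z 1) ^ 2 = hpSlope a (z 1)

/-- The term -4A P M₁ gives -4w PQ sin φ together with 4A sinh y P² cos φ. The term with B u₁
completes A sinh y to U, and C u₂² gives c sin² φ. The individual terms of the polar formula need
not be smooth at the poles; this grouping shows that the sum is. -/
theorem inPolar_quarticIntegral (hc : IsIntegralCoefficients a A B C) (φ y P Q : ℝ) :
    inPolar (quarticIntegral ε S A B C) (!₂[φ, y], !₂[P, Q]) =
      P ^ 4 - 4 * ε * P ^ 2 * inPolar S.hamiltonian (!₂[φ, y], !₂[P, Q]) +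
      4 * invCoord a y * P ^ 2 * Real.cos φ - 4 * coordSpeed a y * P * Q * Real.sin φ +
      hpSlope a y * Real.sin φ ^ 2 := by
  set w : E2 × E2 := (!₂[φ, y], !₂[P, Q]) with hw
  have h1 : angularMomentum !₂[0, 0, 1] (polarPoint w) = P := inPolar_angularMomentum_axis w
  have h2 : angularMomentum !₂[1, 0, 0] (polarPoint w) =
      Real.cosh y * Real.sin φ * Q - Real.sinh y * Real.cos φ * P :=
    inPolar_angularMomentum_first w
  have h3 : S.hamiltonian (polarPoint w) = inPolar S.hamiltonian w := rfl
  have h4 : (polarPoint w).1 = polarMap !₂[φ, y] := rfl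
  have h5 : (polarMap !₂[φ, y] : E3) 0 = Real.cos φ / Real.cosh y := rfl
  have h6 : (polarMap !₂[φ, y] : E3) 1 = Real.sin φ / Real.cosh y := rfl
  have hA : A (polarMap !₂[φ, y]) * Real.cosh y = coordSpeed a y := hc.eq_A _
  have hB : A (polarMap !₂[φ, y]) * Real.sinh y + B (polarMap !₂[φ, y]) / Real.cosh y =
    invCoord a y := hc.eq_B _
  have hC : C (polarMap !₂[φ, y]) / Real.cosh y ^ 2 = hpSlope a y := hc.eq_C _
  rw [inPolar, quarticIntegral, h1, h2, h3, h4, h5, h6, ← hA, ← hB, ← hC]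
  have hne := (Real.cosh_pos y).ne'
  field_simp
  ring

/-- Once all derivatives are replaced by means of the differential system, U, w, m, c, sin φ and cos
φ may be treated as independent variables: the bracket vanishes as a rational identity modulo ε² =
1. -/
theorem IsPolarHp.poissonBracket_quarticIntegral (h : IsPolarHp a p ε S)
    (hc : IsIntegralCoefficients a A B C) (φ y P Q : ℝ) :
    poissonBracket (inPolar (quarticIntegral ε S A B C)) (inPolar S.hamiltonian)
      (!₂[φ, y], !₂[P, Q]) = 0 := by
  have hFs := (isSmoothOnCotangent_quarticIntegral (ε := ε) (S := S) hc.smooth_A hc.smooth_B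
    hc.smooth_C).contDiff_inPolar.differentiable (by simp)
  have hHs := S.isSmoothOnCotangent_hamiltonian.contDiff_inPolar.differentiable (by simp)
  have hw := (coordSpeed_pos h.gt y).ne'
  have hm := h.hpGap_ne_zero y
  have hU' := hasDerivAt_invCoord h.gt y
  have hw' := hasDerivAt_coordSpeed_slope h.gt y
  have hm' := hasDerivAt_hpGap (p := p) h.gt y
  have hc' := hasDerivAt_hpSlope h.gt y
  have hH : ∀ φ y P Q, inPolar S.hamiltonian (!₂[φ, y], !₂[P, Q]) =
      ε * (coordSpeed a y ^ 2 * (P ^ 2 + Q ^ 2) - invCoord a y * hpSlope a y * Real.cos φ) /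
        (2 * hpGap a p y) := fun φ y P Q => h.inPolar_hamiltonian (!₂[φ, y], !₂[P, Q])
  have hH1 : HasDerivAt (fun t => inPolar S.hamiltonian (!₂[t, y], !₂[P, Q])) _ φ :=
    (((((Real.hasDerivAt_cos φ).const_mul (invCoord a y * hpSlope a y)).const_sub
      (coordSpeed a y ^ 2 * (P ^ 2 + Q ^ 2))).const_mul ε).div_const
      (2 * hpGap a p y)).congr_of_eventuallyEq (Filter.Eventually.of_forall fun t => hH t y P Q)
  have hH2 : HasDerivAt (fun t => inPolar S.hamiltonian (!₂[φ, t], !₂[P, Q])) _ y :=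
    (((((hw'.fun_pow 2).mul_const (P ^ 2 + Q ^ 2)).sub ((hU'.fun_mul hc').mul_const
      (Real.cos φ))).const_mul ε).fun_div (hm'.const_mul 2)
      (mul_ne_zero two_ne_zero hm)).congr_of_eventuallyEq
      (Filter.Eventually.of_forall fun t => hH φ t P Q)
  have hH3 : HasDerivAt (fun t => inPolar S.hamiltonian (!₂[φ, y], !₂[t, Q])) _ P :=
    (((((((hasDerivAt_id' P).fun_pow 2).add_const (Q ^ 2)).const_mul
      (coordSpeed a y ^ 2)).sub_const (invCoord a y * hpSlope a y * Real.cos φ)).const_mul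
      ε).div_const (2 * hpGap a p y)).congr_of_eventuallyEq
      (Filter.Eventually.of_forall fun t => hH φ y t Q)
  have hH4 : HasDerivAt (fun t => inPolar S.hamiltonian (!₂[φ, y], !₂[P, t])) _ Q :=
    (((((((hasDerivAt_id' Q).fun_pow 2).const_add (P ^ 2)).const_mul
      (coordSpeed a y ^ 2)).sub_const (invCoord a y * hpSlope a y * Real.cos φ)).const_mul
      ε).div_const (2 * hpGap a p y)).congr_of_eventuallyEq
      (Filter.Eventually.of_forall fun t => hH φ y P t)
  have hF := inPolar_quarticIntegral (ε := ε) (S := S) hc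
  have hF1 : HasDerivAt (fun t => inPolar (quarticIntegral ε S A B C) (!₂[t, y], !₂[P, Q])) _ φ :=
    (((((hH1.const_mul (4 * ε * P ^ 2)).const_sub (P ^ 4)).add ((Real.hasDerivAt_cos φ).const_mul
      (4 * invCoord a y * P ^ 2))).sub ((Real.hasDerivAt_sin φ).const_mul
      (4 * coordSpeed a y * P * Q))).add (((Real.hasDerivAt_sin φ).fun_pow 2).const_mul
      (hpSlope a y))).congr_of_eventuallyEq (Filter.Eventually.of_forall fun t => hF t y P Q)
  have hF2 : HasDerivAt (fun t => inPolar (quarticIntegral ε S A B C) (!₂[φ, t], !₂[P, Q])) _ y :=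
    (((((hH2.const_mul (4 * ε * P ^ 2)).const_sub (P ^ 4)).add (((hU'.const_mul 4).mul_const
      (P ^ 2)).mul_const (Real.cos φ))).sub ((((hw'.const_mul 4).mul_const P).mul_const
      Q).mul_const (Real.sin φ))).add (hc'.mul_const (Real.sin φ ^ 2))).congr_of_eventuallyEq
      (Filter.Eventually.of_forall fun t => hF φ t P Q)
  have hF3 : HasDerivAt (fun t => inPolar (quarticIntegral ε S A B C) (!₂[φ, y], !₂[t, Q])) _ P :=
    (((((((hasDerivAt_id' P).fun_pow 4).sub ((((hasDerivAt_id' P).fun_pow 2).const_mul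
      (4 * ε)).fun_mul hH3)).add ((((hasDerivAt_id' P).fun_pow 2).const_mul
      (4 * invCoord a y)).mul_const (Real.cos φ))).sub ((((hasDerivAt_id' P).const_mul
      (4 * coordSpeed a y)).mul_const Q).mul_const (Real.sin φ))).add_const
      (hpSlope a y * Real.sin φ ^ 2))).congr_of_eventuallyEq
      (Filter.Eventually.of_forall fun t => hF φ y t Q)
  have hF4 : HasDerivAt (fun t => inPolar (quarticIntegral ε S A B C) (!₂[φ, y], !₂[P, t])) _ Q :=
    (((((hH4.const_mul (4 * ε * P ^ 2)).const_sub (P ^ 4)).add_const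
      (4 * invCoord a y * P ^ 2 * Real.cos φ)).sub (((hasDerivAt_id' Q).const_mul
      (4 * coordSpeed a y * P)).mul_const (Real.sin φ))).add_const
      (hpSlope a y * Real.sin φ ^ 2)).congr_of_eventuallyEq
      (Filter.Eventually.of_forall fun t => hF φ y P t)
  rw [poissonBracket_eq_of_hasDerivAt (hFs _) (hHs _) hF1 hF2 hF3 hF4 hH1 hH2 hH3 hH4]
  rw [hH]
  have hs : ε ^ 2 = 1 := by rw [sq, h.sign]
  norm_num
  generalize coordSpeed a y = w at *
  generalize invCoord a y = U at *
  generalize hpSlope a y = c at *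
  generalize hpGap a p y = m at *
  generalize Real.sin φ = s at *
  generalize Real.cos φ = k at *
  clear hH1 hH2 hH3 hH4 hF1 hF2 hF3 hF4 hF hFs hHs hH hU' hw' hm' hc'
  field_simp
  linear_combination (4 * ε * m * P * U * s * c * (w ^ 2 * Q ^ 2 - U * c * k + P ^ 2 * w ^ 2)) * hs

theorem linearIndependent_of_minor {f h : E2 × E2 → ℝ} {φ y P Q f₃ f₄ h₃ h₄ : ℝ}
    (hf : DifferentiableAt ℝ f (!₂[φ, y], !₂[P, Q]))
    (hh : DifferentiableAt ℝ h (!₂[φ, y], !₂[P, Q]))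
    (hf₃ : HasDerivAt (fun t => f (!₂[φ, y], !₂[t, Q])) f₃ P)
    (hf₄ : HasDerivAt (fun t => f (!₂[φ, y], !₂[P, t])) f₄ Q)
    (hh₃ : HasDerivAt (fun t => h (!₂[φ, y], !₂[t, Q])) h₃ P)
    (hh₄ : HasDerivAt (fun t => h (!₂[φ, y], !₂[P, t])) h₄ Q) (hne : f₃ * h₄ - f₄ * h₃ ≠ 0) :
    LinearIndependent ℝ
      ![fderiv ℝ f (!₂[φ, y], !₂[P, Q]), fderiv ℝ h (!₂[φ, y], !₂[P, Q])] := by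
  rw [LinearIndependent.pair_iff]
  intro s t hst
  have h1 := DFunLike.congr_fun hst ((0, EuclideanSpace.single 0 1) : E2 × E2)
  have h2 := DFunLike.congr_fun hst ((0, EuclideanSpace.single 1 1) : E2 × E2)
  simp only [add_apply, smul_apply, smul_eq_mul, zero_apply] at h1 h2
  rw [fderiv_momentum_zero hf hf₃, fderiv_momentum_zero hh hh₃] at h1
  rw [fderiv_momentum_one hf hf₄, fderiv_momentum_one hh hh₄] at h2
  constructor
  · refine (mul_eq_zero.1 ?_).resolve_right hne
    linear_combination h₄ * h1 - h₃ * h2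
  · refine (mul_eq_zero.1 ?_).resolve_right hne
    linear_combination f₃ * h2 - f₄ * h1

theorem exists_near_cubic_ne_zero {k₁ : ℝ} (hk : k₁ ≠ 0) (k₂ k₃ k₄ : ℝ) {s : Set ℝ} {x : ℝ}
    (hs : s ∈ 𝓝 x) : ∃ y ∈ s, k₁ * y ^ 3 + k₂ * y ^ 2 + k₃ * y + k₄ ≠ 0 := by
  set q : Polynomial ℝ := Polynomial.C k₁ * Polynomial.X ^ 3 + Polynomial.C k₂ * Polynomial.X ^ 2 +
    Polynomial.C k₃ * Polynomial.X + Polynomial.C k₄ with hq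
  have hq0 : q ≠ 0 := by
    intro h
    have h3 : q.coeff 3 = k₁ := by
      simp [hq, Polynomial.coeff_X, Polynomial.coeff_C]
    rw [h] at h3
    exact hk h3.symm
  have hfin : (q.rootSet ℝ).Finite := Polynomial.rootSet_finite q ℝ
  obtain ⟨y, hy, hys⟩ := (hfin.countable.dense_compl ℝ).inter_nhds_nonempty hs
  refine ⟨y, hys, fun h0 => hy ?_⟩
  rw [Polynomial.mem_rootSet]
  exact ⟨hq0, by simpa [hq] using h0⟩

/-- It suffices to perturb the momenta at a fixed position. The minor of (dF, dH) in the momentum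
directions is, up to a nonzero factor, a cubic in Q whose leading coefficient is nonzero as soon as
P ≠ 0. -/
theorem IsPolarHp.isGenericallyIndependent_quarticIntegral (h : IsPolarHp a p ε S)
    (hc : IsIntegralCoefficients a A B C) :
    IsGenericallyIndependent (quarticIntegral ε S A B C) S.hamiltonian := by
  have hFsm := isSmoothOnCotangent_quarticIntegral (ε := ε) (S := S) hc.smooth_A hc.smooth_B
    hc.smooth_C
  have hHsm := S.isSmoothOnCotangent_hamiltonian
  have hFs := hFsm.contDiff_inPolar.differentiable (by simp)
  have hHs := hHsm.contDiff_inPolar.differentiable (by simp)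
  refine isGenericallyIndependent_of_inPolar hFsm hHsm fun w s hs => ?_
  obtain ⟨z, v⟩ := w
  obtain ⟨φ, y, rfl⟩ : ∃ φ y, z = !₂[φ, y] := ⟨_, _, eq_vec_two z⟩
  obtain ⟨P₀, Q₀, rfl⟩ : ∃ P Q, v = !₂[P, Q] := ⟨_, _, eq_vec_two v⟩
  have hcont : Continuous fun t : ℝ × ℝ => ((!₂[φ, y], !₂[t.1, t.2]) : E2 × E2) := by
    refine continuous_const.prodMk ?_
    fun_prop
  obtain ⟨u₁, hu₁, u₂, hu₂, hsub⟩ := mem_nhds_prod_iff.1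
    (hcont.continuousAt.preimage_mem_nhds (x := ((P₀, Q₀) : ℝ × ℝ)) hs)
  obtain ⟨P, hP, hPu⟩ := (dense_compl_singleton (0 : ℝ)).inter_nhds_nonempty hu₁
  have hw := (coordSpeed_pos h.gt y).ne'
  have hm := h.hpGap_ne_zero y
  have hε : ε ≠ 0 := left_ne_zero_of_mul (h.hpGap_pos 0).ne'
  have hP0 : P ≠ 0 := hP
  -- The coefficients are those of F_P H_Q - F_Q H_P divided by ε w²/m. The -4εP² dH part of dF
  -- drops out of the minor.
  obtain ⟨Q, hQu, hQ⟩ := exists_near_cubic_ne_zero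
    (k₁ := -4 * P * coordSpeed a y ^ 2 / hpGap a p y)
    (by simp [hP0, hw, hm]) (-4 * coordSpeed a y * Real.sin φ)
    (4 * P ^ 3 - 4 * P * (coordSpeed a y ^ 2 * P ^ 2 -
      invCoord a y * hpSlope a y * Real.cos φ) / hpGap a p y + 8 * invCoord a y * P * Real.cos φ)
    (4 * coordSpeed a y * P ^ 2 * Real.sin φ) hu₂
  refine ⟨(!₂[φ, y], !₂[P, Q]), hsub (Set.mk_mem_prod hPu hQu), ?_⟩
  have hH : ∀ φ y P Q, inPolar S.hamiltonian (!₂[φ, y], !₂[P, Q]) =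
      ε * (coordSpeed a y ^ 2 * (P ^ 2 + Q ^ 2) - invCoord a y * hpSlope a y * Real.cos φ) /
        (2 * hpGap a p y) := fun φ y P Q => h.inPolar_hamiltonian (!₂[φ, y], !₂[P, Q])
  have hH3 : HasDerivAt (fun t => inPolar S.hamiltonian (!₂[φ, y], !₂[t, Q])) _ P :=
    (((((((hasDerivAt_id' P).fun_pow 2).add_const (Q ^ 2)).const_mul
      (coordSpeed a y ^ 2)).sub_const (invCoord a y * hpSlope a y * Real.cos φ)).const_mul
      ε).div_const (2 * hpGap a p y)).congr_of_eventuallyEq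
      (Filter.Eventually.of_forall fun t => hH φ y t Q)
  have hH4 : HasDerivAt (fun t => inPolar S.hamiltonian (!₂[φ, y], !₂[P, t])) _ Q :=
    (((((((hasDerivAt_id' Q).fun_pow 2).const_add (P ^ 2)).const_mul
      (coordSpeed a y ^ 2)).sub_const (invCoord a y * hpSlope a y * Real.cos φ)).const_mul
      ε).div_const (2 * hpGap a p y)).congr_of_eventuallyEq
      (Filter.Eventually.of_forall fun t => hH φ y P t)
  have hF := inPolar_quarticIntegral (ε := ε) (S := S) hc
  have hF3 : HasDerivAt (fun t => inPolar (quarticIntegral ε S A B C) (!₂[φ, y], !₂[t, Q])) _ P :=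
    (((((((hasDerivAt_id' P).fun_pow 4).sub ((((hasDerivAt_id' P).fun_pow 2).const_mul
      (4 * ε)).fun_mul hH3)).add ((((hasDerivAt_id' P).fun_pow 2).const_mul
      (4 * invCoord a y)).mul_const (Real.cos φ))).sub ((((hasDerivAt_id' P).const_mul
      (4 * coordSpeed a y)).mul_const Q).mul_const (Real.sin φ))).add_const
      (hpSlope a y * Real.sin φ ^ 2))).congr_of_eventuallyEq
      (Filter.Eventually.of_forall fun t => hF φ y t Q)
  have hF4 : HasDerivAt (fun t => inPolar (quarticIntegral ε S A B C) (!₂[φ, y], !₂[P, t])) _ Q :=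
    (((((hH4.const_mul (4 * ε * P ^ 2)).const_sub (P ^ 4)).add_const
      (4 * invCoord a y * P ^ 2 * Real.cos φ)).sub (((hasDerivAt_id' Q).const_mul
      (4 * coordSpeed a y * P)).mul_const (Real.sin φ))).add_const
      (hpSlope a y * Real.sin φ ^ 2)).congr_of_eventuallyEq
      (Filter.Eventually.of_forall fun t => hF φ y P t)
  refine linearIndependent_of_minor (hFs _) (hHs _) hF3 hF4 hH3 hH4 fun h0 => hQ ?_
  rw [hH] at h0
  norm_num at h0
  have hs : ε ^ 2 = 1 := by rw [sq, h.sign]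
  clear hH3 hH4 hF3 hF4 hF hFs hHs hH hQ
  generalize coordSpeed a y = w at *
  generalize invCoord a y = U at *
  generalize hpSlope a y = c at *
  generalize hpGap a p y = m at *
  generalize Real.sin φ = s at *
  generalize Real.cos φ = k at *
  have h1 : ε * w ^ 2 * (-4 * P * w ^ 2 / m * Q ^ 3 + -4 * w * s * Q ^ 2 + (4 * P ^ 3 -
      4 * P * (w ^ 2 * P ^ 2 - U * c * k) / m + 8 * U * P * k) * Q + 4 * w * P ^ 2 * s) = 0 := by
    field_simp at h0 ⊢
    linear_combination h0 + (4 * ε * w ^ 2 * Q * P * (w ^ 2 * (P ^ 2 + Q ^ 2) - U * c * k)) * hs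
  exact (mul_eq_zero.1 h1).resolve_left (mul_ne_zero hε (pow_ne_zero 2 hw))

theorem IsPolarHp.exists_integral_of_degree_four (h : IsPolarHp a p ε S) :
    ∃ F : CotangentBundle 2 S2 → ℝ,
      IsIntegralOfDegree 4 F S.hamiltonian ∧ IsGenericallyIndependent F S.hamiltonian := by
  obtain ⟨A, B, C, hA, hB, hC, eA, eB, eC⟩ := exists_integral_coefficients h.gt
  have hc : IsIntegralCoefficients a A B C := ⟨hA, hB, hC, eA, eB, eC⟩
  have hF := isSmoothOnCotangent_quarticIntegral (ε := ε) (S := S) hA hB hC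
  have hg := h.isGenericallyIndependent_quarticIntegral hc
  refine ⟨quarticIntegral ε S A B C, ⟨hF, ?_, isPolynomialInMomenta_quarticIntegral,
    hg.isIndependent⟩, hg⟩
  refine isConserved_of_inPolar hF S.isSmoothOnCotangent_hamiltonian fun w => ?_
  obtain ⟨z, v⟩ := w
  rw [eq_vec_two z, eq_vec_two v]
  exact h.poissonBracket_quarticIntegral hc _ _ _ _

end QuarticIntegral

/-! ### Quadratic integrals of the geodesic flow of f(y)(dφ² + dy²), f even. -/

section KillingTensors

theorem eq_of_deriv_zero {f : ℝ → ℝ} (hf : ∀ y, HasDerivAt f 0 y) (x y : ℝ) : f x = f y :=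
  is_const_of_deriv_eq_zero (fun y => (hf y).differentiableAt) (fun y => (hf y).deriv) x y

/-- If `r' = k Λ` or `(r Λ)' = r(0)² + k Λ² / 2`, where `Λ` is the primitive of `r > 0` with
`Λ(0) = 0`, then `r` satisfies a differential equation of the first order. -/
theorem sq_deriv_of_linear {r L : ℝ → ℝ} (hr : Differentiable ℝ r) (hL : ∀ y, HasDerivAt L (r y) y)
    (hL0 : L 0 = 0) {k : ℝ} (h : ∀ y, deriv r y = k * L y) (y : ℝ) :
    deriv r y ^ 2 = k * (r y ^ 2 - r 0 ^ 2) := by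
  have h1 : ∀ y, HasDerivAt (fun y => r y ^ 2 - k * L y ^ 2) 0 y := fun y => by
    refine (((hr y).hasDerivAt.fun_pow 2).sub (((hL y).fun_pow 2).const_mul k)).congr_deriv ?_
    rw [h]
    ring
  have h2 := eq_of_deriv_zero h1 y 0
  simp only [hL0] at h2
  rw [h]
  linear_combination (-k) * h2

/-- Multiplying by 2rL makes both sides derivatives in y, and integration gives (rL)² = r(0)² L² +
(k/4) L⁴. Dividing by L² leads to r² = r(0)² + (k/4) L², so r' = (k/4) L as in the linear case. -/
theorem sq_deriv_of_quadratic {r L : ℝ → ℝ} (hr : Differentiable ℝ r) (hpos : ∀ y, 0 < r y)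
    (hL : ∀ y, HasDerivAt L (r y) y) (hL0 : L 0 = 0) {k : ℝ}
    (h : ∀ y, deriv r y * L y + r y ^ 2 = r 0 ^ 2 + k * L y ^ 2 / 2) (y : ℝ) :
    deriv r y ^ 2 = k / 4 * (r y ^ 2 - r 0 ^ 2) := by
  have h1 : ∀ y, HasDerivAt
      (fun y => (r y * L y) ^ 2 - (r 0 ^ 2 * L y ^ 2 + k / 4 * L y ^ 4)) 0 y := fun y => by
    refine ((((hr y).hasDerivAt.fun_mul (hL y)).fun_pow 2).sub
      ((((hL y).fun_pow 2).const_mul (r 0 ^ 2)).add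
        (((hL y).fun_pow 4).const_mul (k / 4)))).congr_deriv ?_
    norm_num
    linear_combination (2 * r y * L y) * h y
  have hmono : StrictMono L := strictMono_of_deriv_pos fun y => by rw [(hL y).deriv]; exact hpos y
  have h2 : ∀ y, r y ^ 2 = r 0 ^ 2 + k / 4 * L y ^ 2 := fun y => by
    rcases eq_or_ne y 0 with rfl | hy
    · rw [hL0]; ring
    · have hne : L y ≠ 0 := fun h0 => hy (hmono.injective (h0.trans hL0.symm))
      have h3 := eq_of_deriv_zero h1 y 0
      simp only [hL0] at h3
      have h4 : L y ^ 2 * (r y ^ 2) = L y ^ 2 * (r 0 ^ 2 + k / 4 * L y ^ 2) := by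
        linear_combination h3
      exact mul_left_cancel₀ (pow_ne_zero 2 hne) h4
  have h3 := ((hr y).hasDerivAt.fun_pow 2).unique
    (((((hL y).fun_pow 2).const_mul (k / 4)).const_add (r 0 ^ 2)).congr_of_eventuallyEq
      (Filter.Eventually.of_forall h2))
  have h4 : deriv r y = k / 4 * L y := by
    norm_num at h3
    have h5 : r y * deriv r y = r y * (k / 4 * L y) := by linear_combination h3 / 2
    exact mul_left_cancel₀ (hpos y).ne' h5
  rw [h4]
  linear_combination (-k / 4) * h2 y

/-- A tensor `A dφ² + 2 B dφ dy + C dy²` (as a quadratic function of the momenta) that is a Killing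
tensor of the metric `f(y) (dφ² + dy²)` with `f` even. -/
theorem killing_tensor_dichotomy {f : ℝ → ℝ} (hf : ContDiff ℝ ∞ f) (hpos : ∀ y, 0 < f y)
    (heven : ∀ y, f (-y) = f y) {A B C : ℝ → ℝ → ℝ}
    (hA : ∀ y, ContDiff ℝ ∞ fun φ => A φ y) (hB : ∀ y, ContDiff ℝ ∞ fun φ => B φ y)
    (hC : ∀ y, ContDiff ℝ ∞ fun φ => C φ y) (hA' : ∀ φ, Differentiable ℝ (A φ))
    (hB' : ∀ φ, Differentiable ℝ (B φ)) (hC' : ∀ φ, Differentiable ℝ (C φ))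
    (e₁ : ∀ φ y, f y * deriv (fun t => A t y) φ + B φ y * deriv f y = 0)
    (e₂ : ∀ φ y, f y * (2 * deriv (fun t => B t y) φ + deriv (A φ) y) + C φ y * deriv f y = 0)
    (e₃ : ∀ φ y, f y * (deriv (fun t => C t y) φ + 2 * deriv (B φ) y) + B φ y * deriv f y = 0)
    (e₄ : ∀ φ y, f y * deriv (C φ) y + C φ y * deriv f y = 0) :
    (∃ κ, ∀ y, deriv f y ^ 2 = 4 * κ * f y ^ 2 * (1 - f y / f 0)) ∨
      ∃ c b, ∀ φ y, A φ y = c + b / f y ∧ B φ y = 0 ∧ C φ y = b / f y := by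
  have hfd : ∀ y, HasDerivAt f (deriv f y) y := fun y => (hf.differentiable (by simp) y).hasDerivAt
  have hsq : ∀ y, √(f y) ^ 2 = f y := fun y => Real.sq_sqrt (hpos y).le
  have hsp : ∀ y, 0 < √(f y) := fun y => Real.sqrt_pos.2 (hpos y)
  set r : ℝ → ℝ := fun y => (√(f y))⁻¹ with hr
  have hrpos : ∀ y, 0 < r y := fun y => inv_pos.2 (hsp y)
  have hrd : ∀ y, HasDerivAt r (-(deriv f y / (2 * √(f y))) / √(f y) ^ 2) y := fun y =>
    ((hfd y).sqrt (hpos y).ne').inv (hsp y).ne'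
  have hrdiff : Differentiable ℝ r := fun y => (hrd y).differentiableAt
  have hr2 : ∀ y, r y ^ 2 * f y = 1 := fun y => by
    have := (hsp y).ne'
    rw [← hsq y, hr]
    field_simp
  have hreven : ∀ y, r (-y) = r y := fun y => by rw [hr]; simp only [heven]
  have hrodd : ∀ y, deriv r (-y) = -deriv r y := fun y => by
    have h1 := deriv_comp_neg r y
    rw [show (fun x => r (-x)) = r from funext hreven] at h1
    rw [h1, neg_neg]
  have hr0 : deriv r 0 = 0 := by
    have h1 := hrodd 0
    rw [neg_zero] at h1
    linarith
  set L : ℝ → ℝ := fun y => ∫ t in (0 : ℝ)..y, r t with hL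
  have hLd : ∀ y, HasDerivAt L (r y) y := fun y =>
    intervalIntegral.integral_hasDerivAt_right (hrdiff.continuous.intervalIntegrable _ _)
      (hrdiff.continuous.stronglyMeasurableAtFilter _ _) hrdiff.continuous.continuousAt
  have hL0 : L 0 = 0 := intervalIntegral.integral_same
  have hLodd : ∀ y, L (-y) = -L y := fun y => by
    have h1 : ∀ y, HasDerivAt (fun y => L (-y) + L y) 0 y := fun y => by
      refine (((hLd (-y)).comp y (hasDerivAt_neg y)).add (hLd y)).congr_deriv ?_
      rw [hreven]
      ring
    have h2 := eq_of_deriv_zero h1 y 0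
    simp only [neg_zero, hL0] at h2
    linarith
  -- The Q³ equation says that C f does not depend on y; `c` is this function of φ.
  set c : ℝ → ℝ := fun φ => C φ 0 * f 0 with hc
  have hcs : ContDiff ℝ ∞ c := (hC 0).mul contDiff_const
  have hc1 : ContDiff ℝ ∞ (deriv c) := (contDiff_infty_iff_deriv.1 hcs).2
  have hc2 : ContDiff ℝ ∞ (deriv (deriv c)) := (contDiff_infty_iff_deriv.1 hc1).2
  have hCc : ∀ φ y, C φ y * f y = c φ := fun φ y =>
    eq_of_deriv_zero (f := fun y => C φ y * f y) (fun y => by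
      refine ((hC' φ y).hasDerivAt.fun_mul (hfd y)).congr_deriv ?_
      linear_combination e₄ φ y) y 0
  have hc' : ∀ φ y, f y * deriv (fun t => C t y) φ = deriv c φ := fun φ y => by
    have h1 : HasDerivAt (fun t => C t y * f y) (deriv (fun t => C t y) φ * f y) φ :=
      ((hC y).differentiable (by simp) φ).hasDerivAt.mul_const (f y)
    rw [show (fun t => C t y * f y) = c from funext fun t => hCc t y] at h1
    rw [h1.deriv]
    ring
  -- With r = f^(-1/2) and its primitive L, the PQ² equation is linear in B along y. Its integral is
  -- 2B = r (m(φ) - c'(φ) L).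
  set m : ℝ → ℝ := fun φ => 2 * B φ 0 * √(f 0) with hm
  have hms : ContDiff ℝ ∞ m := (contDiff_const.mul (hB 0)).mul contDiff_const
  have hm1 : ContDiff ℝ ∞ (deriv m) := (contDiff_infty_iff_deriv.1 hms).2
  have hBm : ∀ φ y, 2 * B φ y = r y * (m φ - deriv c φ * L y) := fun φ y => by
    have h1 : ∀ y, HasDerivAt (fun y => 2 * B φ y * √(f y) + deriv c φ * L y) 0 y := fun y => by
      refine ((((hB' φ y).hasDerivAt.const_mul 2).fun_mul ((hfd y).sqrt (hpos y).ne')).add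
        ((hLd y).const_mul (deriv c φ))).congr_deriv ?_
      have h2 := (hsp y).ne'
      simp only [hr]
      field_simp
      rw [hsq]
      linear_combination e₃ φ y - hc' φ y
    have h2 := eq_of_deriv_zero h1 y 0
    simp only [hL0, mul_zero, add_zero] at h2
    have h3 : r y * √(f y) = 1 := inv_mul_cancel₀ (hsp y).ne'
    linear_combination r y * h2 - 2 * B φ y * h3
  have hmd : ∀ φ, HasDerivAt m (deriv m φ) φ := fun φ =>
    (hms.differentiable (by simp) φ).hasDerivAt
  have hm1d : ∀ φ, HasDerivAt (deriv m) (deriv (deriv m) φ) φ := fun φ =>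
    (hm1.differentiable (by simp) φ).hasDerivAt
  have hc1d : ∀ φ, HasDerivAt (deriv c) (deriv (deriv c) φ) φ := fun φ =>
    (hc1.differentiable (by simp) φ).hasDerivAt
  have hc2d : ∀ φ, HasDerivAt (deriv (deriv c)) (deriv (deriv (deriv c)) φ) φ := fun φ =>
    (hc2.differentiable (by simp) φ).hasDerivAt
  have hBφ : ∀ φ y, 2 * deriv (fun t => B t y) φ = r y * (deriv m φ - deriv (deriv c) φ * L y) :=
    fun φ y => by
      have h1 := ((hB y).differentiable (by simp) φ).hasDerivAt.const_mul 2
      have h2 := (((hmd φ).sub ((hc1d φ).mul_const (L y))).const_mul (r y))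
      exact h1.unique (h2.congr_of_eventuallyEq (Filter.Eventually.of_forall fun t => hBm t y))
  have hBy : ∀ φ y, 2 * deriv (B φ) y = deriv r y * (m φ - deriv c φ * L y) -
      deriv c φ * r y ^ 2 := fun φ y => by
    have h1 := (hB' φ y).hasDerivAt.const_mul 2
    have h2 := (hrdiff y).hasDerivAt.fun_mul (((hLd y).const_mul (deriv c φ)).const_sub (m φ))
    rw [h1.unique (h2.congr_of_eventuallyEq (Filter.Eventually.of_forall fun t => hBm φ t))]
    ring
  -- A - C and 2B satisfy equations of Cauchy–Riemann type, the trace-free part of the Killing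
  -- equations. Integrating this one in y and comparing with the other leaves the single condition
  -- `hmain`.
  have hXy : ∀ φ y, deriv (A φ) y - deriv (C φ) y = -(2 * deriv (fun t => B t y) φ) := fun φ y => by
    have h1 : f y * (deriv (A φ) y - deriv (C φ) y) = f y * -(2 * deriv (fun t => B t y) φ) := by
      linear_combination e₂ φ y - e₄ φ y
    exact mul_left_cancel₀ (hpos y).ne' h1
  have hXφ : ∀ φ y, deriv (fun t => A t y) φ - deriv (fun t => C t y) φ = 2 * deriv (B φ) y :=
    fun φ y => by
      have h1 : f y * (deriv (fun t => A t y) φ - deriv (fun t => C t y) φ) =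
          f y * (2 * deriv (B φ) y) := by
        linear_combination e₁ φ y - e₃ φ y
      exact mul_left_cancel₀ (hpos y).ne' h1
  have hX : ∀ φ y, A φ y - C φ y = A φ 0 - C φ 0 - deriv m φ * L y +
      deriv (deriv c) φ * (L y ^ 2 / 2) := fun φ y => by
    have h1 : ∀ y, HasDerivAt (fun y => A φ y - C φ y + deriv m φ * L y -
        deriv (deriv c) φ * (L y ^ 2 / 2)) 0 y := fun y => by
      refine ((((hA' φ y).hasDerivAt.sub (hC' φ y).hasDerivAt).add
        ((hLd y).const_mul (deriv m φ))).sub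
        ((((hLd y).fun_pow 2).div_const 2).const_mul (deriv (deriv c) φ))).congr_deriv ?_
      norm_num
      linear_combination hXy φ y - hBφ φ y
    have h2 := eq_of_deriv_zero h1 y 0
    simp only [hL0] at h2
    linear_combination h2
  have hmain : ∀ φ y, -(deriv c φ * r 0 ^ 2) - deriv (deriv m) φ * L y +
      deriv (deriv (deriv c)) φ * (L y ^ 2 / 2) =
      deriv r y * (m φ - deriv c φ * L y) - deriv c φ * r y ^ 2 := fun φ y => by
    have hAd : ∀ y, HasDerivAt (fun t => A t y) (deriv (fun t => A t y) φ) φ := fun y =>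
      ((hA y).differentiable (by simp) φ).hasDerivAt
    have hCd : ∀ y, HasDerivAt (fun t => C t y) (deriv (fun t => C t y) φ) φ := fun y =>
      ((hC y).differentiable (by simp) φ).hasDerivAt
    have h1 := ((hAd y).sub (hCd y)).unique (((((hAd 0).sub (hCd 0)).sub
      ((hm1d φ).mul_const (L y))).add ((hc2d φ).mul_const (L y ^ 2 / 2))).congr_of_eventuallyEq
        (Filter.Eventually.of_forall fun t => hX t y))
    rw [hXφ, hXφ, hBy, hBy, hr0, hL0] at h1
    linear_combination -h1
  -- Evenness of f enters here: r is even while L and r' are odd, so the condition splits by parity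
  -- in y into one for `m` and one for `c'`.
  have hodd : ∀ φ y, deriv r y * m φ = -(deriv (deriv m) φ * L y) := fun φ y => by
    have h1 := hmain φ y
    have h2 := hmain φ (-y)
    rw [hrodd, hLodd, hreven] at h2
    linear_combination (h2 - h1) / 2
  have hevn : ∀ φ y, deriv c φ * (deriv r y * L y + r y ^ 2) =
      deriv c φ * r 0 ^ 2 - deriv (deriv (deriv c)) φ * (L y ^ 2 / 2) := fun φ y => by
    linear_combination hodd φ y + hmain φ y
  have hfin : (∃ κ, ∀ y, deriv r y ^ 2 = κ * (r y ^ 2 - r 0 ^ 2)) →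
      ∃ κ, ∀ y, deriv f y ^ 2 = 4 * κ * f y ^ 2 * (1 - f y / f 0) := by
    rintro ⟨κ, hκ⟩
    refine ⟨κ, fun y => ?_⟩
    have h1 := hκ y
    have h2 := (hsp y).ne'
    have h3 : r y ^ 2 = 1 / f y := by rw [eq_div_iff (hpos y).ne', hr2]
    have h4 : r 0 ^ 2 = 1 / f 0 := by rw [eq_div_iff (hpos 0).ne', hr2]
    have h5 : deriv r y ^ 2 * (4 * f y ^ 3) = deriv f y ^ 2 := by
      have h6 : f y ^ 3 = (√(f y) ^ 2) ^ 3 := by rw [hsq]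
      rw [(hrd y).deriv, h6]
      field_simp
      ring
    rw [h3, h4] at h1
    rw [← h5, h1]
    have h6 := (hpos y).ne'
    have h7 := (hpos 0).ne'
    field_simp
  -- If `m` or `c'` is nonzero at a single φ, dividing by it gives an equation for r alone, hence
  -- for f. Otherwise B = 0 and both C f and A - C are constant.
  by_cases hm0 : ∃ φ, m φ ≠ 0
  · obtain ⟨φ, hφ⟩ := hm0
    refine Or.inl (hfin ⟨-(deriv (deriv m) φ / m φ), sq_deriv_of_linear hrdiff hLd hL0 fun y => ?_⟩)
    have h1 := hodd φ y
    field_simp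
    linear_combination h1
  by_cases hc0 : ∃ φ, deriv c φ ≠ 0
  · obtain ⟨φ, hφ⟩ := hc0
    refine Or.inl (hfin ⟨-(deriv (deriv (deriv c)) φ / deriv c φ) / 4,
      sq_deriv_of_quadratic hrdiff hrpos hLd hL0 fun y => ?_⟩)
    have h1 := hevn φ y
    field_simp
    linear_combination 2 * h1
  push Not at hm0 hc0
  right
  have hcc : ∀ φ, c φ = c 0 := fun φ =>
    is_const_of_deriv_eq_zero (hcs.differentiable (by simp)) hc0 φ 0
  have hB0 : ∀ φ y, B φ y = 0 := fun φ y => by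
    have h1 := hBm φ y
    rw [hm0, hc0] at h1
    linarith
  have hm0' : deriv m = 0 := by
    rw [show m = fun _ => 0 from funext hm0]
    funext φ
    simp
  have hc0' : deriv (deriv c) = 0 := by
    rw [show deriv c = fun _ => 0 from funext hc0]
    funext φ
    simp
  have hXc : ∀ φ, A φ 0 - C φ 0 = A 0 0 - C 0 0 := fun φ => by
    refine eq_of_deriv_zero (f := fun φ => A φ 0 - C φ 0) (fun φ => ?_) φ 0
    have h1 := ((hA 0).differentiable (by simp) φ).hasDerivAt.sub
      ((hC 0).differentiable (by simp) φ).hasDerivAt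
    refine h1.congr_deriv ?_
    rw [hXφ, hBy, hc0, hm0]
    ring
  refine ⟨A 0 0 - C 0 0, c 0, fun φ y => ?_⟩
  have hCv : C φ y = c 0 / f y := by
    rw [eq_div_iff (hpos y).ne', hCc, hcc]
  refine ⟨?_, hB0 φ y, hCv⟩
  have h1 := hX φ y
  rw [hm0', hc0', hXc] at h1
  simp only [Pi.zero_apply] at h1
  rw [← hCv]
  linear_combination h1

end KillingTensors

/-! ### The conformal factor of H_p is not of the exceptional type. -/

section ConformalFactor

variable {a p ε : ℝ} {S : ConservativeSystem 2 S2}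

theorem Admissible.gt (h : Admissible a p) : -2 < a := by
  rcases h with h | h <;> linarith [h.1]

theorem Admissible.ne_two (h : Admissible a p) : a ≠ 2 := by
  rcases h with ⟨h, -⟩ | ⟨-, h, -⟩
  · exact h.ne'
  · exact h.ne

theorem Admissible.one_add_ne_zero (h : Admissible a p) : 1 + p ≠ 0 := by
  rcases h with ⟨h, h1 | h1⟩ | ⟨h, h2, h1 | h1⟩ <;> intro h0 <;> linarith

theorem Admissible.add_ne_zero (h : Admissible a p) : a + 2 * p ≠ 0 := by
  rcases h with ⟨h, h1 | h1⟩ | ⟨h, h2, h1 | h1⟩ <;> intro h0 <;> linarith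

theorem hpFactor_eq (y : ℝ) : hpFactor a p y = hpGap a p y / coordSpeed a y ^ 2 := rfl

theorem hpPotential_eq (y : ℝ) :
    hpPotential a p y = -(invCoord a y * hpSlope a y / (2 * hpGap a p y)) := rfl

theorem contDiff_hpGap (ha : -2 < a) : ContDiff ℝ ∞ (hpGap a p) :=
  (((contDiff_coordSpeed ha).pow 2).sub ((contDiff_invCoord ha).pow 2)).add contDiff_const

theorem contDiff_hpSlope (ha : -2 < a) : ContDiff ℝ ∞ (hpSlope a) :=
  (contDiff_const.add (contDiff_const.mul ((contDiff_invCoord ha).pow 2))).sub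
    (contDiff_const.mul ((contDiff_coordSpeed ha).pow 2))

theorem contDiff_hpFactor (ha : -2 < a) : ContDiff ℝ ∞ (hpFactor a p) :=
  (contDiff_hpGap ha).div ((contDiff_coordSpeed ha).pow 2)
    fun y => (pow_pos (coordSpeed_pos ha y) 2).ne'

theorem IsPolarHp.contDiff_hpPotential (h : IsPolarHp a p ε S) : ContDiff ℝ ∞ (hpPotential a p) :=
  (((contDiff_invCoord h.gt).mul (contDiff_hpSlope h.gt)).div
    (contDiff_const.mul (contDiff_hpGap h.gt))
      fun y => mul_ne_zero two_ne_zero (h.hpGap_ne_zero y)).neg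

theorem hpFactor_neg (ha : -2 < a) (y : ℝ) : hpFactor a p (-y) = hpFactor a p y := by
  rw [hpFactor, hpFactor, coordSpeed_neg ha, invCoord_neg ha, neg_sq]

theorem hpGap_zero (ha : -2 < a) : hpGap a p 0 = 1 + p := by
  rw [hpGap, coordSpeed_zero ha, invCoord_zero ha]; ring

theorem hpPotential_zero (ha : -2 < a) : hpPotential a p 0 = 0 := by
  rw [hpPotential, invCoord_zero ha]; simp

/-- The product of a + 2u² - 2√A with its conjugate is a² - 4, which vanishes only at a = ±2. -/
theorem hpSlope_ne_zero (ha : -2 < a) (ha2 : a ≠ 2) (y : ℝ) : hpSlope a y ≠ 0 := by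
  intro h
  have h4 := coordSpeed_pow_four ha y
  rw [hpSlope] at h
  have h1 : (a - 2) * (a + 2) = 0 := by
    linear_combination (a + 2 * invCoord a y ^ 2 + 2 * coordSpeed a y ^ 2) * h + 4 * h4
  rcases mul_eq_zero.1 h1 with h2 | h2
  · exact ha2 (by linarith)
  · linarith

theorem hasDerivAt_hpFactor (ha : -2 < a) (y : ℝ) : HasDerivAt (hpFactor a p)
    (-(invCoord a y * (2 + p * a + (a + 2 * p) * invCoord a y ^ 2)) / coordSpeed a y ^ 5) y := by
  have hw := (coordSpeed_pos ha y).ne'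
  have h4 := coordSpeed_pow_four ha y
  have h := (hasDerivAt_hpGap (p := p) ha y).fun_div ((hasDerivAt_coordSpeed_slope ha y).fun_pow 2)
    (pow_ne_zero 2 hw)
  refine h.congr_deriv ?_
  norm_num
  rw [hpGap, hpSlope]
  field_simp
  linear_combination (-2 * invCoord a y) * h4

/-- The conformal factor of `H_p` does not satisfy the equation of a surface with additional Killing
tensors. -/
theorem IsPolarHp.not_exists_killing (h : IsPolarHp a p ε S) (hadm : Admissible a p) :
    ¬ ∃ κ, ∀ y, deriv (fun y => ε * hpFactor a p y) y ^ 2 =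
      4 * κ * (ε * hpFactor a p y) ^ 2 * (1 - ε * hpFactor a p y / (ε * hpFactor a p 0)) := by
  rintro ⟨κ, hκ⟩
  have ha := h.gt
  have ha2 := hadm.ne_two
  have hp1 := hadm.one_add_ne_zero
  have hε : ε ≠ 0 := left_ne_zero_of_mul (h.hpGap_pos 0).ne'
  -- The equation becomes algebraic in x = U² and q = w², with q² = 1 + ax + x².
  have hx : ∀ y, invCoord a y ^ 2 * (1 + p) *
      (2 + p * a + (a + 2 * p) * invCoord a y ^ 2) ^ 2 =
      4 * κ * coordSpeed a y ^ 4 * hpGap a p y ^ 2 *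
        (p * (coordSpeed a y ^ 2 - 1) + invCoord a y ^ 2) := by
    intro y
    have h1 := hκ y
    have hw := (coordSpeed_pos ha y).ne'
    rw [((hasDerivAt_hpFactor (p := p) ha y).const_mul ε).deriv, hpFactor_eq, hpFactor_eq,
      hpGap_zero ha, coordSpeed_zero ha] at h1
    have h2 : p * (coordSpeed a y ^ 2 - 1) + invCoord a y ^ 2 =
        coordSpeed a y ^ 2 * (1 + p) - hpGap a p y := by rw [hpGap]; ring
    rw [h2]
    field_simp at h1
    linear_combination h1
  -- The conic q² = 1 + ax + x² is parametrized by the lines q = 1 + tx through (0, 1), that is x =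
  -- (a - 2t)/(t² - 1). Clearing denominators turns the equation into p₁(t) = p₂(t).
  set p₁ : Polynomial ℝ := Polynomial.C (1 + p) * (Polynomial.X + 1) ^ 2 *
    (Polynomial.C (2 + p * a) * (Polynomial.X ^ 2 - 1) +
      Polynomial.C (a + 2 * p) * (Polynomial.C a - 2 * Polynomial.X)) ^ 2 with hp₁
  set p₂ : Polynomial ℝ := Polynomial.C (4 * κ) *
    (Polynomial.C a * Polynomial.X - Polynomial.X ^ 2 - 1) ^ 2 *
    (Polynomial.C (1 + p) * (Polynomial.X + 1) + Polynomial.C a - 2 * Polynomial.X) ^ 2 *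
    (Polynomial.C p * Polynomial.X + 1) with hp₂
  have he1 : ∀ t, p₁.eval t = (1 + p) * (t + 1) ^ 2 *
      ((2 + p * a) * (t ^ 2 - 1) + (a + 2 * p) * (a - 2 * t)) ^ 2 := fun t => by simp [hp₁]
  have he2 : ∀ t, p₂.eval t = 4 * κ * (a * t - t ^ 2 - 1) ^ 2 *
      ((1 + p) * (t + 1) + a - 2 * t) ^ 2 * (p * t + 1) := fun t => by simp [hp₂]
  have hkey : ∀ t, 0 < (a - 2 * t) / (t ^ 2 - 1) → 0 < 1 + (a - 2 * t) / (t ^ 2 - 1) * t →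
      t + 1 ≠ 0 → p₁.eval t = p₂.eval t := by
    intro t hxp hqp ht1
    have hδ : t ^ 2 - 1 ≠ 0 := fun h0 => by rw [h0, div_zero] at hxp; exact hxp.false
    set x := (a - 2 * t) / (t ^ 2 - 1) with hxdef
    obtain ⟨y, hy⟩ : ∃ y, invCoord a y = √x := ⟨_, invCoord_conformalCoord ha _⟩
    have hU : invCoord a y ^ 2 = x := by rw [hy, Real.sq_sqrt hxp.le]
    have h4 := coordSpeed_pow_four ha y
    have hU4 : invCoord a y ^ 4 = x ^ 2 := by rw [← hU]; ring
    have hxt : x * (t ^ 2 - 1) = a - 2 * t := div_mul_cancel₀ _ hδ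
    have hq : coordSpeed a y ^ 2 = 1 + x * t := by
      have h5 : (coordSpeed a y ^ 2) ^ 2 = (1 + x * t) ^ 2 := by
        rw [hU, hU4] at h4
        linear_combination h4 - x * hxt
      exact (pow_left_inj₀ (sq_nonneg _) hqp.le two_ne_zero).1 h5
    have h6 := hx y
    have hq4 : coordSpeed a y ^ 4 = (1 + x * t) ^ 2 := by rw [← hq]; ring
    rw [hpGap, hq4, hU, hq] at h6
    have h7 : (1 + p) * (2 + p * a + (a + 2 * p) * x) ^ 2 =
        4 * κ * (1 + x * t) ^ 2 * (1 + x * t - x + p) ^ 2 * (p * t + 1) := by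
      refine mul_left_cancel₀ hxp.ne' ?_
      linear_combination h6
    have h8 : (2 + p * a) * (t ^ 2 - 1) + (a + 2 * p) * (a - 2 * t) =
        (t ^ 2 - 1) * (2 + p * a + (a + 2 * p) * x) := by rw [← hxt]; ring
    have h9 : a * t - t ^ 2 - 1 = (t ^ 2 - 1) * (1 + x * t) := by
      linear_combination (-t) * hxt
    have h10 : (1 + p) * (t + 1) + a - 2 * t = (t + 1) * (1 + x * t - x + p) := by
      linear_combination -hxt
    rw [he1, he2, h8, h9, h10]
    linear_combination ((t + 1) ^ 2 * (t ^ 2 - 1) ^ 2) * h7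
  -- Every t strictly between 1 and a/2 gives x > 0 and q > 0, hence an actual point y. Agreement on
  -- this interval forces equality of the polynomials.
  have heq : p₁ = p₂ := by
    apply Polynomial.eq_of_infinite_eval_eq
    rcases lt_or_gt_of_ne ha2 with hlt | hgt
    · refine (Set.Ioo_infinite (show a / 2 < 1 by linarith)).mono fun t ht => ?_
      have h1 : t ^ 2 - 1 < 0 := by nlinarith [ht.1, ht.2]
      have h2 : a - 2 * t < 0 := by linarith [ht.1]
      refine hkey t (div_pos_of_neg_of_neg h2 h1) ?_ (by linarith [ht.1])
      have h3 : 1 + (a - 2 * t) / (t ^ 2 - 1) * t = (a * t - t ^ 2 - 1) / (t ^ 2 - 1) := by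
        have := h1.ne
        field_simp
        ring
      rw [h3]
      exact div_pos_of_neg_of_neg (by nlinarith [sq_nonneg (t - a / 2)]) h1
    · refine (Set.Ioo_infinite (show 1 < a / 2 by linarith)).mono fun t ht => ?_
      have h1 : 0 < t ^ 2 - 1 := by nlinarith [ht.1, ht.2]
      have h2 : 0 < a - 2 * t := by linarith [ht.2]
      have h3 : 0 < t := by linarith [ht.1]
      exact hkey t (div_pos h2 h1) (by positivity) (by linarith)
  have hev : ∀ t, (1 + p) * (t + 1) ^ 2 *
      ((2 + p * a) * (t ^ 2 - 1) + (a + 2 * p) * (a - 2 * t)) ^ 2 =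
      4 * κ * (a * t - t ^ 2 - 1) ^ 2 * ((1 + p) * (t + 1) + a - 2 * t) ^ 2 * (p * t + 1) :=
    fun t => by rw [← he1, ← he2, heq]
  have hd : (a - 2) ≠ 0 := sub_ne_zero.2 ha2
  -- Evaluation at t = 1, t = -1 and t = a/2 gives successively κ = 1, p = 1 and (a + 2)⁵(a - 2)³ =
  -- 0.
  have hκ1 : κ = 1 := by
    have h1 := hev 1
    have h2 : (4 * (1 + p) * (a + 2 * p) ^ 2 * (a - 2) ^ 2) * κ =
        (4 * (1 + p) * (a + 2 * p) ^ 2 * (a - 2) ^ 2) * 1 := by linear_combination -h1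
    exact mul_left_cancel₀ (mul_ne_zero (mul_ne_zero (mul_ne_zero four_ne_zero hp1)
      (pow_ne_zero 2 hadm.add_ne_zero)) (pow_ne_zero 2 hd)) h2
  subst hκ1
  have hp : p = 1 := by
    have h1 := hev (-1)
    have h2 : (a + 2) ^ 4 * (p - 1) = 0 := by linear_combination h1 / 4
    have h3 := (mul_eq_zero.1 h2).resolve_left (pow_ne_zero 4 (by linarith))
    linarith
  subst hp
  have h1 := hev (a / 2)
  have h2 : (a + 2) ^ 5 * (a - 2) ^ 3 = 0 := by linear_combination 32 * h1
  rcases mul_eq_zero.1 h2 with h3 | h3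
  · exact absurd h3 (pow_ne_zero 5 (by linarith))
  · exact pow_ne_zero 3 hd h3

end ConformalFactor

/-! ### No integrals of degree one or two. -/

section QuadraticIntegrals

theorem contDiff_slice_fst {G : E2 × E2 → ℝ} (hG : ContDiff ℝ ∞ G) (y P Q : ℝ) :
    ContDiff ℝ ∞ fun t : ℝ => G (!₂[t, y], !₂[P, Q]) := by
  have h1 : ContDiff ℝ ∞ fun t : ℝ => (!₂[t, y] : E2) := by
    rw [contDiff_euclidean]
    intro i
    fin_cases i
    · exact contDiff_id
    · exact contDiff_const
  exact hG.comp (h1.prodMk contDiff_const)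

theorem contDiff_slice_snd {G : E2 × E2 → ℝ} (hG : ContDiff ℝ ∞ G) (φ P Q : ℝ) :
    ContDiff ℝ ∞ fun t : ℝ => G (!₂[φ, t], !₂[P, Q]) := by
  have h1 : ContDiff ℝ ∞ fun t : ℝ => (!₂[φ, t] : E2) := by
    rw [contDiff_euclidean]
    intro i
    fin_cases i
    · exact contDiff_const
    · exact contDiff_id
  exact hG.comp (h1.prodMk contDiff_const)

/-- An integral of `(P² + Q²) / (2 f) + W cos φ` that is an even polynomial of degree two in the
momenta. -/
theorem even_integral_of_degree_two {f W : ℝ → ℝ} (hf : ContDiff ℝ ∞ f) (hpos : ∀ y, 0 < f y)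
    (heven : ∀ y, f (-y) = f y) (hW : Differentiable ℝ W) (hW0 : W 0 = 0)
    (hκ : ¬ ∃ κ, ∀ y, deriv f y ^ 2 = 4 * κ * f y ^ 2 * (1 - f y / f 0))
    {G H : E2 × E2 → ℝ} (hG : ContDiff ℝ ∞ G) (hH : ContDiff ℝ ∞ H)
    (hHe : ∀ φ y P Q, H (!₂[φ, y], !₂[P, Q]) = (P ^ 2 + Q ^ 2) / (2 * f y) + W y * Real.cos φ)
    (hquad : ∀ z : E2, ∃ α β γ δ : ℝ, ∀ P Q : ℝ,
      G (z, !₂[P, Q]) = α * P ^ 2 + β * (P * Q) + γ * Q ^ 2 + δ)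
    (hbr : ∀ w, poissonBracket G H w = 0) :
    ∃ b c d : ℝ, (∀ w, G w = c * w.2 0 ^ 2 + b * H w + d) ∧ ∀ y, c * W y = 0 := by
  -- The coefficients are recovered as finite differences of G in the momenta; this makes their
  -- smoothness in the position immediate.
  set A : ℝ → ℝ → ℝ := fun φ y => G (!₂[φ, y], !₂[1, 0]) - G (!₂[φ, y], !₂[0, 0]) with hA
  set B : ℝ → ℝ → ℝ := fun φ y =>
    (G (!₂[φ, y], !₂[1, 1]) - G (!₂[φ, y], !₂[1, -1])) / 4 with hB
  set C : ℝ → ℝ → ℝ := fun φ y => G (!₂[φ, y], !₂[0, 1]) - G (!₂[φ, y], !₂[0, 0]) with hC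
  set D : ℝ → ℝ → ℝ := fun φ y => G (!₂[φ, y], !₂[0, 0]) with hD
  have hGe : ∀ φ y P Q, G (!₂[φ, y], !₂[P, Q]) =
      A φ y * P ^ 2 + 2 * B φ y * (P * Q) + C φ y * Q ^ 2 + D φ y := fun φ y P Q => by
    obtain ⟨α, β, γ, δ, h⟩ := hquad !₂[φ, y]
    simp only [hA, hB, hC, hD, h]
    ring
  have hAφ : ∀ y, ContDiff ℝ ∞ fun φ => A φ y := fun y =>
    (contDiff_slice_fst hG y 1 0).sub (contDiff_slice_fst hG y 0 0)
  have hBφ : ∀ y, ContDiff ℝ ∞ fun φ => B φ y := fun y =>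
    ((contDiff_slice_fst hG y 1 1).sub (contDiff_slice_fst hG y 1 (-1))).div_const 4
  have hCφ : ∀ y, ContDiff ℝ ∞ fun φ => C φ y := fun y =>
    (contDiff_slice_fst hG y 0 1).sub (contDiff_slice_fst hG y 0 0)
  have hDφ : ∀ y, ContDiff ℝ ∞ fun φ => D φ y := fun y => contDiff_slice_fst hG y 0 0
  have hAy : ∀ φ, Differentiable ℝ (A φ) := fun φ =>
    ((contDiff_slice_snd hG φ 1 0).sub (contDiff_slice_snd hG φ 0 0)).differentiable (by simp)
  have hBy : ∀ φ, Differentiable ℝ (B φ) := fun φ =>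
    (((contDiff_slice_snd hG φ 1 1).sub (contDiff_slice_snd hG φ 1 (-1))).div_const
      4).differentiable (by simp)
  have hCy : ∀ φ, Differentiable ℝ (C φ) := fun φ =>
    ((contDiff_slice_snd hG φ 0 1).sub (contDiff_slice_snd hG φ 0 0)).differentiable (by simp)
  have hDy : ∀ φ, Differentiable ℝ (D φ) := fun φ =>
    (contDiff_slice_snd hG φ 0 0).differentiable (by simp)
  have hφd : ∀ {K : ℝ → ℝ → ℝ}, (∀ y, ContDiff ℝ ∞ fun φ => K φ y) → ∀ φ y,
      HasDerivAt (fun t => K t y) (deriv (fun t => K t y) φ) φ := fun hK φ y =>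
    ((hK y).differentiable (by simp) φ).hasDerivAt
  have hbrk : ∀ φ y P Q : ℝ,
      (deriv (fun t => A t y) φ * P ^ 2 + 2 * deriv (fun t => B t y) φ * (P * Q) +
        deriv (fun t => C t y) φ * Q ^ 2 + deriv (fun t => D t y) φ) * (P / f y) +
      (2 * A φ y * P + 2 * B φ y * Q) * (W y * Real.sin φ) +
      (deriv (A φ) y * P ^ 2 + 2 * deriv (B φ) y * (P * Q) + deriv (C φ) y * Q ^ 2 +
        deriv (D φ) y) * (Q / f y) -
      (2 * B φ y * P + 2 * C φ y * Q) *
        (-((P ^ 2 + Q ^ 2) * deriv f y) / (2 * f y ^ 2) + deriv W y * Real.cos φ) = 0 := by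
    intro φ y P Q
    have hf0 := (hpos y).ne'
    have hG1 : HasDerivAt (fun t => G (!₂[t, y], !₂[P, Q])) _ φ :=
      ((((((hφd hAφ φ y).mul_const (P ^ 2)).add (((hφd hBφ φ y).const_mul 2).mul_const
        (P * Q))).add ((hφd hCφ φ y).mul_const (Q ^ 2))).add (hφd hDφ φ y))).congr_of_eventuallyEq
        (Filter.Eventually.of_forall fun t => hGe t y P Q)
    have hG2 : HasDerivAt (fun t => G (!₂[φ, t], !₂[P, Q])) _ y :=
      (((((hAy φ y).hasDerivAt.mul_const (P ^ 2)).add (((hBy φ y).hasDerivAt.const_mul 2).mul_const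
        (P * Q))).add ((hCy φ y).hasDerivAt.mul_const (Q ^ 2))).add
        (hDy φ y).hasDerivAt).congr_of_eventuallyEq
        (Filter.Eventually.of_forall fun t => hGe φ t P Q)
    have hG3 : HasDerivAt (fun t => G (!₂[φ, y], !₂[t, Q])) _ P :=
      ((((((hasDerivAt_id' P).fun_pow 2).const_mul (A φ y)).add
        (((hasDerivAt_id' P).mul_const Q).const_mul (2 * B φ y))).add_const
        (C φ y * Q ^ 2)).add_const (D φ y)).congr_of_eventuallyEq
        (Filter.Eventually.of_forall fun t => hGe φ y t Q)
    have hG4 : HasDerivAt (fun t => G (!₂[φ, y], !₂[P, t])) _ Q :=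
      (((((hasDerivAt_id' Q).const_mul P).const_mul (2 * B φ y)).const_add (A φ y * P ^ 2)).add
        (((hasDerivAt_id' Q).fun_pow 2).const_mul (C φ y))).add_const (D φ y)
        |>.congr_of_eventuallyEq (Filter.Eventually.of_forall fun t => hGe φ y P t)
    have hH1 : HasDerivAt (fun t => H (!₂[t, y], !₂[P, Q])) _ φ :=
      (((Real.hasDerivAt_cos φ).const_mul (W y)).const_add
        ((P ^ 2 + Q ^ 2) / (2 * f y))).congr_of_eventuallyEq
        (Filter.Eventually.of_forall fun t => hHe t y P Q)
    have hH2 : HasDerivAt (fun t => H (!₂[φ, t], !₂[P, Q])) _ y :=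
      (((hasDerivAt_const y (P ^ 2 + Q ^ 2)).fun_div
        ((hf.differentiable (by simp) y).hasDerivAt.const_mul 2)
        (mul_ne_zero two_ne_zero hf0)).add ((hW y).hasDerivAt.mul_const
        (Real.cos φ))).congr_of_eventuallyEq (Filter.Eventually.of_forall fun t => hHe φ t P Q)
    have hH3 : HasDerivAt (fun t => H (!₂[φ, y], !₂[t, Q])) _ P :=
      (((((hasDerivAt_id' P).fun_pow 2).add_const (Q ^ 2)).div_const (2 * f y)).add_const
        (W y * Real.cos φ)).congr_of_eventuallyEq
        (Filter.Eventually.of_forall fun t => hHe φ y t Q)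
    have hH4 : HasDerivAt (fun t => H (!₂[φ, y], !₂[P, t])) _ Q :=
      (((((hasDerivAt_id' Q).fun_pow 2).const_add (P ^ 2)).div_const (2 * f y)).add_const
        (W y * Real.cos φ)).congr_of_eventuallyEq
        (Filter.Eventually.of_forall fun t => hHe φ y P t)
    have h := hbr (!₂[φ, y], !₂[P, Q])
    rw [poissonBracket_eq_of_hasDerivAt (hG.differentiable (by simp) _)
      (hH.differentiable (by simp) _) hG1 hG2 hG3 hG4 hH1 hH2 hH3 hH4] at h
    rw [← h]
    norm_num
    field_simp
    ring
  have hall : ∀ φ y,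
      f y * deriv (fun t => A t y) φ + B φ y * deriv f y = 0 ∧
      f y * (2 * deriv (fun t => B t y) φ + deriv (A φ) y) + C φ y * deriv f y = 0 ∧
      f y * (deriv (fun t => C t y) φ + 2 * deriv (B φ) y) + B φ y * deriv f y = 0 ∧
      f y * deriv (C φ) y + C φ y * deriv f y = 0 ∧
      deriv (fun t => D t y) φ + 2 * A φ y * W y * Real.sin φ * f y -
        2 * B φ y * deriv W y * Real.cos φ * f y = 0 ∧
      deriv (D φ) y + 2 * B φ y * W y * Real.sin φ * f y -
        2 * C φ y * deriv W y * Real.cos φ * f y = 0 := by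
    intro φ y
    have hf0 := (hpos y).ne'
    have k1 := hbrk φ y 1 0
    have k2 := hbrk φ y 2 0
    have k3 := hbrk φ y 0 1
    have k4 := hbrk φ y 0 2
    have k5 := hbrk φ y 1 1
    have k6 := hbrk φ y 1 (-1)
    generalize deriv (fun t => A t y) φ = a1 at *
    generalize deriv (fun t => B t y) φ = b1 at *
    generalize deriv (fun t => C t y) φ = c1 at *
    generalize deriv (fun t => D t y) φ = d1 at *
    generalize deriv (A φ) y = a2 at *
    generalize deriv (B φ) y = b2 at *
    generalize deriv (C φ) y = c2 at *
    generalize deriv (D φ) y = d2 at *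
    generalize A φ y = a0 at *
    generalize B φ y = b0 at *
    generalize C φ y = c0 at *
    generalize deriv f y = f1 at *
    generalize deriv W y = w1 at *
    generalize f y = f0 at *
    generalize W y = w0 at *
    generalize Real.sin φ = s at *
    generalize Real.cos φ = k at *
    clear hbrk hφd hDy hCy hBy hAy hDφ hCφ hBφ hAφ hGe hbr hquad hHe hκ
    field_simp at k1 k2 k3 k4 k5 k6
    refine ⟨?_, ?_, ?_, ?_, mul_left_cancel₀ hf0 ?_, mul_left_cancel₀ hf0 ?_⟩
    · linear_combination (k2 - 2 * k1) / 6
    · linear_combination (k5 - k6) / 2 - k3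
    · linear_combination (k5 + k6) / 2 - k1
    · linear_combination (k4 - 2 * k3) / 6
    · linear_combination (8 * k1 - k2) / 6
    · linear_combination (8 * k3 - k4) / 6
  rcases killing_tensor_dichotomy hf hpos heven hAφ hBφ hCφ hAy hBy hCy (fun φ y => (hall φ y).1)
    (fun φ y => (hall φ y).2.1) (fun φ y => (hall φ y).2.2.1) (fun φ y => (hall φ y).2.2.2.1)
    with h | ⟨c, b, h⟩
  · exact absurd h hκ
  have hDφe : ∀ φ y, deriv (fun t => D t y) φ = -(2 * (c * f y + b) * W y * Real.sin φ) :=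
    fun φ y => by
      have h1 := (hall φ y).2.2.2.2.1
      obtain ⟨hA1, hB1, -⟩ := h φ y
      rw [hA1, hB1] at h1
      have := (hpos y).ne'
      have h2 : (c + b / f y) * f y = c * f y + b := by field_simp
      rw [← h2]
      linear_combination h1
  have hDye : ∀ φ y, deriv (D φ) y = 2 * b * deriv W y * Real.cos φ := fun φ y => by
    have h1 := (hall φ y).2.2.2.2.2
    obtain ⟨-, hB1, hC1⟩ := h φ y
    rw [hB1, hC1] at h1
    have := (hpos y).ne'
    have h2 : b / f y * f y = b := div_mul_cancel₀ _ this
    linear_combination h1 + 2 * deriv W y * Real.cos φ * h2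
  have hDe : ∀ φ y, D φ y = D φ 0 + 2 * b * W y * Real.cos φ := fun φ y => by
    have h1 : ∀ y, HasDerivAt (fun y => D φ y - 2 * b * W y * Real.cos φ) 0 y := fun y => by
      refine ((hDy φ y).hasDerivAt.sub (((hW y).hasDerivAt.const_mul (2 * b)).mul_const
        (Real.cos φ))).congr_deriv ?_
      rw [hDye]
      ring
    have h2 := eq_of_deriv_zero h1 y 0
    simp only [hW0] at h2
    linear_combination h2
  have hD0 : ∀ φ, D φ 0 = D 0 0 := fun φ =>
    eq_of_deriv_zero (f := fun φ => D φ 0) (fun φ => by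
      have h1 := hφd hDφ φ 0
      rw [hDφe, hW0] at h1
      simpa using h1) φ 0
  -- Integrating in y gives D = const + 2bW cos φ, the constant being independent of φ because W(0)
  -- = 0. The φ equation asks for the coefficient -2(c f + b)W of sin φ instead of -2bW, and
  -- comparison at φ = π/2 leaves c f W = 0.
  have hcW : ∀ y, c * W y = 0 := fun y => by
    have h1 := hφd hDφ (Real.pi / 2) y
    rw [hDφe] at h1
    have h2 := h1.unique (((Real.hasDerivAt_cos (Real.pi / 2)).const_mul (2 * b * W y)).const_add
      (D 0 0) |>.congr_of_eventuallyEq (Filter.Eventually.of_forall fun t =>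
        (hDe t y).trans (by rw [hD0 t])))
    rw [Real.sin_pi_div_two] at h2
    have h3 : f y * (c * W y) = f y * 0 := by linear_combination (-1 / 2 : ℝ) * h2
    exact mul_left_cancel₀ (hpos y).ne' h3
  refine ⟨2 * b, c, D 0 0, fun w => ?_, hcW⟩
  obtain ⟨z, v⟩ := w
  rw [eq_vec_two z, eq_vec_two v, hGe, hHe, hDe, hD0]
  obtain ⟨hA1, hB1, hC1⟩ := h (z 0) (z 1)
  rw [hA1, hB1, hC1]
  have := (hpos (z 1)).ne'
  simp only [PiLp.toLp_apply, Matrix.cons_val_zero, Matrix.cons_val_one]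
  field_simp
  ring

theorem poissonBracket_linear_combination {f g h : E2 × E2 → ℝ} (hf : Differentiable ℝ f)
    (hg : Differentiable ℝ g) (s t : ℝ) (w : E2 × E2) :
    poissonBracket (fun w => s * f w + t * g w) h w =
      s * poissonBracket f h w + t * poissonBracket g h w := by
  have h1 : fderiv ℝ (fun w => s * f w + t * g w) w = s • fderiv ℝ f w + t • fderiv ℝ g w :=
    (((hf w).hasFDerivAt.const_mul s).add ((hg w).hasFDerivAt.const_mul t)).fderiv
  simp only [poissonBracket, h1, Fin.sum_univ_two, add_apply, smul_apply, smul_eq_mul]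
  ring

theorem poissonBracket_mul_self {f h : E2 × E2 → ℝ} (hf : Differentiable ℝ f) (w : E2 × E2) :
    poissonBracket (fun w => f w * f w) h w = 2 * f w * poissonBracket f h w := by
  have h1 : fderiv ℝ (fun w => f w * f w) w = f w • fderiv ℝ f w + f w • fderiv ℝ f w :=
    ((hf w).hasFDerivAt.mul (hf w).hasFDerivAt).fderiv
  simp only [poissonBracket, h1, Fin.sum_univ_two, add_apply, smul_apply, smul_eq_mul]
  ring

/-- Time reversal: the map p ↦ -p changes the sign of the bracket, and H is invariant under it. So
the even and odd parts in p of an integral are separately conserved. -/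
theorem poissonBracket_neg_momentum {f h : E2 × E2 → ℝ} (hf : Differentiable ℝ f)
    (hh : Differentiable ℝ h) (hhe : ∀ w : E2 × E2, h (w.1, -w.2) = h w) (w : E2 × E2) :
    poissonBracket (fun w => f (w.1, -w.2)) h w = -poissonBracket f h (w.1, -w.2) := by
  set N : E2 × E2 →L[ℝ] E2 × E2 := (ContinuousLinearMap.fst ℝ E2 E2).prod
    (-ContinuousLinearMap.snd ℝ E2 E2) with hN
  have key : ∀ {g : E2 × E2 → ℝ}, Differentiable ℝ g → ∀ v : E2 × E2,
      fderiv ℝ (fun w : E2 × E2 => g (w.1, -w.2)) w v = fderiv ℝ g (w.1, -w.2) (v.1, -v.2) :=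
    fun {g} hg v => by
      have h1 : HasFDerivAt (fun w : E2 × E2 => g (w.1, -w.2)) _ w :=
        HasFDerivAt.comp (f := N) w (hg (N w)).hasFDerivAt N.hasFDerivAt
      rw [h1.fderiv]
      rfl
  have hh' : ∀ v : E2 × E2, fderiv ℝ h w v = fderiv ℝ h (w.1, -w.2) (v.1, -v.2) := fun v => by
    rw [← key hh v, show (fun w : E2 × E2 => h (w.1, -w.2)) = h from funext hhe]
  have hneg : ∀ (g : E2 × E2 → ℝ) (v : E2), fderiv ℝ g (w.1, -w.2) (0, -v) =
      -fderiv ℝ g (w.1, -w.2) (0, v) := fun g v => by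
    rw [← map_neg, Prod.neg_mk, neg_zero]
  simp only [poissonBracket, key hf, hh', Fin.sum_univ_two, neg_zero, hneg]
  ring

theorem exists_eval_of_totalDegree_le_two (P : MvPolynomial (Fin 2) ℝ) (hP : P.totalDegree ≤ 2) :
    ∃ α β γ δ ε ζ : ℝ, ∀ x : Fin 2 → ℝ, MvPolynomial.eval x P =
      α * x 0 ^ 2 + β * (x 0 * x 1) + γ * x 1 ^ 2 + δ * x 0 + ε * x 1 + ζ := by
  have key : ∀ s : Finset (Fin 2 →₀ ℕ), (∀ d ∈ s, d 0 + d 1 ≤ 2) →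
      ∃ α β γ δ ε ζ : ℝ, ∀ x : Fin 2 → ℝ, ∑ d ∈ s, P.coeff d * ∏ i, x i ^ d i =
        α * x 0 ^ 2 + β * (x 0 * x 1) + γ * x 1 ^ 2 + δ * x 0 + ε * x 1 + ζ := by
    intro s
    induction s using Finset.induction_on with
    | empty => exact fun _ => ⟨0, 0, 0, 0, 0, 0, fun x => by simp⟩
    | insert d s hd ih =>
      intro h
      obtain ⟨α, β, γ, δ, ε, ζ, hs⟩ := ih fun d hd => h d (Finset.mem_insert_of_mem hd)
      have hdeg := h d (Finset.mem_insert_self _ _)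
      have hterm : ∃ α β γ δ ε ζ : ℝ, ∀ x : Fin 2 → ℝ, P.coeff d * ∏ i, x i ^ d i =
          α * x 0 ^ 2 + β * (x 0 * x 1) + γ * x 1 ^ 2 + δ * x 0 + ε * x 1 + ζ := by
        simp only [Fin.prod_univ_two]
        generalize P.coeff d = k
        generalize d 0 = m at *
        generalize d 1 = n at *
        have hm : m ≤ 2 := by omega
        have hn : n ≤ 2 := by omega
        interval_cases m <;> interval_cases n <;> first
          | omega
          | exact ⟨0, 0, 0, 0, 0, k, fun x => by ring1⟩
          | exact ⟨0, 0, 0, 0, k, 0, fun x => by ring1⟩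
          | exact ⟨0, 0, 0, k, 0, 0, fun x => by ring1⟩
          | exact ⟨0, 0, k, 0, 0, 0, fun x => by ring1⟩
          | exact ⟨0, k, 0, 0, 0, 0, fun x => by ring1⟩
          | exact ⟨k, 0, 0, 0, 0, 0, fun x => by ring1⟩
      obtain ⟨α', β', γ', δ', ε', ζ', ht⟩ := hterm
      refine ⟨α' + α, β' + β, γ' + γ, δ' + δ, ε' + ε, ζ' + ζ, fun x => ?_⟩
      rw [Finset.sum_insert hd, hs, ht]
      ring
  obtain ⟨α, β, γ, δ, ε, ζ, h⟩ := key P.support fun d hd => by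
    have h1 := (MvPolynomial.le_totalDegree hd).trans hP
    rwa [Finsupp.sum_fintype _ _ (fun _ => rfl), Fin.sum_univ_two] at h1
  exact ⟨α, β, γ, δ, ε, ζ, fun x => by rw [MvPolynomial.eval_eq', h]⟩

variable {a p ε : ℝ} {S : ConservativeSystem 2 S2}

theorem IsPolarHp.inPolar_hamiltonian_vec (h : IsPolarHp a p ε S) (φ y P Q : ℝ) :
    inPolar S.hamiltonian (!₂[φ, y], !₂[P, Q]) =
      (P ^ 2 + Q ^ 2) / (2 * (ε * hpFactor a p y)) + ε * hpPotential a p y * Real.cos φ := by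
  have h1 : inPolar S.hamiltonian (!₂[φ, y], !₂[P, Q]) =
    inPolar S.kinetic (!₂[φ, y], !₂[P, Q]) + S.potential (polarMap !₂[φ, y]) := rfl
  have h2 : S.potential (polarMap !₂[φ, y]) = ε * hpPotential a p y * Real.cos φ :=
    h.potential !₂[φ, y]
  have h3 : inPolar S.kinetic (!₂[φ, y], !₂[P, Q]) =
    1 / 2 * (P ^ 2 / (ε * hpFactor a p y) + Q ^ 2 / (ε * hpFactor a p y)) :=
    h.metric.inPolar_kinetic (!₂[φ, y], !₂[P, Q])
  have h4 := (h.metric.1 y).ne'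
  simp only at h4
  rw [h1, h2, h3]
  field_simp

theorem IsPolarHp.hpPotential_ne_zero (h : IsPolarHp a p ε S) (hadm : Admissible a p) {y : ℝ}
    (hy : y ≠ 0) : hpPotential a p y ≠ 0 := by
  rw [hpPotential_eq]
  exact neg_ne_zero.2 (div_ne_zero (mul_ne_zero (fun h0 => hy ((invCoord_eq_zero h.gt).1 h0))
    (hpSlope_ne_zero h.gt hadm.ne_two y)) (mul_ne_zero two_ne_zero (h.hpGap_ne_zero y)))

/-- The even part of an integral is c P² + b H + d with c W = 0, so c = 0. The square of the odd
part is again an even quadratic integral, hence of the form b'H + d'. It vanishes at zero momentum,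
where H is the nonconstant potential, so it is zero. What is left is an affine function of H. -/
theorem IsPolarHp.not_isIntegralOfDegree_two (h : IsPolarHp a p ε S) (hadm : Admissible a p)
    (F : CotangentBundle 2 S2 → ℝ) : ¬ IsIntegralOfDegree 2 F S.hamiltonian := by
  intro hF
  have hHs := S.isSmoothOnCotangent_hamiltonian
  have hGc := hF.smooth.contDiff_inPolar
  have hHc := hHs.contDiff_inPolar
  have hε : ε ≠ 0 := left_ne_zero_of_mul (h.hpGap_pos 0).ne'
  set G := inPolar F with hG
  set H := inPolar S.hamiltonian with hH
  have hbr : ∀ w, poissonBracket G H w = 0 := hF.conserved.poissonBracket_inPolar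
  have hHe : ∀ φ y P Q, H (!₂[φ, y], !₂[P, Q]) =
      (P ^ 2 + Q ^ 2) / (2 * (ε * hpFactor a p y)) + ε * hpPotential a p y * Real.cos φ :=
    h.inPolar_hamiltonian_vec
  have hHn : ∀ w : E2 × E2, H (w.1, -w.2) = H w := fun w => by
    obtain ⟨z, v⟩ := w
    have h1 : -v = !₂[-(v 0), -(v 1)] := by rw [eq_vec_two (-v)]; rfl
    simp only
    have h2 := hHe (z 0) (z 1) (v 0) (v 1)
    rw [← eq_vec_two z, ← eq_vec_two v] at h2
    rw [h1, h2, eq_vec_two z, hHe]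
    simp only [PiLp.toLp_apply, Matrix.cons_val_zero, Matrix.cons_val_one]
    ring
  have hGnc : ContDiff ℝ ∞ fun w : E2 × E2 => G (w.1, -w.2) :=
    hGc.comp (contDiff_fst.prodMk contDiff_snd.neg)
  have hbrn : ∀ w, poissonBracket (fun w : E2 × E2 => G (w.1, -w.2)) H w = 0 := fun w => by
    rw [poissonBracket_neg_momentum (hGc.differentiable (by simp)) (hHc.differentiable (by simp))
      hHn, hbr, neg_zero]
  have hform : ∀ z : E2, ∃ α β γ δ ε ζ : ℝ, ∀ P Q : ℝ, G (z, !₂[P, Q]) =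
      α * P ^ 2 + β * (P * Q) + γ * Q ^ 2 + δ * P + ε * Q + ζ := fun z => by
    obtain ⟨P, hP, hPe⟩ := hF.polynomial.inPolar z
    obtain ⟨α, β, γ, δ, ε, ζ, hx⟩ := exists_eval_of_totalDegree_le_two P hP
    exact ⟨α, β, γ, δ, ε, ζ, fun x y => (hPe _).trans (hx _)⟩
  have hneg : ∀ P Q : ℝ, -(!₂[P, Q] : E2) = !₂[-P, -Q] := fun P Q => by
    rw [eq_vec_two (-(!₂[P, Q] : E2))]; rfl
  have hf := contDiff_const.mul (contDiff_hpFactor (a := a) (p := p) h.gt) (f := fun _ => ε)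
  have hW : Differentiable ℝ fun y => ε * hpPotential a p y :=
    ((contDiff_const.mul h.contDiff_hpPotential).differentiable (by simp))
  have heven := fun y => congrArg (ε * ·) (hpFactor_neg (a := a) (p := p) h.gt y)
  have hW0 : ε * hpPotential a p 0 = 0 := by rw [hpPotential_zero h.gt, mul_zero]
  have hW1 : ε * hpPotential a p 1 ≠ 0 :=
    mul_ne_zero hε (h.hpPotential_ne_zero hadm one_ne_zero)
  set Ge : E2 × E2 → ℝ := fun w => 1 / 2 * G w + 1 / 2 * G (w.1, -w.2) with hGe
  set Go : E2 × E2 → ℝ := fun w => 1 / 2 * G w + -(1 / 2) * G (w.1, -w.2) with hGo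
  have hGec : ContDiff ℝ ∞ Ge := (contDiff_const.mul hGc).add (contDiff_const.mul hGnc)
  have hGoc : ContDiff ℝ ∞ Go := (contDiff_const.mul hGc).add (contDiff_const.mul hGnc)
  have hdG := hGc.differentiable (by simp)
  have hdGn := hGnc.differentiable (by simp)
  obtain ⟨b, c, d, he, hc⟩ := even_integral_of_degree_two hf h.metric.1 heven hW hW0
    (h.not_exists_killing hadm) hGec hHc hHe (fun z => by
      obtain ⟨α, β, γ, δ, ε, ζ, hx⟩ := hform z
      refine ⟨α, β, γ, ζ, fun P Q => ?_⟩
      simp only [hGe, hneg, hx]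
      ring) fun w => by
      rw [hGe, poissonBracket_linear_combination hdG hdGn, hbr, hbrn]
      ring
  obtain ⟨b', c', d', ho, hc'⟩ := even_integral_of_degree_two hf h.metric.1 heven hW hW0
    (h.not_exists_killing hadm) (hGoc.mul hGoc) hHc hHe (fun z => by
      obtain ⟨α, β, γ, δ, ε, ζ, hx⟩ := hform z
      refine ⟨δ ^ 2, 2 * δ * ε, ε ^ 2, 0, fun P Q => ?_⟩
      simp only [hGo, hneg, hx]
      ring) fun w => by
      rw [poissonBracket_mul_self (hGoc.differentiable (by simp)), hGo,
        poissonBracket_linear_combination hdG hdGn, hbr, hbrn]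
      ring
  have hc0 : c = 0 := (mul_eq_zero.1 (hc 1)).resolve_right hW1
  have hc0' : c' = 0 := (mul_eq_zero.1 (hc' 1)).resolve_right hW1
  have hGo0 : ∀ φ y, Go (!₂[φ, y], !₂[0, 0]) = 0 := fun φ y => by
    simp [hGo, hneg]
  -- At zero momentum H vanishes for φ = π/2, y = 0, which isolates d', and is nonzero for φ = 0, y
  -- = 1, which isolates b'.
  have hd' : d' = 0 := by
    have h1 := ho (!₂[Real.pi / 2, 0], !₂[0, 0])
    rw [hHe, hGo0, hc0'] at h1
    simpa using h1.symm
  have hb' : b' = 0 := by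
    have h1 := ho (!₂[0, 1], !₂[0, 0])
    rw [hHe, hGo0, hc0', hd'] at h1
    simp only [Real.cos_zero] at h1
    have h2 : b' * (ε * hpPotential a p 1) = 0 := by linear_combination -h1
    exact (mul_eq_zero.1 h2).resolve_right hW1
  refine not_isIndependent_of_inPolar hF.smooth hHs (b := b) (c := d) (fun w => ?_) hF.independent
  have h1 := he w
  have h2 := ho w
  rw [hb', hc0', hd'] at h2
  have h3 : Go w = 0 := by
    have h4 : Go w * Go w = 0 := by linear_combination h2
    exact mul_self_eq_zero.1 h4
  have h5 : G w = Ge w + Go w := by simp only [hGe, hGo]; ring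
  change G w = b * H w + d
  rw [h5, h3, h1, hc0]
  ring

theorem IsPolarHp.not_isIntegralOfDegree_one (h : IsPolarHp a p ε S) (hadm : Admissible a p)
    (F : CotangentBundle 2 S2 → ℝ) : ¬ IsIntegralOfDegree 1 F S.hamiltonian := fun hF =>
  h.not_isIntegralOfDegree_two hadm F
    ⟨hF.smooth, hF.conserved, hF.polynomial.mono one_le_two, hF.independent⟩

/-- The quadratic integrals of the geodesic flow of `H_p`. -/
theorem IsPolarHp.eq_of_conserved_kinetic (h : IsPolarHp a p ε S) (hadm : Admissible a p)
    {F : CotangentBundle 2 S2 → ℝ} (hF : IsSmoothOnCotangent F) (hc : IsConserved F S.kinetic)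
    (hquad : ∀ z : E2, ∃ α β γ : ℝ, ∀ P Q : ℝ,
      inPolar F (z, !₂[P, Q]) = α * P ^ 2 + β * (P * Q) + γ * Q ^ 2) :
    ∃ b c : ℝ, ∀ w, inPolar F w = c * w.2 0 ^ 2 + b * inPolar S.kinetic w := by
  have hK : ∀ φ y P Q, inPolar S.kinetic (!₂[φ, y], !₂[P, Q]) =
      (P ^ 2 + Q ^ 2) / (2 * (ε * hpFactor a p y)) + (fun _ => (0 : ℝ)) y * Real.cos φ := by
    intro φ y P Q
    have h3 : inPolar S.kinetic (!₂[φ, y], !₂[P, Q]) =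
      1 / 2 * (P ^ 2 / (ε * hpFactor a p y) + Q ^ 2 / (ε * hpFactor a p y)) :=
      h.metric.inPolar_kinetic (!₂[φ, y], !₂[P, Q])
    have h4 := (h.metric.1 y).ne'
    simp only at h4
    rw [h3]
    field_simp
    ring
  -- Applied with zero potential: the condition c W = 0 is then empty, and P² survives as an
  -- integral of the geodesic flow.
  obtain ⟨b, c, d, he, -⟩ := even_integral_of_degree_two (f := fun y => ε * hpFactor a p y)
    (contDiff_const.mul (contDiff_hpFactor h.gt)) h.metric.1
    (fun y => congrArg (ε * ·) (hpFactor_neg (a := a) (p := p) h.gt y))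
    (differentiable_const 0) rfl (h.not_exists_killing hadm) hF.contDiff_inPolar
    S.isSmoothOnCotangent_kinetic.contDiff_inPolar hK (fun z => by
      obtain ⟨α, β, γ, hx⟩ := hquad z
      exact ⟨α, β, γ, 0, fun P Q => by rw [hx, add_zero]⟩) hc.poissonBracket_inPolar
  have hd : d = 0 := by
    have h1 := he (!₂[0, 0], !₂[0, 0])
    obtain ⟨α, β, γ, hx⟩ := hquad !₂[0, 0]
    rw [hx, hK] at h1
    simpa using h1.symm
  exact ⟨b, c, fun w => by rw [he, hd, add_zero]⟩

end QuadraticIntegrals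

/-! ### Transport of conserved functions by cotangent lifts. -/

section Transfer

variable {n : ℕ} {M : Type} [TopologicalSpace M] [ChartedSpace (EuclideanSpace ℝ (Fin n)) M]
  [IsManifold (𝓡 n) ∞ M] {e : OpenPartialHomeomorph M (EuclideanSpace ℝ (Fin n))}

theorem trans_symm_trans (φ : M ≃ₘ^∞⟮𝓡 n, 𝓡 n⟯ M) :
    φ.symm.toHomeomorph.toOpenPartialHomeomorph.trans
      (φ.toHomeomorph.toOpenPartialHomeomorph.trans e) = e := by
  refine OpenPartialHomeomorph.ext _ _ (fun x => ?_) (fun x => ?_) ?_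
  · exact congrArg e (φ.apply_symm_apply x)
  · exact φ.apply_symm_apply (e.symm x)
  · ext x
    simp [OpenPartialHomeomorph.trans_source]

theorem mem_target_trans (φ : M ≃ₘ^∞⟮𝓡 n, 𝓡 n⟯ M) {q : EuclideanSpace ℝ (Fin n)} :
    q ∈ (φ.toHomeomorph.toOpenPartialHomeomorph.trans e).target ↔ q ∈ e.target := by
  simp [OpenPartialHomeomorph.trans_target]

theorem cotangentLift_symm_cotangentPoint (φ : M ≃ₘ^∞⟮𝓡 n, 𝓡 n⟯ M)
    (he : e ∈ IsManifold.maximalAtlas (𝓡 n) ∞ M)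
    {z : EuclideanSpace ℝ (Fin n) × EuclideanSpace ℝ (Fin n)} (hz : z.1 ∈ e.target) :
    cotangentLift φ.symm (cotangentPoint e z) =
      cotangentPoint (φ.toHomeomorph.toOpenPartialHomeomorph.trans e) z := by
  have h := cotangentLift_cotangentPoint φ.symm (trans_mem_maximalAtlas φ he)
    ((mem_target_trans φ).2 hz)
  rwa [trans_symm_trans] at h

theorem exists_cotangentPoint_eq (ξ : CotangentBundle n M) :
    ∃ e ∈ IsManifold.maximalAtlas (𝓡 n) ∞ M, ∃ z : EuclideanSpace ℝ (Fin n) ×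
      EuclideanSpace ℝ (Fin n), z.1 ∈ e.target ∧ cotangentPoint e z = ξ := by
  set e := chartAt (EuclideanSpace ℝ (Fin n)) ξ.1 with he
  have hmem : e ∈ IsManifold.maximalAtlas (𝓡 n) ∞ M := IsManifold.chart_mem_maximalAtlas ξ.1
  have hs : ξ.1 ∈ e.source := mem_chart_source _ _
  have hleft : e.symm (e ξ.1) = ξ.1 := e.left_inv hs
  obtain ⟨x, α⟩ := ξ
  set β : EuclideanSpace ℝ (Fin n) →L[ℝ] ℝ := ContinuousLinearMap.comp
    (show EuclideanSpace ℝ (Fin n) →L[ℝ] ℝ from α) (mfderiv (𝓡 n) (𝓡 n) e.symm (e x)) with hβ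
  refine ⟨e, hmem, (e x, (InnerProductSpace.toDual ℝ (EuclideanSpace ℝ (Fin n))).symm β),
    e.map_source hs, cotangent_ext hleft fun v => ?_⟩
  have h1 : ∀ u, inner ℝ ((InnerProductSpace.toDual ℝ (EuclideanSpace ℝ (Fin n))).symm β) u = β u :=
    fun u => InnerProductSpace.toDual_symm_apply
  refine (h1 _).trans ?_
  exact congrArg (fun u : EuclideanSpace ℝ (Fin n) => α u)
    (mfderiv_symm_mfderiv hmem (e.map_source hs) v)

theorem cotangentLift_cotangentLift_symm (φ : M ≃ₘ^∞⟮𝓡 n, 𝓡 n⟯ M) (ξ : CotangentBundle n M) :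
    cotangentLift φ (cotangentLift φ.symm ξ) = ξ := by
  obtain ⟨e, he, z, hz, rfl⟩ := exists_cotangentPoint_eq ξ
  rw [cotangentLift_symm_cotangentPoint φ he hz, cotangentLift_cotangentPoint φ he hz]

theorem inCanonicalCoordinates_comp_cotangentLift_symm (φ : M ≃ₘ^∞⟮𝓡 n, 𝓡 n⟯ M)
    (he : e ∈ IsManifold.maximalAtlas (𝓡 n) ∞ M) (F : CotangentBundle n M → ℝ)
    {z : EuclideanSpace ℝ (Fin n) × EuclideanSpace ℝ (Fin n)} (hz : z ∈ canonicalDomain e) :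
    inCanonicalCoordinates (fun ξ => F (cotangentLift φ.symm ξ)) e z =
      inCanonicalCoordinates F (φ.toHomeomorph.toOpenPartialHomeomorph.trans e) z :=
  congrArg F (cotangentLift_symm_cotangentPoint φ he hz.1)

theorem mem_canonicalDomain_trans (φ : M ≃ₘ^∞⟮𝓡 n, 𝓡 n⟯ M)
    {z : EuclideanSpace ℝ (Fin n) × EuclideanSpace ℝ (Fin n)} (hz : z ∈ canonicalDomain e) :
    z ∈ canonicalDomain (φ.toHomeomorph.toOpenPartialHomeomorph.trans e) :=
  ⟨(mem_target_trans φ).2 hz.1, trivial⟩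

theorem IsSmoothOnCotangent.comp_cotangentLift_symm {F : CotangentBundle n M → ℝ}
    (hF : IsSmoothOnCotangent F) (φ : M ≃ₘ^∞⟮𝓡 n, 𝓡 n⟯ M) :
    IsSmoothOnCotangent (fun ξ => F (cotangentLift φ.symm ξ)) := fun _ he =>
  ((hF _ (trans_mem_maximalAtlas φ he)).mono fun _ hz => mem_canonicalDomain_trans φ hz).congr
    fun _ hz => inCanonicalCoordinates_comp_cotangentLift_symm φ he F hz

/-- In a chart and its pullback the lift is the identity, so the two brackets are computed by the
same formula and differ by the constant factor `κ`. -/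
theorem IsConserved.comp_cotangentLift_symm {F K K' : CotangentBundle n M → ℝ}
    (hF : IsConserved F K') (hK' : IsSmoothOnCotangent K') (φ : M ≃ₘ^∞⟮𝓡 n, 𝓡 n⟯ M) {κ : ℝ}
    (hK : ∀ ξ, K (cotangentLift φ ξ) = κ * K' ξ) :
    IsConserved (fun ξ => F (cotangentLift φ.symm ξ)) K := by
  intro e he z hz
  set e' := φ.toHomeomorph.toOpenPartialHomeomorph.trans e with he'
  have hmem := trans_mem_maximalAtlas φ he
  have h1 : inCanonicalCoordinates (fun ξ => F (cotangentLift φ.symm ξ)) e =ᶠ[𝓝 z]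
      inCanonicalCoordinates F e' := by
    filter_upwards [isOpen_canonicalDomain.mem_nhds hz] with w hw
    exact inCanonicalCoordinates_comp_cotangentLift_symm φ he F hw
  have h2 : inCanonicalCoordinates K e =ᶠ[𝓝 z] fun w => κ * inCanonicalCoordinates K' e' w := by
    filter_upwards [isOpen_canonicalDomain.mem_nhds hz] with w hw
    exact (congrArg K (cotangentLift_cotangentPoint φ he hw.1)).symm.trans (hK _)
  have hd : DifferentiableAt ℝ (inCanonicalCoordinates K' e') z :=
    ((hK' e' hmem).contDiffAt (isOpen_canonicalDomain.mem_nhds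
      (mem_canonicalDomain_trans φ hz))).differentiableAt (by simp)
  have h3 := hF e' hmem z (mem_canonicalDomain_trans φ hz)
  have h4 : poissonBracket (inCanonicalCoordinates (fun ξ => F (cotangentLift φ.symm ξ)) e)
      (inCanonicalCoordinates K e) z =
        κ * poissonBracket (inCanonicalCoordinates F e') (inCanonicalCoordinates K' e') z := by
    simp only [poissonBracket, h1.fderiv_eq, h2.fderiv_eq, fderiv_const_mul hd, Finset.mul_sum]
    refine Finset.sum_congr rfl fun i _ => ?_
    simp only [smul_apply, smul_eq_mul]
    ring
  rw [h4, h3, mul_zero]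

end Transfer

/-! ### The differential of a diffeomorphism of the sphere in polar coordinates. -/

section PolarDifferential

theorem exists_polarDeriv_eq {z : E2} (v : TangentSpace (𝓡 2) (polarMap z)) :
    ∃ u, polarDeriv z u = v :=
  ⟨(polarEquiv z).symm v, by rw [← polarEquiv_apply]; exact (polarEquiv z).apply_symm_apply v⟩

variable (φ : S2 ≃ₘ^∞⟮𝓡 2, 𝓡 2⟯ S2)

/-- The transported angular momentum is linear in the covector, being evaluation on the image of the
rotation field. Hence its square is a quadratic form of rank at most one. -/
theorem exists_angularMomentum_cotangentLift_symm (z : E2) : ∃ u : E2, ∀ p : E2,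
    angularMomentum !₂[0, 0, 1] (cotangentLift φ.symm (polarPoint (z, p))) =
      p 0 * u 0 + p 1 * u 1 := by
  obtain ⟨u, hu⟩ := exists_polarDeriv_eq (z := z) (mfderiv (𝓡 2) (𝓡 2) φ (φ.symm (polarMap z))
    (rotationField !₂[0, 0, 1] (φ.symm (polarMap z))) : E2)
  refine ⟨u, fun p => ?_⟩
  have h1 : angularMomentum !₂[0, 0, 1] (cotangentLift φ.symm (polarPoint (z, p))) =
      (polarPoint (z, p)).2 (mfderiv (𝓡 2) (𝓡 2) φ (φ.symm (polarMap z))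
        (rotationField !₂[0, 0, 1] (φ.symm (polarMap z))) : E2) := rfl
  refine h1.trans ((congrArg (polarPoint (z, p)).2 hu).symm.trans
    ((polarPoint_polarDeriv (z, p) u).trans ?_))
  simp [PiLp.inner_apply, Fin.sum_univ_two]
  ring

variable {φ} {z z' : E2}

/-- The differential of `φ` in the coordinates `(φ, y)`. -/
def polarDifferential (φ : S2 ≃ₘ^∞⟮𝓡 2, 𝓡 2⟯ S2) (z z' : E2) : E2 →L[ℝ] E2 :=
  ContinuousLinearMap.comp ((polarEquiv z').symm : TangentSpace (𝓡 2) (polarMap z') →L[ℝ] E2)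
    (ContinuousLinearMap.comp (mfderiv (𝓡 2) (𝓡 2) φ (polarMap z) : E2 →L[ℝ] E2)
      (polarDeriv z : E2 →L[ℝ] E2) : E2 →L[ℝ] E2)

theorem cotangentLift_symm_polarPoint (hz : φ (polarMap z) = polarMap z') (p : E2) :
    cotangentLift φ.symm (polarPoint (z', p)) = polarPoint (z,
      !₂[inner ℝ p (polarDifferential φ z z' !₂[1, 0]),
        inner ℝ p (polarDifferential φ z z' !₂[0, 1])]) := by
  have hz1 : φ.symm (polarMap z') = polarMap z := by rw [← hz]; exact φ.symm_apply_apply _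
  refine cotangent_ext hz1 fun v => ?_
  obtain ⟨w, hw⟩ := exists_polarDeriv_eq (z := z) v
  -- The base point is generalized so that equality of base points can be substituted inside
  -- dependent types.
  have h1 : ∀ m, m = polarMap z → (polarPoint (z', p)).2 (mfderiv (𝓡 2) (𝓡 2) φ m v : E2) =
      (polarPoint (z', p)).2 (mfderiv (𝓡 2) (𝓡 2) φ (polarMap z) v : E2) := by
    rintro m rfl
    rfl
  refine (h1 _ hz1).trans ?_
  have h2 : (polarPoint (z', p)).2 (mfderiv (𝓡 2) (𝓡 2) φ (polarMap z) v : E2) =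
      inner ℝ p (polarDifferential φ z z' w) :=
    (congrArg (fun u : E2 => (polarPoint (z', p)).2 (mfderiv (𝓡 2) (𝓡 2) φ (polarMap z) u : E2))
      hw).symm
  have hwv : w = w 0 • (!₂[1, 0] : E2) + w 1 • (!₂[0, 1] : E2) := by
    ext i
    fin_cases i <;> simp
  have h3 : inner ℝ p (polarDifferential φ z z' w) =
      w 0 * inner ℝ p (polarDifferential φ z z' !₂[1, 0]) +
        w 1 * inner ℝ p (polarDifferential φ z z' !₂[0, 1]) := by
    conv_lhs => rw [hwv]
    rw [map_add, map_smul, map_smul, inner_add_right, inner_smul_right, inner_smul_right]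
  have h4 := polarPoint_polarDeriv (z, !₂[inner ℝ p (polarDifferential φ z z' !₂[1, 0]),
        inner ℝ p (polarDifferential φ z z' !₂[0, 1])]) w
  rw [h2, h3]
  refine Eq.trans ?_ (h4.symm.trans (congrArg (polarPoint (z, _)).2 hw))
  simp [PiLp.inner_apply, Fin.sum_univ_two]

theorem contDiff_height : ContDiff ℝ ∞ fun w : E2 => (φ (polarMap w) : E3) 2 :=
  (EuclideanSpace.proj 2 : E3 →L[ℝ] ℝ).contDiff.comp
    ((contMDiff_coe_sphere (n := 2) (m := ∞)).comp (φ.contMDiff.comp contMDiff_polarMap)).contDiff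

/-- The third component of a polar point is tanh y', so its differential is dy'/cosh² y'. In this
form the map can be followed along meridians and parallels even where its image is a pole. -/
theorem fderiv_height (hz : φ (polarMap z) = polarMap z') (v : E2) :
    fderiv ℝ (fun w : E2 => (φ (polarMap w) : E3) 2) z v =
      polarDifferential φ z z' v 1 / Real.cosh (z' 1) ^ 2 := by
  have hf : MDifferentiableAt (𝓡 2) (𝓡 2) (fun w : E2 => φ (polarMap w)) z :=
    (φ.contMDiff.comp contMDiff_polarMap).mdifferentiable (by simp) z
  have h1 := inclusionDeriv_comp_mfderiv hf v
  have h2 : mfderiv (𝓡 2) 𝓘(ℝ, E3) (fun w : E2 => (φ (polarMap w) : E3)) z v =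
      fderiv ℝ (fun w : E2 => (φ (polarMap w) : E3)) z v :=
    DFunLike.congr_fun mfderiv_eq_fderiv v
  have hc : ContDiff ℝ ∞ fun w : E2 => (φ (polarMap w) : E3) :=
    ((contMDiff_coe_sphere (n := 2) (m := ∞)).comp (φ.contMDiff.comp contMDiff_polarMap)).contDiff
  have h3 : fderiv ℝ (fun w : E2 => (φ (polarMap w) : E3) 2) z v =
      fderiv ℝ (fun w : E2 => (φ (polarMap w) : E3)) z v 2 := by
    have h := ((EuclideanSpace.proj 2 : E3 →L[ℝ] ℝ).hasFDerivAt (x := (φ (polarMap z) : E3))).comp z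
      (hc.differentiable (by simp) z).hasFDerivAt
    exact DFunLike.congr_fun h.fderiv v
  have h4 : mfderiv (𝓡 2) (𝓡 2) (fun w : E2 => φ (polarMap w)) z =
      (mfderiv (𝓡 2) (𝓡 2) φ (polarMap z)).comp (polarDeriv z) :=
    mfderiv_comp z (φ.mdifferentiable (by simp) _) (contMDiff_polarMap.mdifferentiable (by simp) z)
  have h5 : (mfderiv (𝓡 2) (𝓡 2) (fun w : E2 => φ (polarMap w)) z v : E2) =
      polarDeriv z' (polarDifferential φ z z' v) := by
    refine (DFunLike.congr_fun h4 v).trans ?_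
    rw [← polarEquiv_apply]
    exact ((polarEquiv z').apply_symm_apply _).symm
  have h6 : ∀ m, m = polarMap z' → (inclusionDeriv m
      (mfderiv (𝓡 2) (𝓡 2) (fun w : E2 => φ (polarMap w)) z v : E2)) =
      inclusionDeriv (polarMap z') (polarDeriv z' (polarDifferential φ z z' v)) := by
    rintro m rfl
    exact congrArg (fun u : E2 => inclusionDeriv (polarMap z') u) h5
  have h7 := (h2.symm.trans (h1.symm.trans (h6 _ hz))).trans (inclusionDeriv_polarDeriv z' _)
  rw [h3, h7]
  simp [polarTangentφ, polarTangentY]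
  ring

end PolarDifferential

/-! ### Equivalences map parallels to parallels. -/

section Parallels

variable {a p q ε κ : ℝ} {S S' : ConservativeSystem 2 S2} {A B : ℝ → ℝ}
  {φ : S2 ≃ₘ^∞⟮𝓡 2, 𝓡 2⟯ S2}

/-- A diffeomorphism that relates the geodesic flows of `H_p` and of a rotationally symmetric metric
preserves the square of the angular momentum up to a constant. -/
theorem IsPolarHp.exists_angularMomentum_sq (h : IsPolarHp a q ε S) (hadm : Admissible a q)
    (hS' : HasPolarMetric S' A B)
    (hK : ∀ ξ, S.kinetic (cotangentLift φ ξ) = κ * S'.kinetic ξ) :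
    ∃ c, ∀ z p : E2, angularMomentum !₂[0, 0, 1] (cotangentLift φ.symm (polarPoint (z, p))) ^ 2 =
      c * p 0 ^ 2 := by
  have hs := isSmoothOnCotangent_angularMomentum !₂[0, 0, 1]
  have hF := (hs.mul hs).comp_cotangentLift_symm φ
  have hc := hS'.isConserved_angularMomentum_sq.comp_cotangentLift_symm
    S'.isSmoothOnCotangent_kinetic φ hK
  choose u hu using exists_angularMomentum_cotangentLift_symm φ
  obtain ⟨b, c, hbc⟩ := h.eq_of_conserved_kinetic hadm hF hc fun z =>
    ⟨u z 0 ^ 2, 2 * (u z 0 * u z 1), u z 1 ^ 2, fun P Q => by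
      change angularMomentum _ _ * angularMomentum _ _ = _
      rw [hu]
      simp
      ring⟩
  have hval : ∀ z p : E2, (p 0 * u z 0 + p 1 * u z 1) ^ 2 = c * p 0 ^ 2 +
      b * (1 / 2 * (p 0 ^ 2 / (ε * hpFactor a q (z 1)) + p 1 ^ 2 / (ε * hpFactor a q (z 1)))) := by
    intro z p
    rw [← hu, ← h.metric.inPolar_kinetic (z, p), ← hbc (z, p), sq]
    rfl
  -- The transported form c P² + b K has rank at most one. If b ≠ 0, its vanishing determinant
  -- forces the conformal factor to equal the constant -b/(2c), and a constant satisfies the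
  -- excluded equation with κ = 0.
  have hb : b = 0 := by
    by_contra hb
    refine h.not_exists_killing hadm ⟨0, fun y => ?_⟩
    have hconst : ∀ y, ε * hpFactor a q y = -b / (2 * c) := by
      intro y
      have hl : ε * hpFactor a q y ≠ 0 := (h.metric.1 y).ne'
      have h1 := hval !₂[0, y] !₂[1, 0]
      have h2 := hval !₂[0, y] !₂[0, 1]
      have h3 := hval !₂[0, y] !₂[1, 1]
      simp [-mul_inv_rev] at h1 h2 h3
      set l := ε * hpFactor a q y with hldef
      set s := u !₂[0, y] 0
      set t := u !₂[0, y] 1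
      have h4 : s * t = 0 := by linarith [h1, h2, h3]
      have h5 : (c + b * (2⁻¹ * l⁻¹)) * (b * (2⁻¹ * l⁻¹)) = 0 := by
        rw [← h1, ← h2]
        linear_combination (s * t) * h4
      have h6 : b * (2⁻¹ * l⁻¹) ≠ 0 := mul_ne_zero hb (by positivity)
      have h7 := (mul_eq_zero.1 h5).resolve_right h6
      have hc0 : c ≠ 0 := by
        rintro rfl
        exact h6 (by linarith)
      field_simp at h7 ⊢
      linarith
    have h1 : (fun y => ε * hpFactor a q y) = fun _ => -b / (2 * c) := funext hconst
    rw [h1]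
    simp
  refine ⟨c, fun z p => ?_⟩
  rw [hu, hval, hb]
  ring

/-- The covector dy' has P = 0, so by conservation of P² up to a factor its pullback annihilates
∂/∂φ. At points sent to a pole the height is extremal and its whole differential vanishes. -/
theorem IsPolarHp.fderiv_height_fst (h : IsPolarHp a p ε S) (hadm : Admissible a p)
    (hS' : HasPolarMetric S' A B)
    (hK : ∀ ξ, S.kinetic (cotangentLift φ ξ) = κ * S'.kinetic ξ) (z : E2) :
    fderiv ℝ (fun w : E2 => (φ (polarMap w) : E3) 2) z (EuclideanSpace.single 0 1) = 0 := by
  obtain ⟨c, hc⟩ := h.exists_angularMomentum_sq hadm hS' hK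
  by_cases hz : φ (polarMap z) ∈ Set.range polarMap
  · obtain ⟨z', hz'⟩ := hz
    have h1 := hc z' !₂[0, 1]
    rw [cotangentLift_symm_polarPoint hz'.symm] at h1
    have h2 := inPolar_angularMomentum_axis (z, !₂[inner ℝ (!₂[0, 1] : E2) (polarDifferential φ z z' !₂[1, 0]),
        inner ℝ (!₂[0, 1] : E2) (polarDifferential φ z z' !₂[0, 1])])
    rw [inPolar] at h2
    rw [h2] at h1
    have h3 : polarDifferential φ z z' !₂[1, 0] 1 = 0 := by
      simpa [PiLp.inner_apply, Fin.sum_univ_two] using h1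
    have h4 : (EuclideanSpace.single 0 1 : E2) = !₂[1, 0] := by
      ext i
      fin_cases i <;> simp
    rw [fderiv_height hz'.symm, h4, h3, zero_div]
  · have hle : ∀ x : S2, (x : E3) 2 ^ 2 ≤ 1 := fun x => by
      nlinarith [sphere_sq_sum x, sq_nonneg ((x : E3) 0), sq_nonneg ((x : E3) 1)]
    have h1 : fderiv ℝ (fun w : E2 => (φ (polarMap w) : E3) 2) z = 0 := by
      rcases pole_of_notMem_range hz with h0 | h0
      · refine IsLocalMax.fderiv_eq_zero (Filter.Eventually.of_forall fun w => ?_)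
        beta_reduce
        rw [h0]
        exact (abs_le.1 ((sq_le_one_iff_abs_le_one _).1 (hle _))).2
      · refine IsLocalMin.fderiv_eq_zero (Filter.Eventually.of_forall fun w => ?_)
        beta_reduce
        rw [h0]
        exact (abs_le.1 ((sq_le_one_iff_abs_le_one _).1 (hle _))).1
    rw [h1]
    rfl

theorem IsPolarHp.height_eq (h : IsPolarHp a p ε S) (hadm : Admissible a p)
    (hS' : HasPolarMetric S' A B)
    (hK : ∀ ξ, S.kinetic (cotangentLift φ ξ) = κ * S'.kinetic ξ) (θ θ' y : ℝ) :
    (φ (polarMap !₂[θ, y]) : E3) 2 = (φ (polarMap !₂[θ', y]) : E3) 2 :=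
  eq_of_deriv_zero (f := fun t => (φ (polarMap !₂[t, y]) : E3) 2) (fun t =>
    (HasFDerivAt.comp_hasDerivAt (f := fun t => (!₂[t, y] : E2)) t
      ((contDiff_height (φ := φ)).differentiable (by simp) _).hasFDerivAt
        (hasDerivAt_vec_fst t y)).congr_deriv (h.fderiv_height_fst hadm hS' hK _)) θ θ'

theorem polarMap_ne_of_cos_ne {θ θ' y : ℝ} (h : Real.cos θ ≠ Real.cos θ') :
    polarMap !₂[θ, y] ≠ polarMap !₂[θ', y] := by
  intro heq
  have h1 := congrArg (fun x : S2 => (x : E3) 0) heq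
  have hc := (Real.cosh_pos y).ne'
  simp [polarMap_coe] at h1
  field_simp at h1
  exact h h1

/-- The height is constant on the image of a parallel. If one point of the parallel went to a pole,
the whole circle would go to that pole, against injectivity. -/
theorem IsPolarHp.mem_range_polarMap (h : IsPolarHp a p ε S) (hadm : Admissible a p)
    (hS' : HasPolarMetric S' A B)
    (hK : ∀ ξ, S.kinetic (cotangentLift φ ξ) = κ * S'.kinetic ξ) (z : E2) :
    φ (polarMap z) ∈ Set.range polarMap := by
  by_contra hz
  rw [eq_vec_two z] at hz
  have hall : ∀ θ, φ (polarMap !₂[θ, z 1]) = φ (polarMap !₂[z 0, z 1]) := by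
    intro θ
    have h1 := h.height_eq hadm hS' hK θ (z 0) (z 1)
    have hθ : φ (polarMap !₂[θ, z 1]) ∉ Set.range polarMap := by
      rw [_root_.mem_range_polarMap] at hz ⊢
      rwa [h1]
    apply Subtype.ext
    rcases pole_of_notMem_range hz with h2 | h2 <;> rcases pole_of_notMem_range hθ with h3 | h3
    · rw [h2, h3]
    · rw [h2, h3] at h1
      exact absurd (show (-1 : ℝ) = 1 from h1) (by norm_num)
    · rw [h2, h3] at h1
      exact absurd (show (1 : ℝ) = -1 from h1) (by norm_num)
    · rw [h2, h3]
  have h4 := φ.injective ((hall 0).trans (hall Real.pi).symm)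
  exact polarMap_ne_of_cos_ne (by norm_num) h4

end Parallels

/-! ### Inequivalence with the Goryachev and Kovalevskaya systems. -/

section Goryachev

variable {a p ε κ κ' : ℝ} {S S' : ConservativeSystem 2 S2} {A B : ℝ → ℝ}
  {φ : S2 ≃ₘ^∞⟮𝓡 2, 𝓡 2⟯ S2}

/-- The parameters B₁, B₂ enter only the potential; the metric is rotationally symmetric about the
third axis, so the results on parallels apply. -/
theorem exists_hasPolarMetric_goryachev (B₁ B₂ : ℝ) :
    ∃ A B, HasPolarMetric (goryachev B₁ B₂) A B := by
  refine ⟨fun y => (2 / Real.cosh y ^ 2 + Real.tanh y ^ 2)⁻¹ * (1 / Real.cosh y ^ 2),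
    fun y => (2 / Real.cosh y ^ 2 + Real.tanh y ^ 2)⁻¹ *
      (Real.tanh y ^ 2 / Real.cosh y ^ 2 + 2 / Real.cosh y ^ 4), fun y => ?_, fun y => ?_,
      fun z v w => ?_⟩
  · have := Real.cosh_pos y
    positivity
  · have := Real.cosh_pos y
    positivity
  · have h1 : (goryachev B₁ B₂).metric.inner (polarMap z) (polarDeriv z v) (polarDeriv z w) =
      goryachevFactor (polarMap z) * goryachevForm (inclusionDeriv (polarMap z) (polarDeriv z v))
        (inclusionDeriv (polarMap z) (polarDeriv z w)) := rfl
    have hc := (Real.cosh_pos (z 1)).ne'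
    have h2 := Real.sin_sq_add_cos_sq (z 0)
    have hf : goryachevFactor (polarMap z) =
        (2 / Real.cosh (z 1) ^ 2 + Real.tanh (z 1) ^ 2)⁻¹ := by
      rw [goryachevFactor, polarMap_two]
      congr 2
      simp [polarMap_coe]
      field_simp
      linear_combination h2
    rw [h1, hf, mul_assoc, mul_assoc, ← mul_add, goryachevForm_apply, inclusionDeriv_polarDeriv,
      inclusionDeriv_polarDeriv]
    congr 1
    simp [polarTangentφ, polarTangentY, Real.tanh_eq_sinh_div_cosh]
    field_simp
    have h3 : Real.cos (z 0) ^ 2 = 1 - Real.sin (z 0) ^ 2 := by linarith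
    ring_nf
    simp only [h3]
    ring

theorem goryachev_potential_polarMap (B₁ B₂ θ y : ℝ) :
    (goryachev B₁ B₂).potential (polarMap !₂[θ, y]) =
      -2 * B₁ * (Real.cos θ / Real.cosh y) * (Real.sin θ / Real.cosh y) -
        B₂ * ((Real.cos θ / Real.cosh y) ^ 2 - (Real.sin θ / Real.cosh y) ^ 2) -
        Real.cos θ / Real.cosh y := rfl

/-- Some point of the equator is not a pole after a bijection of the sphere. -/
theorem exists_equator_mem_range (f : S2 → S2) (hf : Function.Injective f) :
    ∃ θ, f (polarMap !₂[θ, 0]) ∈ Set.range polarMap := by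
  by_contra! hcon
  have h0 := pole_of_notMem_range (hcon 0)
  have h1 := pole_of_notMem_range (hcon Real.pi)
  have h2 := pole_of_notMem_range (hcon (Real.pi / 2))
  have n1 : f (polarMap !₂[0, 0]) ≠ f (polarMap !₂[Real.pi, 0]) := fun h =>
    polarMap_ne_of_cos_ne (by norm_num) (hf h)
  have n2 : f (polarMap !₂[0, 0]) ≠ f (polarMap !₂[Real.pi / 2, 0]) := fun h =>
    polarMap_ne_of_cos_ne (by norm_num) (hf h)
  have n3 : f (polarMap !₂[Real.pi, 0]) ≠ f (polarMap !₂[Real.pi / 2, 0]) := fun h =>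
    polarMap_ne_of_cos_ne (by norm_num) (hf h)
  rcases h0 with h0 | h0 <;> rcases h1 with h1 | h1 <;> rcases h2 with h2 | h2
  · exact n1 (Subtype.ext (h0.trans h1.symm))
  · exact n1 (Subtype.ext (h0.trans h1.symm))
  · exact n2 (Subtype.ext (h0.trans h2.symm))
  · exact n3 (Subtype.ext (h1.trans h2.symm))
  · exact n3 (Subtype.ext (h1.trans h2.symm))
  · exact n2 (Subtype.ext (h0.trans h2.symm))
  · exact n1 (Subtype.ext (h0.trans h1.symm))
  · exact n1 (Subtype.ext (h0.trans h1.symm))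

/-- An equivalence sends some parallel into the equator, where the potential of H_p is zero, so the
Goryachev potential vanishes on that parallel. But its values at φ = 0 and φ = π differ by 2/cosh y,
because the quadratic terms are invariant under φ ↦ φ + π. -/
theorem IsPolarHp.not_equivalent_goryachev (h : IsPolarHp a p ε S) (hadm : Admissible a p)
    (B₁ B₂ : ℝ) : ¬ S.Equivalent (goryachev B₁ B₂) := by
  rintro ⟨φ, κ, κ', hκ, hκ', hK, hU⟩
  obtain ⟨A, B, hS'⟩ := exists_hasPolarMetric_goryachev B₁ B₂
  obtain ⟨θ₀, z₀, hz₀⟩ := exists_equator_mem_range φ.symm φ.symm.injective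
  have hz : φ (polarMap !₂[z₀ 0, z₀ 1]) = polarMap !₂[θ₀, 0] := by
    rw [← eq_vec_two, hz₀]
    exact φ.apply_symm_apply _
  have hzero : ∀ θ, (goryachev B₁ B₂).potential (polarMap !₂[θ, z₀ 1]) = 0 := by
    intro θ
    have h1 := h.height_eq hadm hS' hK θ (z₀ 0) (z₀ 1)
    rw [hz, polarMap_two] at h1
    obtain ⟨z', hz'⟩ := h.mem_range_polarMap hadm hS' hK !₂[θ, z₀ 1]
    rw [← hz', polarMap_two] at h1
    have h2 : z' 1 = 0 := Real.tanh_injective h1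
    have h3 := hU (polarMap !₂[θ, z₀ 1])
    rw [← hz', h.potential, h2, hpPotential_zero h.gt, mul_zero, zero_mul] at h3
    exact (mul_eq_zero.1 h3.symm).resolve_left hκ'
  have h1 := hzero 0
  have h2 := hzero Real.pi
  rw [goryachev_potential_polarMap] at h1 h2
  have hc := Real.cosh_pos (z₀ 1)
  simp at h1 h2
  have h3 : 0 < (Real.cosh (z₀ 1))⁻¹ := by positivity
  have h4 : (Real.cosh (z₀ 1))⁻¹ = 0 := by
    rw [div_pow, neg_one_sq, neg_div, one_div, one_div] at h2
    linarith
  exact h3.ne' h4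

end Goryachev

/-! ### Invariants that determine the slope of the reparametrization and a, p. -/

section Rigidity

theorem hasDerivAt_artanh {x : ℝ} (hx : x ^ 2 < 1) :
    HasDerivAt Real.artanh (1 - x ^ 2)⁻¹ x := by
  obtain ⟨h1, h2⟩ := abs_lt.1 (sq_lt_one_iff_abs_lt_one _ |>.1 hx)
  have hev : Real.artanh =ᶠ[𝓝 x] fun t => 1 / 2 * (Real.log (1 + t) - Real.log (1 - t)) := by
    filter_upwards [Ioo_mem_nhds h1 h2] with t ht
    rw [Real.artanh_eq_half_log ⟨ht.1.le, ht.2.le⟩,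
      Real.log_div (by linarith [ht.1]) (by linarith [ht.2])]
  have hp : 1 + x ≠ 0 := by linarith
  have hm : 1 - x ≠ 0 := by linarith
  have h := ((((hasDerivAt_id' x).const_add 1).log hp).sub
    (((hasDerivAt_id' x).const_sub 1).log hm)).const_mul (1 / 2)
  refine (h.congr_of_eventuallyEq hev).congr_deriv ?_
  have hpm : 1 - x ^ 2 ≠ 0 := by linarith
  field_simp
  ring

theorem abs_le_one_of_cosh_le {s C : ℝ} (h : ∀ y, Real.cosh (s * y) ≤ C * Real.cosh y) :
    |s| ≤ 1 := by
  by_contra! hs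
  have hC : 1 ≤ C := by simpa using h 0
  -- Chosen so that (|s| - 1) y = 2C; the hypothesis then gives exp(2C) ≤ 2C, which is absurd.
  set y := 2 * C / (|s| - 1) with hy
  have hs' : 0 < |s| - 1 := by linarith
  have hy0 : 0 ≤ y := by positivity
  have h1 : Real.exp (|s| * y) / 2 ≤ Real.cosh (s * y) := by
    rw [← Real.cosh_abs (s * y), abs_mul, abs_of_nonneg hy0, Real.cosh_eq]
    linarith [Real.exp_pos (-(|s| * y))]
  have h2 : Real.cosh y ≤ Real.exp y := by
    rw [Real.cosh_eq]
    linarith [Real.exp_le_exp.2 (show -y ≤ y by linarith)]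
  have h3 : Real.exp (|s| * y) = Real.exp ((|s| - 1) * y) * Real.exp y := by
    rw [← Real.exp_add]
    ring_nf
  have h4 : (|s| - 1) * y = 2 * C := by
    rw [hy]
    field_simp
  have h5 := Real.add_one_le_exp (2 * C)
  have h6 := Real.exp_pos y
  have h7 := h y
  rw [h4] at h3
  have h8 : Real.exp (2 * C) * Real.exp y ≤ 2 * C * Real.exp y := by nlinarith
  have h9 := le_of_mul_le_mul_right h8 h6
  linarith

variable {a a' p p' : ℝ}

/-- As a function of s the product is continuous and positive on the compact interval [-1, 1], poles
included. So |f| decays exactly like 1/cosh² y. -/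
theorem exists_bounds_hpFactor (h : Admissible a p) : ∃ m M, 0 < m ∧ ∀ y,
    m ≤ |hpFactor a p y| * Real.cosh y ^ 2 ∧ |hpFactor a p y| * Real.cosh y ^ 2 ≤ M := by
  have ha := h.gt
  obtain ⟨ε, -, hε⟩ := exists_sign a p h
  set G : ℝ → ℝ := fun s => |compactGap a s + p| / compactRoot a s ^ 2 * compactCosh a s ^ 2 with hG
  have hsq : ∀ s ∈ Set.Icc (-1 : ℝ) 1, s ^ 2 ≤ 1 := fun s hs =>
    (sq_le_one_iff_abs_le_one s).2 (abs_le.2 hs)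
  have hc : ContinuousOn G (Set.Icc (-1) 1) := by
    intro s hs
    have h1 := (contDiffAt_compactGap ha (hsq s hs)).continuousAt
    have hA := compactA_pos_of_sq_le ha (hsq s hs)
    have h2 := (contDiffAt_compactRoot hA).continuousAt
    have h3 := (contDiffAt_compactCosh ha (mem_Ioo_compactRadius (hsq s hs))).continuousAt
    exact (((h1.add continuousAt_const).abs.div (h2.pow 2)
      (pow_pos (compactRoot_pos hA) 2).ne').mul (h3.pow 2)).continuousWithinAt
  have hpos : ∀ s ∈ Set.Icc (-1 : ℝ) 1, 0 < G s := by
    intro s hs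
    have h1 : 0 < |compactGap a s + p| :=
      abs_pos.2 (right_ne_zero_of_mul (hε s (hsq s hs)).ne')
    have h2 := compactRoot_pos (compactA_pos_of_sq_le ha (hsq s hs))
    have h3 := compactCosh_pos (a := a) (hsq s hs)
    positivity
  have hne : (Set.Icc (-1 : ℝ) 1).Nonempty := ⟨0, by norm_num, by norm_num⟩
  obtain ⟨s₀, hs₀, hmin⟩ := isCompact_Icc.exists_isMinOn hne hc
  obtain ⟨s₁, hs₁, hmax⟩ := isCompact_Icc.exists_isMaxOn hne hc
  have hval : ∀ y, |hpFactor a p y| * Real.cosh y ^ 2 = G (compactCoord a y) := by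
    intro y
    have hw := coordSpeed_pos ha y
    have hr : 0 < √(1 + invCoord a y ^ 2) := Real.sqrt_pos.2 (by positivity)
    simp only [hG]
    rw [compactGap_compactCoord ha, compactRoot_compactCoord ha, cosh_eq_compactCosh ha, hpFactor,
      abs_div, abs_of_pos (pow_pos hw 2)]
    field_simp
  refine ⟨G s₀, G s₁, hpos s₀ hs₀, fun y => ?_⟩
  have hmem : compactCoord a y ∈ Set.Icc (-1 : ℝ) 1 :=
    abs_le.1 ((sq_le_one_iff_abs_le_one _).1 (compactCoord_sq_lt_one y).le)
  rw [hval]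
  exact ⟨hmin hmem, hmax hmem⟩

theorem coordSpeed_sq_sub_ne_one (ha : -2 < a) (ha2 : a ≠ 2) {y : ℝ} (hy : y ≠ 0) :
    coordSpeed a y ^ 2 - invCoord a y ^ 2 ≠ 1 := by
  intro h
  have h4 := coordSpeed_pow_four ha y
  have h5 : (a - 2) * invCoord a y ^ 2 = 0 := by
    linear_combination (coordSpeed a y ^ 2 + invCoord a y ^ 2 + 1) * h - h4
  rcases mul_eq_zero.1 h5 with h6 | h6
  · exact ha2 (by linarith)
  · exact hy ((invCoord_eq_zero ha).1 (pow_eq_zero_iff two_ne_zero |>.1 h6))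

/-- For a common `a` the hypothesis becomes g + p = C (g + p') with g = w² - U². Since g is 1 at y =
0 but not at y = 1, C = 1. -/
theorem eq_of_hpFactor_eq_mul (ha : -2 < a) (ha2 : a ≠ 2) {C : ℝ}
    (h : ∀ y, hpFactor a p y = C * hpFactor a p' y) : p = p' := by
  have hgap : ∀ y, hpGap a p y = C * hpGap a p' y := by
    intro y
    have hw := (coordSpeed_pos ha y).ne'
    have h1 := h y
    rw [hpFactor_eq, hpFactor_eq] at h1
    field_simp at h1
    exact h1
  have h0 := hgap 0
  have h1 := hgap 1
  rw [hpGap_zero ha, hpGap_zero ha] at h0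
  rw [hpGap, hpGap] at h1
  have h2 : (1 - C) * (coordSpeed a 1 ^ 2 - invCoord a 1 ^ 2 - 1) = 0 := by
    linear_combination h1 - h0
  have h3 := (mul_eq_zero.1 h2).resolve_right
    (sub_ne_zero.2 (coordSpeed_sq_sub_ne_one ha ha2 one_ne_zero))
  have h4 : C = 1 := by linarith
  rw [h4] at h0
  linarith

/-- The product of the conformal factor and the potential, up to a constant. -/
def hpProduct (a y : ℝ) : ℝ := invCoord a y * hpSlope a y / coordSpeed a y ^ 2

/-- The gap m, the only place where `p` occurs, cancels from the product. Hence `a` can be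
determined before `p`. -/
theorem hpFactor_mul_hpPotential (ha : -2 < a) {y : ℝ} (h : hpGap a p y ≠ 0) :
    hpFactor a p y * hpPotential a p y = -(1 / 2) * hpProduct a y := by
  have hw := (coordSpeed_pos ha y).ne'
  rw [hpFactor_eq, hpPotential_eq, hpProduct]
  field_simp

theorem hpProduct_neg (ha : -2 < a) (y : ℝ) : hpProduct a (-y) = -hpProduct a y := by
  rw [hpProduct, hpProduct, hpSlope, hpSlope, invCoord_neg ha, coordSpeed_neg ha]
  ring

theorem exists_sign_hpSlope (ha : -2 < a) (ha2 : a ≠ 2) :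
    ∃ σ : ℝ, σ * σ = 1 ∧ ∀ y, 0 < σ * hpSlope a y := by
  have h1 : ∀ y, hpSlope a y * (a + 2 * invCoord a y ^ 2 + 2 * coordSpeed a y ^ 2) =
      (a - 2) * (a + 2) := by
    intro y
    rw [hpSlope]
    linear_combination (-4) * coordSpeed_pow_four ha y
  have h2 : ∀ y, 0 < a + 2 * invCoord a y ^ 2 + 2 * coordSpeed a y ^ 2 := by
    intro y
    have h4 := coordSpeed_pow_four ha y
    have hw := coordSpeed_pos ha y
    by_contra! hcon
    have h3 : 2 * coordSpeed a y ^ 2 ≤ -(a + 2 * invCoord a y ^ 2) := by linarith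
    have h5 : (2 * coordSpeed a y ^ 2) ^ 2 ≤ (-(a + 2 * invCoord a y ^ 2)) ^ 2 :=
      pow_le_pow_left₀ (by positivity) h3 2
    have h6 : 4 ≤ a ^ 2 := by nlinarith
    have h7 : a < 0 := by nlinarith [sq_nonneg (invCoord a y), pow_pos hw 2]
    nlinarith
  rcases lt_or_gt_of_ne ha2 with h | h
  · refine ⟨-1, by norm_num, fun y => ?_⟩
    have h3 : hpSlope a y < 0 := by
      by_contra! hcon
      have := mul_nonneg hcon (h2 y).le
      rw [h1] at this
      nlinarith
    linarith
  · refine ⟨1, by norm_num, fun y => ?_⟩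
    rw [one_mul]
    by_contra! hcon
    have := mul_nonpos_of_nonpos_of_nonneg hcon (h2 y).le
    rw [h1] at this
    nlinarith

theorem invCoord_pos (ha : -2 < a) {y : ℝ} (hy : 0 < y) : 0 < invCoord a y := by
  rw [← invCoord_zero ha]
  exact strictMono_of_deriv_pos (fun y => by
    rw [(hasDerivAt_invCoord ha y).deriv]; exact coordSpeed_pos ha y) hy

/-- Potentials are compared only in absolute value. Since `hpProduct` is odd and of constant sign on
y > 0, proportional absolute values imply proportionality. -/
theorem hpProduct_eq_mul_of_abs (ha : -2 < a) (ha2 : a ≠ 2) (ha' : -2 < a') (ha2' : a' ≠ 2) {C : ℝ}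
    (h : ∀ y, |hpProduct a y| = C * |hpProduct a' y|) :
    ∃ k, ∀ y, hpProduct a y = k * hpProduct a' y := by
  obtain ⟨σ, hσ, h1⟩ := exists_sign_hpSlope ha ha2
  obtain ⟨σ', hσ', h1'⟩ := exists_sign_hpSlope ha' ha2'
  have key : ∀ {a σ : ℝ}, -2 < a → σ * σ = 1 → (∀ y, 0 < σ * hpSlope a y) → ∀ y, 0 < y →
      |hpProduct a y| = σ * hpProduct a y := by
    intro a σ ha hσ h1 y hy
    have h2 : 0 < σ * hpProduct a y := by
      have h3 : σ * hpProduct a y = invCoord a y * (σ * hpSlope a y) / coordSpeed a y ^ 2 := by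
        rw [hpProduct]
        ring
      rw [h3]
      exact div_pos (mul_pos (invCoord_pos ha hy) (h1 y)) (pow_pos (coordSpeed_pos ha y) 2)
    have h4 : |σ| = 1 := by
      rcases mul_self_eq_one_iff.1 hσ with h | h <;> simp [h]
    rw [← abs_of_pos h2, abs_mul, h4, one_mul]
  have hpos : ∀ y, 0 < y → hpProduct a y = σ * C * σ' * hpProduct a' y := by
    intro y hy
    have h2 := h y
    rw [key ha hσ h1 y hy, key ha' hσ' h1' y hy] at h2
    linear_combination σ * h2 - hpProduct a y * hσ
  refine ⟨σ * C * σ', fun y => ?_⟩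
  rcases lt_trichotomy y 0 with hy | rfl | hy
  · have h2 := hpos (-y) (by linarith)
    rw [hpProduct_neg ha, hpProduct_neg ha'] at h2
    linarith
  · simp [hpProduct, invCoord_zero ha, invCoord_zero ha']
  · exact hpos y hy

/-- The derivative of `hpProduct` divided by `hpSlope`. -/
def hpProductSlope (a y : ℝ) : ℝ := 1 / coordSpeed a y - 2 * invCoord a y ^ 2 / coordSpeed a y ^ 3 -
  (a * invCoord a y ^ 2 + 2 * invCoord a y ^ 4) / coordSpeed a y ^ 5

/-- The second derivative of `hpProduct` divided by `hpProduct`. -/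
def hpProductRatio (a y : ℝ) : ℝ :=
  -2 * hpProductSlope a y * coordSpeed a y - (5 * a + 18 * invCoord a y ^ 2) / (2 * coordSpeed a y ^ 2)
    - 4 + 3 * invCoord a y ^ 2 * (a + 2 * invCoord a y ^ 2) / coordSpeed a y ^ 4 +
    5 * invCoord a y ^ 2 * (a + 2 * invCoord a y ^ 2) ^ 2 / (2 * coordSpeed a y ^ 6)

theorem hasDerivAt_coordSpeed_quot (ha : -2 < a) (y : ℝ) : HasDerivAt (coordSpeed a)
    (invCoord a y * (a + 2 * invCoord a y ^ 2) / (2 * coordSpeed a y ^ 2)) y :=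
  (hasDerivAt_coordSpeed_slope ha y).congr_deriv (by rw [hpSlope]; ring)

theorem hasDerivAt_hpProduct (ha : -2 < a) (y : ℝ) :
    HasDerivAt (hpProduct a) (hpSlope a y * hpProductSlope a y) y := by
  have hw := (coordSpeed_pos ha y).ne'
  have h := ((hasDerivAt_invCoord ha y).fun_mul (hasDerivAt_hpSlope ha y)).fun_div
    ((hasDerivAt_coordSpeed_quot ha y).fun_pow 2) (pow_ne_zero 2 hw)
  refine h.congr_deriv ?_
  rw [hpProductSlope]
  norm_num
  field_simp
  ring

theorem hasDerivAt_hpProductSlope_mul (ha : -2 < a) (y : ℝ) :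
    HasDerivAt (fun y => hpSlope a y * hpProductSlope a y)
      (hpProduct a y * hpProductRatio a y) y := by
  have hw := (coordSpeed_pos ha y).ne'
  have hU := hasDerivAt_invCoord ha y
  have hW := hasDerivAt_coordSpeed_quot ha y
  have h1 := ((hasDerivAt_const y (1 : ℝ)).fun_div hW hw).fun_sub
    (((hU.fun_pow 2).const_mul 2).fun_div (hW.fun_pow 3) (pow_ne_zero 3 hw))
  have h2 := h1.fun_sub ((((hU.fun_pow 2).const_mul a).fun_add ((hU.fun_pow 4).const_mul 2)).fun_div
    (hW.fun_pow 5) (pow_ne_zero 5 hw))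
  have h := (hasDerivAt_hpSlope ha y).fun_mul h2
  refine h.congr_deriv ?_
  rw [hpProduct, hpProductRatio, hpProductSlope]
  norm_num
  field_simp
  ring

theorem hpProduct_ne_zero (ha : -2 < a) (ha2 : a ≠ 2) {y : ℝ} (hy : y ≠ 0) : hpProduct a y ≠ 0 :=
  div_ne_zero (mul_ne_zero (fun h0 => hy ((invCoord_eq_zero ha).1 h0)) (hpSlope_ne_zero ha ha2 y))
    (pow_pos (coordSpeed_pos ha y) 2).ne'

theorem continuous_hpProductRatio (ha : -2 < a) : Continuous (hpProductRatio a) := by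
  have hU := (contDiff_invCoord ha).continuous
  have hW := (contDiff_coordSpeed ha).continuous
  have hne : ∀ y, coordSpeed a y ≠ 0 := fun y => (coordSpeed_pos ha y).ne'
  unfold hpProductRatio hpProductSlope
  fun_prop (disch := simp [hne])

theorem hpProductRatio_zero (ha : -2 < a) : hpProductRatio a 0 = -6 - 5 / 2 * a := by
  rw [hpProductRatio, hpProductSlope, invCoord_zero ha, coordSpeed_zero ha]
  ring

/-- The quotient h''/h of h = `hpProduct` is insensitive to constant factors. Its explicit form
extends continuously over the zero y = 0 of h, with value -6 - 5a/2 there. -/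
theorem eq_of_hpProduct_eq_mul (ha : -2 < a) (ha2 : a ≠ 2) (ha' : -2 < a') {k : ℝ}
    (h : ∀ y, hpProduct a y = k * hpProduct a' y) : a = a' := by
  have h1 : ∀ y, hpSlope a y * hpProductSlope a y = k * (hpSlope a' y * hpProductSlope a' y) :=
    fun y => (hasDerivAt_hpProduct ha y).unique (((hasDerivAt_hpProduct ha' y).const_mul
      k).congr_of_eventuallyEq (Filter.Eventually.of_forall h))
  have h2 : ∀ y, hpProduct a y * hpProductRatio a y = k * (hpProduct a' y * hpProductRatio a' y) :=
    fun y => (hasDerivAt_hpProductSlope_mul ha y).unique (((hasDerivAt_hpProductSlope_mul ha'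
      y).const_mul k).congr_of_eventuallyEq (Filter.Eventually.of_forall h1))
  have h3 : Set.EqOn (hpProductRatio a) (hpProductRatio a') {0}ᶜ := by
    intro y hy
    have h4 := h2 y
    rw [← mul_assoc, ← h] at h4
    exact mul_left_cancel₀ (hpProduct_ne_zero ha ha2 hy) h4
  have h5 := congrFun (Continuous.ext_on (dense_compl_singleton 0) (continuous_hpProductRatio ha)
    (continuous_hpProductRatio ha') h3) 0
  rw [hpProductRatio_zero ha, hpProductRatio_zero ha'] at h5
  linarith

end Rigidity

/-! ### Systems for different (a, p) are not equivalent. -/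

section Equivalence

variable {a a' p p' ε ε' κ κ' : ℝ} {S S' : ConservativeSystem 2 S2} {φ : S2 ≃ₘ^∞⟮𝓡 2, 𝓡 2⟯ S2}

/-- A linear map of the plane that is conformal and maps horizontal lines to themselves. -/
theorem conformal_of_preserves_square {c κ r r' u₀ u₁ v₀ v₁ : ℝ} (hr : 0 < r) (hr' : 0 < r')
    (hP : ∀ P Q : ℝ, (P * u₀ + Q * u₁) ^ 2 = c * P ^ 2)
    (hK : ∀ P Q : ℝ, κ * (1 / 2 * ((P * u₀ + Q * u₁) ^ 2 / r' + (P * v₀ + Q * v₁) ^ 2 / r')) =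
      1 / 2 * (P ^ 2 / r + Q ^ 2 / r)) :
    0 < c ∧ v₁ ^ 2 = c ∧ r' = c * κ * r := by
  have h1 : ∀ P Q : ℝ, κ * r * (c * P ^ 2 + (P * v₀ + Q * v₁) ^ 2) = r' * (P ^ 2 + Q ^ 2) := by
    intro P Q
    have h := hK P Q
    rw [hP] at h
    field_simp at h
    linear_combination h
  have h2 := h1 1 0
  have h3 := h1 0 1
  have h4 := h1 1 1
  ring_nf at h2 h3 h4
  have hκ : κ * r ≠ 0 := by
    intro h0
    rw [h0] at h3
    linarith
  have h5 : v₁ ≠ 0 := by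
    rintro rfl
    simp at h3
    linarith
  have h6 : v₀ = 0 := by
    have : κ * r * v₁ * v₀ = 0 := by linear_combination (h4 - h2 - h3) / 2
    exact (mul_eq_zero.1 this).resolve_left (mul_ne_zero hκ h5)
  have h7 : v₁ ^ 2 = c := by
    apply mul_left_cancel₀ hκ
    rw [h6] at h2
    linear_combination h3 - h2
  refine ⟨by rw [← h7]; positivity, h7, ?_⟩
  rw [← h7]
  linear_combination -h3

/-- At a pair of corresponding points the differential preserves P² up to `c` and is conformal, so
it scales ∂/∂y by v with the same square v² = c. The conformal factors are then related, and v is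
the slope of y' along the meridian φ = 0. -/
theorem IsPolarHp.exists_conformal_deriv (h : IsPolarHp a p ε S) (h' : IsPolarHp a' p' ε' S')
    (hK : ∀ ξ, S.kinetic (cotangentLift φ ξ) = κ * S'.kinetic ξ) {c : ℝ}
    (hc : ∀ z p : E2, angularMomentum !₂[0, 0, 1] (cotangentLift φ.symm (polarPoint (z, p))) ^ 2 =
      c * p 0 ^ 2) {y : ℝ} {z' : E2} (hz' : φ (polarMap !₂[0, y]) = polarMap z') :
    ∃ v, 0 < c ∧ v ^ 2 = c ∧ ε' * hpFactor a' p' y = c * κ * (ε * hpFactor a p (z' 1)) ∧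
      HasDerivAt (fun t => (φ (polarMap !₂[0, t]) : E3) 2) (v / Real.cosh (z' 1) ^ 2) y := by
  set u := polarDifferential φ !₂[0, y] z' !₂[1, 0] with hu
  set v := polarDifferential φ !₂[0, y] z' !₂[0, 1] with hv
  have hlift : ∀ P Q : ℝ, cotangentLift φ.symm (polarPoint (z', !₂[P, Q])) =
      polarPoint (!₂[0, y], !₂[P * u 0 + Q * u 1, P * v 0 + Q * v 1]) := by
    intro P Q
    rw [cotangentLift_symm_polarPoint hz', ← hu, ← hv]
    have hin : ∀ x : E2, inner ℝ (!₂[P, Q] : E2) x = P * x 0 + Q * x 1 := by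
      intro x
      simp [PiLp.inner_apply, Fin.sum_univ_two]
      ring
    rw [hin, hin]
  have hP : ∀ P Q : ℝ, (P * u 0 + Q * u 1) ^ 2 = c * P ^ 2 := by
    intro P Q
    have h1 := hc z' !₂[P, Q]
    rw [hlift] at h1
    have h2 := inPolar_angularMomentum_axis (!₂[0, y], !₂[P * u 0 + Q * u 1, P * v 0 + Q * v 1])
    rw [inPolar] at h2
    rw [h2] at h1
    exact h1
  have hQ : ∀ P Q : ℝ, κ * (1 / 2 * ((P * u 0 + Q * u 1) ^ 2 / (ε' * hpFactor a' p' y) +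
      (P * v 0 + Q * v 1) ^ 2 / (ε' * hpFactor a' p' y))) =
        1 / 2 * (P ^ 2 / (ε * hpFactor a p (z' 1)) + Q ^ 2 / (ε * hpFactor a p (z' 1))) := by
    intro P Q
    have h1 := hK (cotangentLift φ.symm (polarPoint (z', !₂[P, Q])))
    rw [cotangentLift_cotangentLift_symm, hlift] at h1
    have h2 := h.metric.inPolar_kinetic (z', !₂[P, Q])
    have h3 := h'.metric.inPolar_kinetic
      (!₂[0, y], !₂[P * u 0 + Q * u 1, P * v 0 + Q * v 1])
    rw [inPolar] at h2 h3
    rw [h2, h3] at h1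
    exact h1.symm
  obtain ⟨h1, h2, h3⟩ := conformal_of_preserves_square (h.metric.1 (z' 1)) (h'.metric.1 y) hP hQ
  refine ⟨v 1, h1, h2, h3, ?_⟩
  refine (HasFDerivAt.comp_hasDerivAt (f := fun t => (!₂[0, t] : E2)) y
    ((contDiff_height (φ := φ)).differentiable (by simp) _).hasFDerivAt
      (hasDerivAt_vec_snd y 0)).congr_deriv ?_
  have h5 : (EuclideanSpace.single 1 1 : E2) = !₂[0, 1] := by
    ext i
    fin_cases i <;> simp
  rw [h5]
  exact fderiv_height hz' _

theorem hasDerivAt_artanh_comp {T : ℝ → ℝ} {v x y : ℝ} (hx : T y = Real.tanh x)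
    (hT : HasDerivAt T (v / Real.cosh x ^ 2) y) : HasDerivAt (fun t => Real.artanh (T t)) v y := by
  have h7 : T y ^ 2 < 1 := by
    rw [hx, sq_lt_one_iff_abs_lt_one]
    exact Real.abs_tanh_lt_one _
  refine ((hasDerivAt_artanh h7).comp y hT).congr_deriv ?_
  have hcosh := Real.cosh_pos x
  have h8 : 1 - T y ^ 2 = (Real.cosh x ^ 2)⁻¹ := by
    rw [hx, Real.tanh_eq_sinh_div_cosh]
    field_simp
    linarith [Real.cosh_sq x]
  rw [h8]
  field_simp

/-- Since parallels go to parallels, y' is a function `Y` of y alone. It is recovered as artanh of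
the height of the image of the meridian φ = 0, and the constant `c` is the same at all points. -/
theorem IsPolarHp.exists_reparametrization (h : IsPolarHp a p ε S) (hadm : Admissible a p)
    (h' : IsPolarHp a' p' ε' S')
    (hK : ∀ ξ, S.kinetic (cotangentLift φ ξ) = κ * S'.kinetic ξ) :
    ∃ (Y : ℝ → ℝ) (c : ℝ), 0 < c ∧ (∀ z z', φ (polarMap z) = polarMap z' → z' 1 = Y (z 1)) ∧
      (∀ y, ∃ v, v ^ 2 = c ∧ HasDerivAt Y v y) ∧
        ∀ y, ε' * hpFactor a' p' y = c * κ * (ε * hpFactor a p (Y y)) := by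
  obtain ⟨T, hT⟩ : ∃ T : ℝ → ℝ, ∀ y, (φ (polarMap !₂[0, y]) : E3) 2 = T y := ⟨_, fun _ => rfl⟩
  have hheight : ∀ z z', φ (polarMap z) = polarMap z' → T (z 1) = Real.tanh (z' 1) := by
    intro z z' hz
    have h1 := h.height_eq hadm h'.metric hK (z 0) 0 (z 1)
    rw [← eq_vec_two, hz, polarMap_two, hT] at h1
    exact h1.symm
  have hY : ∀ z z', φ (polarMap z) = polarMap z' → z' 1 = Real.artanh (T (z 1)) := by
    intro z z' hz
    rw [hheight z z' hz, Real.artanh_tanh]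
  obtain ⟨c, hc⟩ := h.exists_angularMomentum_sq hadm h'.metric hK
  have hmain : ∀ y, ∃ v, 0 < c ∧ v ^ 2 = c ∧
      ε' * hpFactor a' p' y = c * κ * (ε * hpFactor a p (Real.artanh (T y))) ∧
        HasDerivAt (fun y => Real.artanh (T y)) v y := by
    intro y
    obtain ⟨z', hz'⟩ := h.mem_range_polarMap hadm h'.metric hK !₂[0, y]
    have hz1 : z' 1 = Real.artanh (T y) := hY !₂[0, y] z' hz'.symm
    obtain ⟨v, h1, h2, h3, h4⟩ := h.exists_conformal_deriv h' hK hc hz'.symm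
    simp only [hT] at h4
    rw [hz1] at h3
    exact ⟨v, h1, h2, h3, hasDerivAt_artanh_comp (hheight !₂[0, y] z' hz'.symm) h4⟩
  obtain ⟨-, h0, -⟩ := hmain 0
  refine ⟨fun y => Real.artanh (T y), c, h0, hY, fun y => ?_, fun y => ?_⟩
  · obtain ⟨v, -, h2, -, h4⟩ := hmain y
    exact ⟨v, h2, h4⟩
  · obtain ⟨v, -, -, h3, -⟩ := hmain y
    exact h3

/-- The derivative is ±√c and never zero. By the intermediate value property of derivatives its sign
is constant, although its continuity is not assumed. -/
theorem exists_eq_mul_add_of_deriv_sq {Y : ℝ → ℝ} {c : ℝ} (hc : 0 < c)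
    (h : ∀ y, ∃ v, v ^ 2 = c ∧ HasDerivAt Y v y) : ∃ s, s ^ 2 = c ∧ ∀ y, Y y = s * y + Y 0 := by
  choose v hv hY using h
  have hne : ∀ y ∈ Set.univ, v y ≠ 0 := by
    intro y _ h0
    have := hv y
    rw [h0] at this
    norm_num at this
    exact hc.ne this
  have hconst : ∃ s, s ^ 2 = c ∧ ∀ y, v y = s := by
    have hr : √c ^ 2 = c := Real.sq_sqrt hc.le
    rcases hasDerivWithinAt_forall_lt_or_forall_gt_of_forall_ne convex_univ
      (fun y _ => (hY y).hasDerivWithinAt) hne with h | h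
    · refine ⟨-√c, by rw [neg_sq, hr], fun y => ?_⟩
      have := h y trivial
      rw [← hv y, Real.sqrt_sq_eq_abs, abs_of_neg this, neg_neg]
    · refine ⟨√c, hr, fun y => ?_⟩
      have := h y trivial
      rw [← hv y, Real.sqrt_sq this.le]
  obtain ⟨s, hs, hvs⟩ := hconst
  refine ⟨s, hs, fun y => ?_⟩
  have h1 : ∀ y, HasDerivAt (fun y => Y y - s * y) 0 y := fun y => by
    have := (hY y).fun_sub ((hasDerivAt_id' y).const_mul s)
    rw [hvs] at this
    simpa using this
  have h2 := eq_of_deriv_zero h1 y 0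
  simp only [mul_zero, sub_zero] at h2
  linarith

/-- On the image of the equator the potential of `S` vanishes. If that image were not the equator,
cos φ would be zero on it, leaving only two possible positions for three distinct points. -/
theorem IsPolarHp.reparametrization_zero (h : IsPolarHp a p ε S) (hadm : Admissible a p)
    (h' : IsPolarHp a' p' ε' S')
    (hK : ∀ ξ, S.kinetic (cotangentLift φ ξ) = κ * S'.kinetic ξ)
    (hU : ∀ x, S.potential (φ x) = κ' * S'.potential x) {Y : ℝ → ℝ}
    (hY : ∀ z z', φ (polarMap z) = polarMap z' → z' 1 = Y (z 1)) : Y 0 = 0 := by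
  by_contra hne
  have hε : ε ≠ 0 := left_ne_zero_of_mul (h.metric.1 0).ne'
  have hcos : ∀ θ, ∃ s : ℝ, s * s = 1 ∧
      (φ (polarMap !₂[θ, 0]) : E3) = !₂[0, s / Real.cosh (Y 0), Real.sinh (Y 0) / Real.cosh (Y 0)] := by
    intro θ
    obtain ⟨z', hz'⟩ := h.mem_range_polarMap hadm h'.metric hK !₂[θ, 0]
    have h1 : z' 1 = Y 0 := hY _ _ hz'.symm
    have h2 := hU (polarMap !₂[θ, 0])
    have h3 : hpPotential a' p' ((!₂[θ, 0] : E2) 1) = 0 := hpPotential_zero h'.gt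
    rw [← hz', h.potential, h'.potential, h1, h3] at h2
    have h4 : ε * hpPotential a p (Y 0) * Real.cos (z' 0) = 0 := by rw [h2]; ring
    have h5 := (mul_eq_zero.1 h4).resolve_left (mul_ne_zero hε (h.hpPotential_ne_zero hadm hne))
    refine ⟨Real.sin (z' 0), ?_, ?_⟩
    · have := Real.sin_sq_add_cos_sq (z' 0)
      rw [h5] at this
      linear_combination this
    · rw [← hz', polarMap_coe, h1, h5, zero_div]
  obtain ⟨s₀, hs₀, e₀⟩ := hcos 0
  obtain ⟨s₁, hs₁, e₁⟩ := hcos Real.pi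
  obtain ⟨s₂, hs₂, e₂⟩ := hcos (Real.pi / 2)
  have key : ∀ {θ θ' s s' : ℝ}, Real.cos θ ≠ Real.cos θ' → (φ (polarMap !₂[θ, 0]) : E3) =
      !₂[0, s / Real.cosh (Y 0), Real.sinh (Y 0) / Real.cosh (Y 0)] →
      (φ (polarMap !₂[θ', 0]) : E3) =
        !₂[0, s' / Real.cosh (Y 0), Real.sinh (Y 0) / Real.cosh (Y 0)] → s ≠ s' := by
    rintro θ θ' s s' hne h1 h2 rfl
    exact polarMap_ne_of_cos_ne hne (φ.injective (Subtype.ext (h1.trans h2.symm)))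
  have n₁ : s₀ ≠ s₁ := key (by norm_num) e₀ e₁
  have n₂ : s₀ ≠ s₂ := key (by norm_num) e₀ e₂
  have n₃ : s₁ ≠ s₂ := key (by norm_num) e₁ e₂
  rcases mul_self_eq_one_iff.1 hs₀ with rfl | rfl <;>
    rcases mul_self_eq_one_iff.1 hs₁ with rfl | rfl <;>
    rcases mul_self_eq_one_iff.1 hs₂ with rfl | rfl <;> simp_all

/-- Both conformal factors decay like 1/cosh² y. Hence cosh(sy) is bounded by a multiple of cosh y,
and the same holds with s⁻¹. -/
theorem IsPolarHp.abs_slope_eq_one (h : IsPolarHp a p ε S) (hadm : Admissible a p)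
    (h' : IsPolarHp a' p' ε' S') (hadm' : Admissible a' p') {s C : ℝ} (hs : s ≠ 0) (hC : 0 < C)
    (heq : ∀ y, ε' * hpFactor a' p' y = C * (ε * hpFactor a p (s * y))) : |s| = 1 := by
  obtain ⟨m, N, hm, hb⟩ := exists_bounds_hpFactor hadm
  obtain ⟨m', N', hm', hb'⟩ := exists_bounds_hpFactor hadm'
  have habs : ∀ {a p ε : ℝ} {S : ConservativeSystem 2 S2}, IsPolarHp a p ε S → ∀ y,
      |hpFactor a p y| = ε * hpFactor a p y := by
    intro a p ε S h y
    have h1 : |ε| = 1 := by rcases mul_self_eq_one_iff.1 h.sign with h | h <;> simp [h]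
    have h2 := abs_of_pos (h.metric.1 y)
    rw [abs_mul, h1, one_mul] at h2
    exact h2
  simp only [habs h, habs h'] at hb hb'
  have hN : 0 < N := hm.trans_le ((hb 0).1.trans (hb 0).2)
  have hN' : 0 < N' := hm'.trans_le ((hb' 0).1.trans (hb' 0).2)
  have hroot : ∀ {x y D : ℝ}, 0 ≤ D → x ^ 2 ≤ D * Real.cosh y ^ 2 → x ≤ √D * Real.cosh y := by
    intro x y D hD hx
    have hcy := Real.cosh_pos y
    refine le_of_sq_le_sq ?_ (by positivity)
    rw [mul_pow, Real.sq_sqrt hD]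
    exact hx
  apply le_antisymm
  · refine abs_le_one_of_cosh_le (C := √(C * N / m')) fun y => hroot (by positivity) ?_
    have h1 := (hb (s * y)).2
    have h2 := (hb' y).1
    rw [heq] at h2
    have hl := h.metric.1 (s * y)
    set l := ε * hpFactor a p (s * y)
    have hl' : 0 < l := hl
    rw [div_mul_eq_mul_div, le_div_iff₀ hm']
    have h3 : 0 < Real.cosh (s * y) ^ 2 := pow_pos (Real.cosh_pos _) 2
    have h4 : 0 < Real.cosh y ^ 2 := pow_pos (Real.cosh_pos _) 2
    calc Real.cosh (s * y) ^ 2 * m' ≤ Real.cosh (s * y) ^ 2 * (C * l * Real.cosh y ^ 2) :=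
          mul_le_mul_of_nonneg_left h2 h3.le
      _ = l * Real.cosh (s * y) ^ 2 * (C * Real.cosh y ^ 2) := by ring
      _ ≤ N * (C * Real.cosh y ^ 2) := mul_le_mul_of_nonneg_right h1 (by positivity)
      _ = C * N * Real.cosh y ^ 2 := by ring
  · have h5 : |s⁻¹| ≤ 1 := by
      refine abs_le_one_of_cosh_le (C := √(N' / (C * m))) fun y => hroot (by positivity) ?_
      have hsy : s * (s⁻¹ * y) = y := by field_simp
      have h1 := (hb' (s⁻¹ * y)).2
      have h2 := (hb y).1
      rw [heq, hsy] at h1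
      have hl := h.metric.1 y
      set l := ε * hpFactor a p y
      have hl' : 0 < l := hl
      rw [div_mul_eq_mul_div, le_div_iff₀ (by positivity)]
      have h3 : 0 < Real.cosh (s⁻¹ * y) ^ 2 := pow_pos (Real.cosh_pos _) 2
      have h4 : 0 < Real.cosh y ^ 2 := pow_pos (Real.cosh_pos _) 2
      calc Real.cosh (s⁻¹ * y) ^ 2 * (C * m)
          ≤ Real.cosh (s⁻¹ * y) ^ 2 * (C * (l * Real.cosh y ^ 2)) :=
            mul_le_mul_of_nonneg_left (mul_le_mul_of_nonneg_left h2 hC.le) h3.le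
        _ = C * l * Real.cosh (s⁻¹ * y) ^ 2 * Real.cosh y ^ 2 := by ring
        _ ≤ N' * Real.cosh y ^ 2 := mul_le_mul_of_nonneg_right h1 h4.le
    rw [abs_inv] at h5
    exact (inv_le_one₀ (abs_pos.2 hs)).1 h5

/-- The angle of the image point is unknown, so only an inequality results, from cos φ = 1 on the
source side and |cos| ≤ 1 on the target side. Applied also to the inverse map it becomes an
equality. -/
theorem IsPolarHp.abs_potential_le (h : IsPolarHp a p ε S) (hadm : Admissible a p)
    (h' : IsPolarHp a' p' ε' S')
    (hK : ∀ ξ, S.kinetic (cotangentLift φ ξ) = κ * S'.kinetic ξ)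
    (hU : ∀ x, S.potential (φ x) = κ' * S'.potential x) {Y : ℝ → ℝ}
    (hY : ∀ z z', φ (polarMap z) = polarMap z' → z' 1 = Y (z 1)) (y : ℝ) :
    |κ'| * |hpPotential a' p' y| ≤ |hpPotential a p (Y y)| := by
  have h1 : |ε| = 1 := by rcases mul_self_eq_one_iff.1 h.sign with h | h <;> simp [h]
  have h1' : |ε'| = 1 := by rcases mul_self_eq_one_iff.1 h'.sign with h | h <;> simp [h]
  obtain ⟨z', hz'⟩ := h.mem_range_polarMap hadm h'.metric hK !₂[0, y]
  have h2 : z' 1 = Y y := hY _ _ hz'.symm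
  have h3 := hU (polarMap !₂[0, y])
  have h4 : S'.potential (polarMap !₂[0, y]) = ε' * hpPotential a' p' y * Real.cos 0 :=
    h'.potential !₂[0, y]
  rw [← hz', h.potential, h4, h2, Real.cos_zero, mul_one] at h3
  have h5 := congrArg abs h3
  rw [abs_mul, abs_mul, abs_mul, abs_mul, h1, h1', one_mul, one_mul] at h5
  rw [← h5]
  exact mul_le_of_le_one_right (abs_nonneg _) (Real.abs_cos_le_one _)

theorem abs_hpPotential_neg (ha : -2 < a) (y : ℝ) :
    |hpPotential a p (-y)| = |hpPotential a p y| := by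
  have h : hpPotential a p (-y) = -hpPotential a p y := by
    rw [hpPotential, hpPotential, invCoord_neg ha, coordSpeed_neg ha]
    ring
  rw [h, abs_neg]

/-- The reparametrization is Y(y) = ±y, under which f and |W| are invariant. So f' is proportional
to f and |W'| to |W| as functions of y; their product yields `a`, and f alone then yields `p`. -/
theorem IsPolarHp.eq_of_equivalent (h : IsPolarHp a p ε S) (hadm : Admissible a p)
    (h' : IsPolarHp a' p' ε' S') (hadm' : Admissible a' p') (he : S.Equivalent S') :
    a = a' ∧ p = p' := by
  obtain ⟨φ, κ, κ', hκ, hκ', hK, hU⟩ := he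
  have hK' : ∀ ξ, S'.kinetic (cotangentLift φ.symm ξ) = κ⁻¹ * S.kinetic ξ := by
    intro ξ
    have h1 := hK (cotangentLift φ.symm ξ)
    rw [cotangentLift_cotangentLift_symm] at h1
    rw [h1]
    field_simp
  have hU' : ∀ x, S'.potential (φ.symm x) = κ'⁻¹ * S.potential x := by
    intro x
    have h1 := hU (φ.symm x)
    rw [φ.apply_symm_apply] at h1
    rw [h1]
    field_simp
  obtain ⟨Y, c, hc, hY, hd, hf⟩ := h.exists_reparametrization hadm h' hK
  obtain ⟨Z, c', hc', hZ, -, -⟩ := h'.exists_reparametrization hadm' h hK'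
  obtain ⟨s, hs, hYs⟩ := exists_eq_mul_add_of_deriv_sq hc hd
  have hY0 := h.reparametrization_zero hadm h' hK hU hY
  have hlin : ∀ y, Y y = s * y := fun y => by rw [hYs, hY0, add_zero]
  have hs0 : s ≠ 0 := by
    rintro rfl
    norm_num at hs
    exact hc.ne hs
  have hκpos : 0 < c * κ := by
    have h1 := hf 0
    have h2 := h'.metric.1 0
    have h3 := h.metric.1 (Y 0)
    beta_reduce at h2 h3
    rw [h1] at h2
    exact (mul_pos_iff_of_pos_right h3).1 h2
  have hs1 : |s| = 1 := h.abs_slope_eq_one hadm h' hadm' hs0 hκpos fun y => by rw [hf, hlin]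
  have heven : ∀ y, hpFactor a p (Y y) = hpFactor a p y ∧
      |hpPotential a p (Y y)| = |hpPotential a p y| := by
    intro y
    rw [hlin]
    rcases eq_or_eq_neg_of_abs_eq hs1 with rfl | rfl
    · rw [one_mul]
      exact ⟨rfl, rfl⟩
    · rw [neg_one_mul]
      exact ⟨hpFactor_neg h.gt y, abs_hpPotential_neg h.gt y⟩
  -- The reparametrization `Z` of the inverse diffeomorphism satisfies y = s Z(y), so it is also y ↦
  -- ±y.
  have hZY : ∀ y, |hpPotential a' p' (Z y)| = |hpPotential a' p' y| := by
    intro y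
    obtain ⟨z', hz'⟩ := h'.mem_range_polarMap hadm' h.metric hK' !₂[0, y]
    have h1 : z' 1 = Z y := hZ _ _ hz'.symm
    have h2 : φ (polarMap z') = polarMap !₂[0, y] := by
      rw [hz']
      exact φ.apply_symm_apply _
    have h3 : y = s * Z y := by
      rw [← h1, ← hlin]
      exact hY _ _ h2
    rcases eq_or_eq_neg_of_abs_eq hs1 with rfl | rfl
    · rw [one_mul] at h3
      rw [← h3]
    · rw [neg_one_mul] at h3
      rw [h3, abs_hpPotential_neg h'.gt, ← h3]
  have hpot : ∀ y, |hpPotential a p y| = |κ'| * |hpPotential a' p' y| := by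
    intro y
    apply le_antisymm
    · have h1 := h'.abs_potential_le hadm' h hK' hU' hZ y
      rw [hZY, abs_inv] at h1
      have h2 := abs_pos.2 hκ'
      rwa [inv_mul_le_iff₀ h2] at h1
    · have h1 := h.abs_potential_le hadm h' hK hU hY y
      rwa [(heven y).2] at h1
  have hfac : ∀ y, hpFactor a' p' y = ε' * c * κ * ε * hpFactor a p y := by
    intro y
    have h1 := hf y
    rw [(heven y).1] at h1
    linear_combination ε' * h1 - hpFactor a' p' y * h'.sign
  set k := ε' * c * κ * ε with hk
  have hk0 : k ≠ 0 := by
    intro h0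
    have h1 := hfac 0
    rw [h0, zero_mul] at h1
    exact right_ne_zero_of_mul (h'.metric.1 0).ne' h1
  have hprod : ∀ y, |hpProduct a y| = |κ'| * |k|⁻¹ * |hpProduct a' y| := by
    intro y
    have h1 := congrArg abs (hpFactor_mul_hpPotential h.gt (h.hpGap_ne_zero y))
    have h2 := congrArg abs (hpFactor_mul_hpPotential h'.gt (h'.hpGap_ne_zero y))
    rw [hfac y] at h2
    rw [abs_mul, abs_mul, hpot] at h1
    rw [abs_mul, abs_mul k, abs_mul (-(1 / 2))] at h2
    have h3 : |(-(1 / 2) : ℝ)| = 1 / 2 := by norm_num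
    rw [h3] at h1 h2
    have h4 := abs_pos.2 hk0
    field_simp
    linear_combination (-2 * |k|) * h1 + 2 * |κ'| * h2
  obtain ⟨k', hk'⟩ := hpProduct_eq_mul_of_abs h.gt hadm.ne_two h'.gt hadm'.ne_two hprod
  have haa := eq_of_hpProduct_eq_mul h.gt hadm.ne_two h'.gt hk'
  subst haa
  exact ⟨rfl, (eq_of_hpFactor_eq_mul h.gt hadm.ne_two hfac).symm⟩

end Equivalence

end

/-! ### The main theorem. -/

theorem mainTheorem2 :
    (∀ a p : ℝ, Admissible a p →
      IsCylindricalCoordinates (cylinderMap a) ∧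
      (∃ S : ConservativeSystem 2 S2, IsSystemHp a p S) ∧
      ∀ S : ConservativeSystem 2 S2, IsSystemHp a p S →
        (∃ F : CotangentBundle 2 S2 → ℝ,
          IsIntegralOfDegree 4 F S.hamiltonian ∧ IsGenericallyIndependent F S.hamiltonian) ∧
        (¬ ∃ F : CotangentBundle 2 S2 → ℝ, IsIntegralOfDegree 1 F S.hamiltonian) ∧
        (¬ ∃ F : CotangentBundle 2 S2 → ℝ, IsIntegralOfDegree 2 F S.hamiltonian) ∧
        ¬ S.Equivalent kovalevskaya ∧
        ∀ B₁ B₂ : ℝ, ¬ S.Equivalent (goryachev B₁ B₂)) ∧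
    (∀ a p a' p' : ℝ, Admissible a p → Admissible a' p' → (a, p) ≠ (a', p') →
      ∀ S S' : ConservativeSystem 2 S2, IsSystemHp a p S → IsSystemHp a' p' S' →
        ¬ S.Equivalent S') := by
  refine ⟨fun a p hadm => ⟨isCylindricalCoordinates_cylinderMap hadm.gt, exists_isSystemHp hadm,
    fun S hS => ?_⟩, fun a p a' p' hadm hadm' hne S S' hS hS' he => ?_⟩
  · obtain ⟨ε, h⟩ := hS.isPolarHp hadm.gt
    exact ⟨h.exists_integral_of_degree_four, fun ⟨F, hF⟩ => h.not_isIntegralOfDegree_one hadm F hF,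
      fun ⟨F, hF⟩ => h.not_isIntegralOfDegree_two hadm F hF, h.not_equivalent_goryachev hadm 0 0,
      h.not_equivalent_goryachev hadm⟩
  · obtain ⟨ε, h⟩ := hS.isPolarHp hadm.gt
    obtain ⟨ε', h'⟩ := hS'.isPolarHp hadm'.gt
    obtain ⟨rfl, rfl⟩ := h.eq_of_equivalent hadm h' hadm' he
    exact hne rfl
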